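/- **Setting.** Let $\mathbf X=(\mathbf x_1,\dots,\mathbf x_p)\in\mathbb R^{n\times p}$ be a fixed design, $\mathbf y=\mathbf X\boldsymbol\beta+\boldsymbol\varepsilon$ with $\boldsymbol\varepsilon\sim N(0,\sigma^2\mathbf I_n)$, $\sigma>0$, $A^o=\{j:\beta_j\ne0\}$, $d^o=|A^o|$, $\beta_*=\min_{j\in A^o}|\beta_j|$, $\Sigma_A=\mathbf X_A'\mathbf X_A/n$, and let $w_j^o$, $j\in A^o$, be the diagonal elements of $\Sigma_{A^o}^{-1}$. Let $\widehat{\boldsymbol\beta}^o$ be the oracle LSE, the minimizer of $\|\mathbf y-\mathbf X\mathbf b\|^2$ subject to $b_j=0$ for $j\notin A^o$. Let $\rho(t;\lambda)$ be a penalty, nondecreasing in $t\ge0$ with a continuous derivative $\dot\rho(t;\lambda)$ in $t>0$, such that for all $\lambda\ge\lambda_1$ with $\lambda>0$: $\dot\rho(0+;\lambda)=\lambda$; $\dot\rho(t;\lambda)\le\lambda I\{t\le\gamma\lambda\}$ for $t>0$; and $\dot\rho(t_1;\lambda)-\dot\rho(t_2;\lambda)\le\kappa(t_2-t_1)$ for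 $0<t_1<t_2$ (that is, $\ddot\rho\ge-\kappa$), where $\kappa\ge0$. A pair $\lambda\oplus\mathbf b$ with $\lambda\ge0$ is a critical point if $\mathbf x_j'(\mathbf y-\mathbf X\mathbf b)/n=\mathrm{sgn}(b_j)\dot\rho(|b_j|;\lambda)$ when $b_j\neq0$ and $|\mathbf x_j'(\mathbf y-\mathbf X\mathbf b)/n|\le\lambda$ when $b_j=0$. Let $\lambda^{(x)}\oplus\widehat{\boldsymbol\beta}^{(x)}$, $x\ge0$, be (almost surely) a continuous path of critical points with $\widehat{\boldsymbol\beta}^{(0)}=\mathbf 0$ and $\lim_{x\to\infty}\lambda^{(x)}=0$. The path solution at level $\lambda$ is $\widehat{\boldsymbol\beta}(\lambda)=\widehat{\boldsymbol\beta}^{(x_\lambda)}$, $x_\lambda=\inf\{x\ge0:\lambda^{(x)}\le\lambda\}$. Let $\widehat\lambda$ be a deterministic or random penalty level, $\widehat{\boldsymbol\beta}=\widehat{\boldsymbol\beta}(\widehat\lambda)$ and $\widehat A=\{j:\widehat\beta_j\ne0\}$. Suppose the sparse Riesz condition holds with a positive integer rank $d^*$ and $c^*\ge c_*>\kappa$: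 $c_*\le\min_{\|\mathbf u\|=1}\|\Sigma_A\mathbf u\|$ and the largest eigenvalue of $\Sigma_A$ is at most $c^*$, for every nonempty $A\subseteq\{1,\dots,p\}$ with $|A|\le d^*$. For $0<\alpha<1$ let $w=(2-\alpha)/(c_*c^*/\kappa^2-1)$ ($w=0$ if $\kappa=0$) and $$K_*=\inf_{0<t<(2/w+1+\alpha)/\alpha}\frac{(1+w\{1+(\alpha/t)/(1-\alpha)\})c^*/c_*-1}{\{2+w(1+\alpha-t\alpha)\}(1-\alpha)} .$$ Suppose $d^o\le d^*/(1+K_*)$ and put $m=d^*-d^o$. With $\Phi$ the $N(0,1)$ distribution function, let $$\pi_{n,1}(\lambda)=2\sum_{j\notin A^o}\Phi\Big(-\frac{n\lambda}{\sigma\|\mathbf x_j\|}\Big),\quad \pi_{n,2}(\lambda)=\sum_{j\in A^o}\Phi\Big(\frac{\gamma\lambda-|\beta_j|}{\sigma(w_j^o/n)^{1/2}}\Big),\quad \pi_{n,3}(\lambda)=\binom{p-d^o}{m}P\{\sigma^2\chi^2_m>mn\lambda^2\}.$$ **(i)** Let $\lambda_1>0$, $\lambda_3\ge0$ and $\lambda_2\ge\max\{\lambda_1,(\sqrt{c^*}/\alpha)\lambda_3\}$.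 Suppose $\beta_*\ge\gamma\lambda_2$ and $P\{\lambda_1\le\widehat\lambda\le\lambda_2\}=1$. Then $$P\{\widehat A\ne A^o\}\le P\{\widehat{\boldsymbol\beta}\ne\widehat{\boldsymbol\beta}^o\text{ or }\mathrm{sgn}(\widehat{\boldsymbol\beta})\ne\mathrm{sgn}(\boldsymbol\beta)\}\le\pi_{n,1}(\lambda_1)+\pi_{n,2}(\lambda_2)+\pi_{n,3}(\lambda_3).$$ **(ii)** Let $0<\epsilon\le1$, $d^*\le p$, $\|\mathbf x_j\|^2=n$ for all $j$, and let $\widetilde p_\epsilon$ be the solution with $2\log\widetilde p_\epsilon\ge1$ of $2\log\widetilde p_\epsilon-1-\log(2\log\widetilde p_\epsilon)=(2/m)\{\log\binom{p-d^o}{m}+\log(1/\epsilon)\}$. Let $\lambda_{1,\epsilon}=\sigma\sqrt{(2/n)\log((p-d^o)/\epsilon)}$, $\lambda_{3,\epsilon}=\sigma\sqrt{(2/n)\log\widetilde p_\epsilon}$, $\lambda_{2,\epsilon}\ge\max\{\lambda_{1,\epsilon},(\sqrt{c^*}/\alpha)\lambda_{3,\epsilon}\}$ and $a_n\ge d^o$;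 the penalty conditions are assumed with $\lambda_1=\lambda_{1,\epsilon}$. Suppose $|\beta_j|\ge\gamma\lambda_{2,\epsilon}+\sigma\sqrt{w_j^o(2/n)\log(a_n/\epsilon)}$ for $j\in A^o$. If $P\{\lambda_{1,\epsilon}\le\widehat\lambda\le\lambda_{2,\epsilon}\}=1$, then $$P\{\widehat A\ne A^o\}\le P\{\widehat{\boldsymbol\beta}\ne\widehat{\boldsymbol\beta}^o\text{ or }\mathrm{sgn}(\widehat{\boldsymbol\beta})\ne\mathrm{sgn}(\boldsymbol\beta)\}\le\epsilon\Big\{\frac1{1\vee J_1}+\frac{d^o/(2a_n)}{1\vee J_2}+\frac{(4\log\widetilde p_\epsilon)^{-1/2}}{1\vee J_3}\Big\}\le\Big(\frac32+\frac1{\sqrt2}\Big)\epsilon,$$ where $J_1=\sqrt{\pi\log((p-d^o)/\epsilon)}$, $J_2=\sqrt{\pi\log(a_n/\epsilon)}$ and $J_3=\{2\log\widetilde p_\epsilon-1+1/m\}\sqrt{m\pi}/\sqrt{4\log\widetilde p_\epsilon}$ (when $d^o=0$ the second term is $0$). Consequently, along any sequence of such problems (all quantities, including $n$, $p$, $\boldsymbol\beta$,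 $\sigma$, the penalty, $d^*$, $c_*$, $c^*$, $\alpha$ and $\epsilon$, may vary) that satisfies the assumptions of (ii) except the one on $\widehat\lambda$, if $\epsilon^{-1}\vee\min(J_1,J_2,J_3)\to\infty$ and $P\{\lambda_{1,\epsilon}\le\widehat\lambda\le\lambda_{2,\epsilon}\}\to1$, then $P\{\widehat A=A^o\}\to1$. -/

import Mathlib

open MeasureTheory ProbabilityTheory Filter Topology

universe u

noncomputable section

namespace PLUS

/-! ### The design: Gram matrices, sparse Riesz condition, oracle least squares -/

/-- The normalized Gram matrix `Σ = X'X / n`. -/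
def gram {n p : ℕ} (X : Matrix (Fin n) (Fin p) ℝ) : Matrix (Fin p) (Fin p) ℝ :=
  (n : ℝ)⁻¹ • (X.transpose * X)

/-- The sub-Gram matrix `Σ_A = X_A'X_A / n`. -/
def subGram {n p : ℕ} (X : Matrix (Fin n) (Fin p) ℝ) (A : Finset (Fin p)) :
    Matrix A A ℝ :=
  (gram X).submatrix (fun j => j.1) (fun j => j.1)

/-- The sparse Riesz condition of rank `d` with constants `cLow`, `cUp`: for every `A` with
`|A| ≤ d`, `cLow ≤ min_{‖u‖ = 1} ‖Σ_A u‖` and the largest eigenvalue of `Σ_A` is at most `cUp`. -/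
def SparseRiesz {n p : ℕ} (X : Matrix (Fin n) (Fin p) ℝ) (d : ℕ) (cLow cUp : ℝ) : Prop :=
  ∀ A : Finset (Fin p), A.card ≤ d →
    (∀ v : EuclideanSpace ℝ A, ‖v‖ = 1 →
      cLow ≤ ‖(WithLp.toLp 2 ((subGram X A).mulVec v.ofLp) : EuclideanSpace ℝ A)‖) ∧
    (∀ c : ℝ, Module.End.HasEigenvalue (Matrix.toLin' (subGram X A)) c → c ≤ cUp)

/-- The matrix-vector product `X b`, as a vector with the Euclidean norm. -/
def applyX {n p : ℕ} (X : Matrix (Fin n) (Fin p) ℝ) (b : EuclideanSpace ℝ (Fin p)) :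
    EuclideanSpace ℝ (Fin n) :=
  WithLp.toLp 2 (X.mulVec b.ofLp)

/-- The `j`-th column `x_j` of the design matrix. -/
def col {n p : ℕ} (X : Matrix (Fin n) (Fin p) ℝ) (j : Fin p) : EuclideanSpace ℝ (Fin n) :=
  WithLp.toLp 2 (fun i => X i j)

/-- `{j : b_j ≠ 0}`. -/
def supp {p : ℕ} (b : EuclideanSpace ℝ (Fin p)) : Finset (Fin p) :=
  Finset.univ.filter (fun j => b j ≠ 0)

/-- `b` minimizes `‖y - X b‖²` among all vectors that vanish outside `B`. -/
def IsOracleLSE {n p : ℕ} (X : Matrix (Fin n) (Fin p) ℝ) (y : EuclideanSpace ℝ (Fin n))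
    (B : Finset (Fin p)) (b : EuclideanSpace ℝ (Fin p)) : Prop :=
  (∀ j, j ∉ B → b j = 0) ∧
    ∀ b' : EuclideanSpace ℝ (Fin p), (∀ j, j ∉ B → b' j = 0) →
      ‖y - applyX X b‖ ^ 2 ≤ ‖y - applyX X b'‖ ^ 2

/-- The least squares estimator restricted to `B`: a minimizer (it always exists, and is unique
when `Σ_B` is invertible). -/
def oracleLSE {n p : ℕ} (X : Matrix (Fin n) (Fin p) ℝ) (y : EuclideanSpace ℝ (Fin n))
    (B : Finset (Fin p)) : EuclideanSpace ℝ (Fin p) :=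
  Classical.epsilon (IsOracleLSE X y B)

/-! ### Penalties, critical points, solution paths, and the path solution -/

/-- The derivative `ρ̇(t; lam)` in `t` of a penalty `ρ(t; lam)`. -/
def rhoDot (ρ : ℝ → ℝ → ℝ) (t lam : ℝ) : ℝ := deriv (fun s => ρ s lam) t

/-- The requirements on the penalty at every level `lam ≥ lam1` (penalty levels are positive):
`ρ(·; lam)` is nondecreasing on `[0, ∞)` with a continuous derivative on `(0, ∞)`,
`ρ̇(0+; lam) = lam`, `ρ̇(t; lam) ≤ lam I{t ≤ γ lam}` for `t > 0`, and the concavity is at most `κ`: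
`ρ̇(t₁; lam) - ρ̇(t₂; lam) ≤ κ (t₂ - t₁)` for `0 < t₁ < t₂`. -/
structure IsPenalty (ρ : ℝ → ℝ → ℝ) (lam1 γ κ : ℝ) : Prop where
  mono : ∀ lam, lam1 ≤ lam → 0 < lam → MonotoneOn (fun t => ρ t lam) (Set.Ici 0)
  smooth : ∀ lam, lam1 ≤ lam → 0 < lam → ContDiffOn ℝ 1 (fun t => ρ t lam) (Set.Ioi 0)
  deriv_zero : ∀ lam, lam1 ≤ lam → 0 < lam →
    Tendsto (fun t => rhoDot ρ t lam) (𝓝[>] 0) (𝓝 lam)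
  deriv_le : ∀ lam, lam1 ≤ lam → 0 < lam → ∀ t, 0 < t →
    rhoDot ρ t lam ≤ if t ≤ γ * lam then lam else 0
  concavity : ∀ lam, lam1 ≤ lam → 0 < lam → ∀ t₁ t₂, 0 < t₁ → t₁ < t₂ →
    rhoDot ρ t₁ lam - rhoDot ρ t₂ lam ≤ κ * (t₂ - t₁)

/-- `lam ⊕ b` is a critical point of `(2n)⁻¹‖y - X b‖² + ∑ ρ(|b_j|; lam)`. -/
def IsCritical {n p : ℕ} (X : Matrix (Fin n) (Fin p) ℝ) (y : EuclideanSpace ℝ (Fin n))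
    (ρ : ℝ → ℝ → ℝ) (lam : ℝ) (b : EuclideanSpace ℝ (Fin p)) : Prop :=
  ∀ j : Fin p,
    (b j ≠ 0 →
      inner ℝ (col X j) (y - applyX X b) / n = Real.sign (b j) * rhoDot ρ |b j| lam) ∧
    (b j = 0 → |inner ℝ (col X j) (y - applyX X b) / n| ≤ lam)

/-- A continuous path `x ↦ lamP x ⊕ bP x`, `x ≥ 0`, of critical points that starts at `bP 0 = 0`
and along which the penalty level tends to `0`. -/
structure IsSolutionPath {n p : ℕ} (X : Matrix (Fin n) (Fin p) ℝ)
    (y : EuclideanSpace ℝ (Fin n)) (ρ : ℝ → ℝ → ℝ) (lamP : ℝ → ℝ)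
    (bP : ℝ → EuclideanSpace ℝ (Fin p)) : Prop where
  cont_lam : ContinuousOn lamP (Set.Ici 0)
  cont_b : ContinuousOn bP (Set.Ici 0)
  nonneg : ∀ x, 0 ≤ x → 0 ≤ lamP x
  critical : ∀ x, 0 ≤ x → IsCritical X y ρ (lamP x) (bP x)
  start : bP 0 = 0
  lim : Tendsto lamP atTop (𝓝 0)

/-- The path solution at level `lam`: the point of the path at `inf {x ≥ 0 : lamP x ≤ lam}`. -/
def pathSolution {p : ℕ} (lamP : ℝ → ℝ) (bP : ℝ → EuclideanSpace ℝ (Fin p)) (lam : ℝ) :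
    EuclideanSpace ℝ (Fin p) :=
  bP (sInf {x : ℝ | 0 ≤ x ∧ lamP x ≤ lam})

/-! ### Constants and tail probabilities -/

/-- `w = (2 - α) / (c_* c^* / κ² - 1)`, which is `0` for `κ = 0`. -/
def wConst (cLow cUp κ α : ℝ) : ℝ :=
  if κ = 0 then 0 else (2 - α) / (cLow * cUp / κ ^ 2 - 1)

/-- The constant `K_*`: the infimum over `0 < t < (2/w + 1 + α)/α` (over all `t > 0` if `w = 0`). -/
def Kstar (cLow cUp κ α : ℝ) : ℝ :=
  sInf ((fun t : ℝ =>
      ((1 + wConst cLow cUp κ α * (1 + (α / t) / (1 - α))) * cUp / cLow - 1) /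
        ((2 + wConst cLow cUp κ α * (1 + α - t * α)) * (1 - α))) ''
    {t : ℝ | 0 < t ∧
      (wConst cLow cUp κ α = 0 ∨ t < (2 / wConst cLow cUp κ α + 1 + α) / α)})

/-- The standard normal distribution function. -/
def Phi (x : ℝ) : ℝ := cdf (gaussianReal 0 1) x

/-- The chi-square distribution with `m` degrees of freedom. -/
def chiSq (m : ℕ) : Measure ℝ :=
  (stdGaussian (EuclideanSpace ℝ (Fin m))).map (fun z => ‖z‖ ^ 2)

/-- `q` is the number `p̃_ε` attached to `(p, d, m, ε)`: the solution with `2 log q ≥ 1` of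
`2 log q - 1 - log (2 log q) = (2/m) {log (p - d choose m) + log (1/ε)}`. -/
def IsPTilde (p d m : ℕ) (ε q : ℝ) : Prop :=
  0 < q ∧ 1 ≤ 2 * Real.log q ∧
    2 * Real.log q - 1 - Real.log (2 * Real.log q) =
      (2 / (m : ℝ)) * (Real.log ((p - d).choose m : ℝ) + Real.log (1 / ε))

/-! ### The regression problem -/

/-- The data of one problem: design `X`, coefficients `β`, noise level `σ`, a random noise vector,
a penalty `ρ` with its constants `γ`, `κ`, the rank and the constants of the sparse Riesz condition,
`α`, a path `x ↦ lamP ω x ⊕ bP ω x` for every outcome `ω`, and a (possibly random) penalty level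
`lamHat`. -/
structure Problem where
  n : ℕ
  p : ℕ
  X : Matrix (Fin n) (Fin p) ℝ
  β : EuclideanSpace ℝ (Fin p)
  σ : ℝ
  Ω : Type u
  [mΩ : MeasurableSpace Ω]
  μ : Measure Ω
  [prob : IsProbabilityMeasure μ]
  noise : Ω → EuclideanSpace ℝ (Fin n)
  ρ : ℝ → ℝ → ℝ
  γ : ℝ
  κ : ℝ
  dStar : ℕ
  cLow : ℝ
  cUp : ℝ
  α : ℝ
  lamP : Ω → ℝ → ℝ
  bP : Ω → ℝ → EuclideanSpace ℝ (Fin p)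
  lamHat : Ω → ℝ

attribute [instance] Problem.mΩ Problem.prob

namespace Problem

variable (P : Problem.{u})

/-- The response `y = X β + noise`. -/
def y (ω : P.Ω) : EuclideanSpace ℝ (Fin P.n) := applyX P.X P.β + P.noise ω

/-- `A° = {j : β_j ≠ 0}`. -/
def A0 : Finset (Fin P.p) := supp P.β

/-- `d° = |A°|`. -/
def d0 : ℕ := P.A0.card

/-- `m = d^* - d°`. -/
def m : ℕ := P.dStar - P.d0

/-- The estimator: the path solution at the level `lamHat`. -/
def betaHat (ω : P.Ω) : EuclideanSpace ℝ (Fin P.p) :=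
  pathSolution (P.lamP ω) (P.bP ω) (P.lamHat ω)

/-- The oracle least squares estimator, computed with the true support. -/
def betaOracle (ω : P.Ω) : EuclideanSpace ℝ (Fin P.p) := oracleLSE P.X (P.y ω) P.A0

/-- `w_j°`, `j ∈ A°`: the diagonal elements of `Σ_{A°}⁻¹`. -/
def w0 (j : P.A0) : ℝ := (subGram P.X P.A0)⁻¹ j j

/-- The standing assumptions, with the penalty conditions imposed at the levels `lam ≥ lam1`. -/
structure Assumptions (lam1 : ℝ) : Prop where
  sigma_pos : 0 < P.σ
  noise_law : HasLaw P.noise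
    (multivariateGaussian 0 (P.σ ^ 2 • (1 : Matrix (Fin P.n) (Fin P.n) ℝ))) P.μ
  path : ∀ᵐ ω ∂P.μ, IsSolutionPath P.X (P.y ω) P.ρ (P.lamP ω) (P.bP ω)
  penalty : IsPenalty P.ρ lam1 P.γ P.κ
  dStar_pos : 0 < P.dStar
  src : SparseRiesz P.X P.dStar P.cLow P.cUp
  kappa_nonneg : 0 ≤ P.κ
  kappa_lt : P.κ < P.cLow
  cLow_le_cUp : P.cLow ≤ P.cUp
  alpha_pos : 0 < P.α
  alpha_lt_one : P.α < 1
  sparsity : (P.d0 : ℝ) ≤ P.dStar / (1 + Kstar P.cLow P.cUp P.κ P.α)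

/-- `P{Â ≠ A°}`. -/
def probWrongSelection : ℝ := P.μ.real {ω | supp (P.betaHat ω) ≠ P.A0}

/-- `P{β̂ ≠ β̂° or sgn(β̂) ≠ sgn(β)}`. -/
def probNotOracle : ℝ :=
  P.μ.real {ω | P.betaHat ω ≠ P.betaOracle ω ∨
    ∃ j, Real.sign (P.betaHat ω j) ≠ Real.sign (P.β j)}

/-- `π_{n,1}(lam) = 2 ∑_{j ∉ A°} Φ(-n lam / (σ ‖x_j‖))`. -/
def pi1 (lam : ℝ) : ℝ :=
  2 * ∑ j ∈ P.A0ᶜ, Phi (-(P.n * lam / (P.σ * ‖col P.X j‖)))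

/-- `π_{n,2}(lam) = ∑_{j ∈ A°} Φ((γ lam - |β_j|) / (σ (w_j°/n)^{1/2}))`. -/
def pi2 (lam : ℝ) : ℝ :=
  ∑ j : P.A0, Phi ((P.γ * lam - |P.β j.1|) / (P.σ * √(P.w0 j / P.n)))

/-- `π_{n,3}(lam) = (p - d° choose m) P{σ² χ²_m > m n lam²}`. -/
def pi3 (lam : ℝ) : ℝ :=
  ((P.p - P.d0).choose P.m : ℝ) *
    (chiSq P.m).real {x | (P.m : ℝ) * P.n * lam ^ 2 < P.σ ^ 2 * x}

/-- `λ_{1,ε} = σ √((2/n) log((p - d°)/ε))`. -/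
def lam1 (ε : ℝ) : ℝ :=
  P.σ * √((2 / (P.n : ℝ)) * Real.log (((P.p : ℝ) - P.d0) / ε))

/-- `λ_{3,ε} = σ √((2/n) log p̃_ε)`, where `q = p̃_ε`. -/
def lam3 (q : ℝ) : ℝ := P.σ * √((2 / (P.n : ℝ)) * Real.log q)

/-- `J_1 = √(π log((p - d°)/ε))`. -/
def J1 (ε : ℝ) : ℝ := √(Real.pi * Real.log (((P.p : ℝ) - P.d0) / ε))

/-- `J_2 = √(π log(a/ε))`. -/
def J2 (_P : Problem.{u}) (ε a : ℝ) : ℝ := √(Real.pi * Real.log (a / ε))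

/-- `J_3 = {2 log p̃_ε - 1 + 1/m} √(m π) / √(4 log p̃_ε)`, where `q = p̃_ε`. -/
def J3 (q : ℝ) : ℝ :=
  (2 * Real.log q - 1 + 1 / (P.m : ℝ)) * √(P.m * Real.pi) / √(4 * Real.log q)

/-- The hypotheses of the explicit bound, apart from the range of `lamHat`: `0 < ε ≤ 1`, the
standing assumptions with `λ_1 = λ_{1,ε}`, `d^* ≤ p` (so that `1 ≤ m ≤ p - d°` and `p̃_ε` is
defined), `q = p̃_ε`, `λ_{2,ε} = lam2 ≥ max{λ_{1,ε}, (√c^*/α) λ_{3,ε}}`, `a ≥ d°`,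
`|β_j| ≥ γ λ_{2,ε} + σ √(w_j° (2/n) log(a/ε))` on `A°`, and `‖x_j‖² = n`. -/
structure ExplicitAssumptions (ε q lam2 a : ℝ) : Prop where
  eps_pos : 0 < ε
  eps_le_one : ε ≤ 1
  base : P.Assumptions (P.lam1 ε)
  dStar_le : P.dStar ≤ P.p
  pTilde : IsPTilde P.p P.d0 P.m ε q
  lam2_ge : max (P.lam1 ε) (√P.cUp / P.α * P.lam3 q) ≤ lam2
  a_ge : (P.d0 : ℝ) ≤ a
  signal : ∀ j : P.A0,
    P.γ * lam2 + P.σ * √(P.w0 j * (2 / (P.n : ℝ)) * Real.log (a / ε)) ≤ |P.β j.1|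
  columns : ∀ j, ‖col P.X j‖ ^ 2 = P.n

end Problem

end PLUS

end

/-!
The estimator is compared with the oracle least squares fit on an event that depends on the noise
only. Put `B = A°` and `m = d^* - d°`, and let `P_A` be the orthogonal projection onto the span of
the columns in `A`. On this event

* every column outside `B` has correlation less than `lam1` with the residual of the oracle fit;
* every oracle coefficient exceeds `γ lam2` in absolute value and has the right sign;
* for every `A ⊇ B` with `|A| = d^*`, the energy `‖(P_A - P_B) noise‖²` is at most `m n lam3²`.

The complement costs `π₁ + π₂ + π₃` by a union bound, since linear functionals of the noise are
Gaussian and `‖(P_A - P_B) noise‖² / σ²` is chi-square with `m` degrees of freedom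
(`Problem.real_not_oracle_inter_le`).

The event forces the path solution to be the oracle fit (`IsSolutionPath.pathSolution_eq`). At
levels in `[lam1, lam2]` the oracle fit `β°` is critical, because `ρ̇` vanishes beyond `γ lam`.
Since the concavity `κ` is less than `c_*`, the penalized loss is strictly convex on models of
size at most `d^*`, so every critical point with at most `m` nonzero coordinates outside `B` equals
`β°` (`IsCritical.eq_of_sub_mem`). It remains to see that the path, which starts at `0`, keeps at
most `m` nonzero coordinates outside `B` as long as its level is above `lamHat`. If this failed,
there would be a last point with the property, at which the gradient is nearly extremal
(`|g_j| ≥ lam - κ |b_j|`, with the sign of `b_j`) on more than `m` coordinates outside `B`. At a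
level below `lam2` that point is `β°`, whose gradient outside `B` is less than `lam1`. At a level
above `lam2` it contradicts `no_large_model`: a critical point `b` supported in `A ⊇ B` whose
gradient is nearly extremal on `A \ B` satisfies, for every `t > 0` (`sparsity_inequality`),
`(2 + w (1 + α - tα)) (1 - α) |A \ B| ≤ ((1 + w {1 + (α/t)/(1 - α)}) c^*/c_* - 1 - w) |B|`,
and the last `w` makes `|A \ B| < K_* |B|`, against `d° (1 + K_*) ≤ d^*`. The inequality combines
two energy estimates (`energy_inequalities`) with weights `1` and `w`, where `w` is chosen so that
the combination can be bounded below coordinate by coordinate (`coordinate_bound`).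

The explicit bound needs two sharp tail estimates. The normal one, `Phi_neg_sqrt_le`, is classical.
For the chi-square one, `chiSq_tail_le`, the law is written in polar coordinates and the tail
integral of `f(v) = v^(m-1) exp (-m v²/2)` is compared with its boundary term through
`-f'(v) = f(v) (m v - (m-1)/v)`. The normalization comes from Stirling's lower bound for `Γ` at
half integers, and the factor `1/√2` from the fact that at most half of the mass of `f` lies beyond
`1`. All bounds are proved on the event that `lamHat` is in its range, so that they also give
selection consistency when this event only has probability tending to `1`.
-/

namespace PLUS

/-! ### Column spans and Riesz bounds -/

section Columns

variable {n p : ℕ} {X : Matrix (Fin n) (Fin p) ℝ}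

lemma applyX_eq_toEuclideanLin (b : EuclideanSpace ℝ (Fin p)) :
    applyX X b = Matrix.toEuclideanLin X b := rfl

lemma applyX_sub (b b' : EuclideanSpace ℝ (Fin p)) :
    applyX X (b - b') = applyX X b - applyX X b' := by
  simp only [applyX_eq_toEuclideanLin, map_sub]

lemma continuous_applyX : Continuous (applyX X) :=
  (Matrix.toEuclideanLin X).continuous_of_finiteDimensional

lemma applyX_eq_sum (b : EuclideanSpace ℝ (Fin p)) :
    applyX X b = ∑ j, b j • col X j := by
  ext i
  simp [applyX, col, Matrix.mulVec, dotProduct, mul_comm]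

lemma inner_applyX (b : EuclideanSpace ℝ (Fin p)) (v : EuclideanSpace ℝ (Fin n)) :
    inner ℝ (applyX X b) v = ∑ j, b j * inner ℝ (col X j) v := by
  rw [applyX_eq_sum, sum_inner]
  simp [real_inner_smul_left]

/-- The vectors of `ℝᵖ` that vanish outside `A`. -/
noncomputable def supportedIn (A : Finset (Fin p)) : Submodule ℝ (EuclideanSpace ℝ (Fin p)) where
  carrier := {b | ∀ j, j ∉ A → b j = 0}
  add_mem' := fun ha hb j hj => by simp [ha j hj, hb j hj]
  zero_mem' := fun _ _ => rfl
  smul_mem' := fun c b hb j hj => by simp [hb j hj]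

lemma sum_mul_of_mem_supportedIn {A : Finset (Fin p)} {b : EuclideanSpace ℝ (Fin p)}
    (hb : b ∈ supportedIn A) (f : Fin p → ℝ) : ∑ j, b j * f j = ∑ j ∈ A, b j * f j :=
  (Finset.sum_subset A.subset_univ fun j _ hj => by rw [hb j hj, zero_mul]).symm

lemma norm_sq_of_mem_supportedIn {A : Finset (Fin p)} {b : EuclideanSpace ℝ (Fin p)}
    (hb : b ∈ supportedIn A) : ‖b‖ ^ 2 = ∑ j ∈ A, b j ^ 2 := by
  rw [EuclideanSpace.real_norm_sq_eq]
  simpa only [sq] using sum_mul_of_mem_supportedIn hb b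

variable (X) in
/-- The column space `{X b : supp b ⊆ A}` of `X_A`. -/
noncomputable def colSpan (A : Finset (Fin p)) : Submodule ℝ (EuclideanSpace ℝ (Fin n)) :=
  (supportedIn A).map (Matrix.toEuclideanLin X)

lemma mem_colSpan {A : Finset (Fin p)} {v : EuclideanSpace ℝ (Fin n)} :
    v ∈ colSpan X A ↔ ∃ b ∈ supportedIn A, applyX X b = v := Iff.rfl

lemma applyX_mem_colSpan {A : Finset (Fin p)} {b : EuclideanSpace ℝ (Fin p)}
    (hb : b ∈ supportedIn A) : applyX X b ∈ colSpan X A := ⟨b, hb, rfl⟩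

lemma colSpan_mono {A B : Finset (Fin p)} (h : B ⊆ A) : colSpan X B ≤ colSpan X A := by
  rintro _ ⟨b, hb, rfl⟩
  exact ⟨b, fun j hj => hb j fun hjB => hj (h hjB), rfl⟩

lemma applyX_single (j : Fin p) : applyX X (EuclideanSpace.single j 1) = col X j := by
  rw [applyX_eq_sum, Finset.sum_eq_single j] <;> simp +contextual

lemma col_mem_colSpan {A : Finset (Fin p)} {j : Fin p} (hj : j ∈ A) : col X j ∈ colSpan X A := by
  rw [← applyX_single]
  refine applyX_mem_colSpan fun i hi => ?_
  have : i ≠ j := by rintro rfl; exact hi hj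
  simp [this]

/-- A vector with zero inner product with the columns in `A` is orthogonal to their span. -/
lemma inner_eq_zero_of_mem_colSpan {A : Finset (Fin p)} {v w : EuclideanSpace ℝ (Fin n)}
    (hv : v ∈ colSpan X A) (hw : ∀ j ∈ A, inner ℝ (col X j) w = 0) : inner ℝ v w = 0 := by
  obtain ⟨b, hb, rfl⟩ := mem_colSpan.1 hv
  rw [inner_applyX, sum_mul_of_mem_supportedIn hb]
  exact Finset.sum_eq_zero fun j hj => by rw [hw j hj, mul_zero]

/-- The Riesz bounds `n c_* ‖b‖² ≤ ‖X b‖² ≤ n c^* ‖b‖²` for the vectors `b` supported in `A`. -/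
def RieszOn (X : Matrix (Fin n) (Fin p) ℝ) (A : Finset (Fin p)) (cLow cUp : ℝ) : Prop :=
  ∀ b ∈ supportedIn A,
    n * cLow * ‖b‖ ^ 2 ≤ ‖applyX X b‖ ^ 2 ∧ ‖applyX X b‖ ^ 2 ≤ n * cUp * ‖b‖ ^ 2

lemma RieszOn.mono {A B : Finset (Fin p)} {cLow cUp : ℝ} (h : RieszOn X A cLow cUp)
    (hBA : B ⊆ A) : RieszOn X B cLow cUp :=
  fun b hb => h b fun j hj => hb j fun hjB => hj (hBA hjB)

lemma subGram_posSemidef (X : Matrix (Fin n) (Fin p) ℝ) (A : Finset (Fin p)) :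
    (subGram X A).PosSemidef := by
  have h : (gram X).PosSemidef := by
    have := Matrix.posSemidef_conjTranspose_mul_self X
    rw [Matrix.conjTranspose_eq_transpose_of_trivial] at this
    exact this.smul (by positivity)
  exact h.submatrix _

lemma gram_apply (X : Matrix (Fin n) (Fin p) ℝ) (i j : Fin p) :
    gram X i j = (n : ℝ)⁻¹ * inner ℝ (col X i) (col X j) := by
  simp [gram, col, Matrix.mul_apply, PiLp.inner_apply, mul_comm]

lemma mul_inner_subGram_mulVec {A : Finset (Fin p)} {b : EuclideanSpace ℝ (Fin p)}
    (hb : b ∈ supportedIn A) :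
    n * inner ℝ (WithLp.toLp 2 (fun j : A => b j) : EuclideanSpace ℝ A)
      (WithLp.toLp 2 ((subGram X A).mulVec fun j : A => b j)) = ‖applyX X b‖ ^ 2 := by
  rcases Nat.eq_zero_or_pos n with rfl | hn
  · have : applyX X b = 0 := Subsingleton.elim _ _
    simp [this]
  have hn' : (n : ℝ) ≠ 0 := by positivity
  rw [← real_inner_self_eq_norm_sq, inner_applyX, sum_mul_of_mem_supportedIn hb, PiLp.inner_apply,
    Finset.mul_sum, ← Finset.sum_coe_sort A]
  refine Finset.sum_congr rfl fun i _ => ?_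
  rw [real_inner_comm, real_inner_comm (applyX X b), inner_applyX, sum_mul_of_mem_supportedIn hb,
    ← Finset.sum_coe_sort A]
  simp only [subGram, Matrix.mulVec, dotProduct, Matrix.submatrix_apply, gram_apply,
    RCLike.inner_apply, conj_trivial]
  rw [mul_left_comm, Finset.mul_sum]
  congr 1
  refine Finset.sum_congr rfl fun j _ => ?_
  rw [real_inner_comm (col X i.1)]
  field_simp

/-- Since `Σ_A` is positive semidefinite, the lower bound on `‖Σ_A u‖` and the upper bound on its
eigenvalues bound its quadratic form. -/
lemma SparseRiesz.rieszOn {d : ℕ} {cLow cUp : ℝ} (h : SparseRiesz X d cLow cUp)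
    {A : Finset (Fin p)} (hA : A.card ≤ d) : RieszOn X A cLow cUp := by
  classical
  obtain ⟨h1, h2⟩ := h A hA
  have hP := subGram_posSemidef X A
  set M := subGram X A
  set e := hP.isHermitian.eigenvectorBasis
  have hMe (j : A) : M.mulVec (e j).ofLp = hP.isHermitian.eigenvalues j • (e j).ofLp :=
    hP.isHermitian.mulVec_eigenvectorBasis j
  have hlow (j : A) : cLow ≤ hP.isHermitian.eigenvalues j := by
    have := h1 (e j) (e.orthonormal.1 j)
    rw [hMe, WithLp.toLp_smul, norm_smul, WithLp.toLp_ofLp, e.orthonormal.1 j, mul_one,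
      Real.norm_of_nonneg (hP.eigenvalues_nonneg j)] at this
    exact this
  have hup (j : A) : hP.isHermitian.eigenvalues j ≤ cUp := by
    refine h2 _ (Module.End.hasEigenvalue_of_hasEigenvector (x := (e j).ofLp) ⟨?_, ?_⟩)
    · rw [Module.End.mem_eigenspace_iff, Matrix.toLin'_apply, hMe]
    · intro h0
      have : e j = 0 := by ext i; exact congrFun h0 i
      exact e.orthonormal.ne_zero j this
  intro b hb
  set v : EuclideanSpace ℝ A := WithLp.toLp 2 (fun j : A => b j) with hv
  have hnorm : ‖b‖ ^ 2 = ‖v‖ ^ 2 := by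
    rw [norm_sq_of_mem_supportedIn hb, EuclideanSpace.real_norm_sq_eq, ← Finset.sum_coe_sort A]
  have hform : inner ℝ v (WithLp.toLp 2 (M.mulVec v.ofLp)) =
      ∑ j, hP.isHermitian.eigenvalues j * inner ℝ v (e j) ^ 2 := by
    rw [← e.sum_inner_mul_inner]
    refine Finset.sum_congr rfl fun j _ => ?_
    have : inner ℝ (e j) (WithLp.toLp 2 (M.mulVec v.ofLp)) =
        hP.isHermitian.eigenvalues j * inner ℝ v (e j) := by
      have hT : M.transpose = M := by
        rw [← Matrix.conjTranspose_eq_transpose_of_trivial]; exact hP.isHermitian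
      have : inner ℝ (e j) (WithLp.toLp 2 (M.mulVec v.ofLp)) =
          (M.mulVec v.ofLp) ⬝ᵥ (e j).ofLp := by
        simp [PiLp.inner_apply, dotProduct]
      have hswap : M.mulVec v.ofLp ⬝ᵥ (e j).ofLp = v.ofLp ⬝ᵥ M.mulVec (e j).ofLp := by
        conv_lhs => rw [← hT, Matrix.mulVec_transpose, ← Matrix.dotProduct_mulVec]
      rw [this, hswap, hMe, dotProduct_smul]
      simp [PiLp.inner_apply, dotProduct, mul_comm]
    rw [this]; ring
  have hsq : ∑ j, inner ℝ v (e j) ^ 2 = ‖v‖ ^ 2 := by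
    rw [← real_inner_self_eq_norm_sq, ← e.sum_inner_mul_inner]
    exact Finset.sum_congr rfl fun j _ => by rw [real_inner_comm v (e j), sq]
  rw [← mul_inner_subGram_mulVec hb, hnorm, mul_assoc, mul_assoc]
  change (n : ℝ) * (cLow * ‖v‖ ^ 2) ≤ n * inner ℝ v (WithLp.toLp 2 (M.mulVec v.ofLp)) ∧
    n * inner ℝ v (WithLp.toLp 2 (M.mulVec v.ofLp)) ≤ n * (cUp * ‖v‖ ^ 2)
  rw [hform, ← hsq]
  constructor <;> refine mul_le_mul_of_nonneg_left ?_ n.cast_nonneg <;> rw [Finset.mul_sum] <;>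
    gcongr with j
  · exact hlow j
  · exact hup j

variable {A : Finset (Fin p)} {cLow cUp : ℝ}

/-- The upper Riesz bound, read for the adjoint: `‖X_A' h‖² ≤ n c^* ‖h‖²`. -/
lemma RieszOn.sum_sq_inner_le (h : RieszOn X A cLow cUp) (hc : 0 ≤ cUp)
    (v : EuclideanSpace ℝ (Fin n)) :
    ∑ j ∈ A, inner ℝ (col X j) v ^ 2 ≤ n * cUp * ‖v‖ ^ 2 := by
  classical
  set b : EuclideanSpace ℝ (Fin p) :=
    WithLp.toLp 2 fun j => if j ∈ A then inner ℝ (col X j) v else 0 with hb_def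
  have hb : b ∈ supportedIn A := fun j hj => by simp [hb_def, hj]
  have hbj : ∀ j ∈ A, b j = inner ℝ (col X j) v := fun j hj => by simp [hb_def, hj]
  have hS : ‖b‖ ^ 2 = ∑ j ∈ A, inner ℝ (col X j) v ^ 2 := by
    rw [norm_sq_of_mem_supportedIn hb]
    exact Finset.sum_congr rfl fun j hj => by rw [hbj j hj]
  have hI : inner ℝ (applyX X b) v = ‖b‖ ^ 2 := by
    rw [inner_applyX, sum_mul_of_mem_supportedIn hb, hS]
    exact Finset.sum_congr rfl fun j hj => by rw [hbj j hj, sq]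
  have h1 := real_inner_le_norm (applyX X b) v
  have h2 := (h b hb).2
  rw [← hS]
  rw [hI] at h1
  have h3 : ‖b‖ ^ 2 * ‖b‖ ^ 2 ≤ ‖b‖ ^ 2 * (n * cUp * ‖v‖ ^ 2) := by
    calc ‖b‖ ^ 2 * ‖b‖ ^ 2 ≤ (‖applyX X b‖ * ‖v‖) * (‖applyX X b‖ * ‖v‖) := by gcongr
      _ = ‖applyX X b‖ ^ 2 * ‖v‖ ^ 2 := by ring
      _ ≤ n * cUp * ‖b‖ ^ 2 * ‖v‖ ^ 2 := by gcongr
      _ = _ := by ring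
  rcases (sq_nonneg ‖b‖).eq_or_lt with h0 | h0
  · rw [← h0]; positivity
  · exact le_of_mul_le_mul_left h3 h0

/-- The lower Riesz bound, read for the adjoint: `n c_* ‖h‖² ≤ ‖X_A' h‖²` on the span of the
columns in `A`. -/
lemma RieszOn.le_sum_sq_inner (h : RieszOn X A cLow cUp) (hc : 0 ≤ cLow)
    {v : EuclideanSpace ℝ (Fin n)} (hv : v ∈ colSpan X A) :
    n * cLow * ‖v‖ ^ 2 ≤ ∑ j ∈ A, inner ℝ (col X j) v ^ 2 := by
  obtain ⟨b, hb, rfl⟩ := mem_colSpan.1 hv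
  set v := applyX X b
  set S := ∑ j ∈ A, inner ℝ (col X j) v ^ 2
  have h1 : ‖v‖ ^ 2 = ∑ j ∈ A, b j * inner ℝ (col X j) v := by
    rw [← real_inner_self_eq_norm_sq, inner_applyX, sum_mul_of_mem_supportedIn hb]
  have h2 : (‖v‖ ^ 2) ^ 2 ≤ ‖b‖ ^ 2 * S := by
    rw [h1, norm_sq_of_mem_supportedIn hb]
    exact Finset.sum_mul_sq_le_sq_mul_sq _ _ _
  have h3 := (h b hb).1
  have hS : 0 ≤ S := Finset.sum_nonneg fun _ _ => sq_nonneg _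
  rcases (sq_nonneg ‖v‖).eq_or_lt with h0 | h0
  · rw [← h0]; simpa using hS
  · refine le_of_mul_le_mul_left ?_ h0
    calc ‖v‖ ^ 2 * (n * cLow * ‖v‖ ^ 2) = n * cLow * (‖v‖ ^ 2) ^ 2 := by ring
      _ ≤ n * cLow * (‖b‖ ^ 2 * S) := by gcongr
      _ = n * cLow * ‖b‖ ^ 2 * S := by ring
      _ ≤ ‖v‖ ^ 2 * S := by gcongr

lemma RieszOn.eq_zero_of_applyX_eq_zero (h : RieszOn X A cLow cUp) (hn : 0 < n) (hc : 0 < cLow)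
    {b : EuclideanSpace ℝ (Fin p)} (hb : b ∈ supportedIn A) (h0 : applyX X b = 0) : b = 0 := by
  have := (h b hb).1
  rw [h0, norm_zero] at this
  have hn' : (0 : ℝ) < n := by exact_mod_cast hn
  have h2 : ‖b‖ ^ 2 ≤ 0 := by
    by_contra! hlt
    have : 0 < n * cLow * ‖b‖ ^ 2 := by positivity
    linarith
  exact norm_eq_zero.1 (pow_eq_zero_iff two_ne_zero |>.1 (le_antisymm h2 (sq_nonneg _)))

/-- Inner products with linearly independent columns may be prescribed inside their span. -/
lemma RieszOn.exists_mem_colSpan_inner_eq (h : RieszOn X A cLow cUp) (hn : 0 < n) (hc : 0 < cLow)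
    (z : Fin p → ℝ) : ∃ v ∈ colSpan X A, ∀ j ∈ A, inner ℝ (col X j) v = z j := by
  classical
  let T : supportedIn A →ₗ[ℝ] (A → ℝ) :=
    { toFun := fun b j => inner ℝ (col X j) (applyX X b)
      map_add' := fun b b' => by
        ext j; simp [applyX_eq_toEuclideanLin, inner_add_right]
      map_smul' := fun c b => by
        ext j; simp [applyX_eq_toEuclideanLin, real_inner_smul_right] }
  have hinj : Function.Injective T := by
    refine (injective_iff_map_eq_zero T).2 fun b hb => ?_
    have h0 : inner ℝ (applyX X b.1) (applyX X b.1) = 0 :=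
      inner_eq_zero_of_mem_colSpan (applyX_mem_colSpan b.2) fun j hj => congrFun hb ⟨j, hj⟩
    exact Subtype.ext
      (h.eq_zero_of_applyX_eq_zero hn hc b.2 (inner_self_eq_zero.1 h0))
  let R : (A → ℝ) →ₗ[ℝ] supportedIn A :=
    { toFun := fun u => ⟨WithLp.toLp 2 fun j => if hj : j ∈ A then u ⟨j, hj⟩ else 0,
        fun j hj => by simp [hj]⟩
      map_add' := fun u u' => by
        ext j; by_cases hj : j ∈ A <;> simp [hj]
      map_smul' := fun c u => by
        ext j; by_cases hj : j ∈ A <;> simp [hj] }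
  have hR : Function.Injective R := by
    intro u u' huu
    ext j
    have := congrArg (fun b : supportedIn A => b.1 j.1) huu
    simpa [R] using this
  have hsurj : Function.Surjective (T ∘ₗ R) :=
    LinearMap.injective_iff_surjective.1 (hinj.comp hR)
  obtain ⟨u, hu⟩ := hsurj fun j => z j
  exact ⟨applyX X (R u).1, applyX_mem_colSpan (R u).2, fun j hj => congrFun hu ⟨j, hj⟩⟩

end Columns

/-! ### The sparsity inequality at a critical point -/

section Sparsity

variable {n p : ℕ} {X : Matrix (Fin n) (Fin p) ℝ}

lemma inner_col_sub_starProjection {A : Finset (Fin p)} {j : Fin p} (hj : j ∈ A)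
    (v : EuclideanSpace ℝ (Fin n)) :
    inner ℝ (col X j) (v - (colSpan X A).starProjection v) = 0 := by
  rw [real_inner_comm]
  exact Submodule.starProjection_inner_eq_zero v _ (col_mem_colSpan hj)

lemma inner_col_starProjection {A : Finset (Fin p)} {j : Fin p} (hj : j ∈ A)
    (v : EuclideanSpace ℝ (Fin n)) :
    inner ℝ (col X j) ((colSpan X A).starProjection v) = inner ℝ (col X j) v := by
  have := inner_col_sub_starProjection (X := X) hj v
  rw [inner_sub_right] at this
  linarith

/-- The coordinatewise bound behind the choice of `w`: the equation
`w (c_* c^* / κ² - 1) = 2 - α` makes the left side at least `(2 - α + w) (r + q)²`, where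
`q = lam - r ≤ κ x`. -/
lemma coordinate_bound {cLow cUp κ α w lam r x : ℝ} (hκ : 0 < κ) (hκc : κ < cLow)
    (hc : cLow ≤ cUp) (hα0 : 0 < α) (hα1 : α < 1) (hw : 0 < w)
    (hweq : w * (cLow * cUp / κ ^ 2 - 1) = 2 - α) (hr : 0 ≤ r) (hrl : r ≤ lam)
    (hx : lam - κ * x ≤ r) :
    (2 - α + w) * lam ^ 2 ≤
      (2 - α) * r ^ 2 + 2 * cUp * (r * x)
        + w * (cUp * cLow * x ^ 2 + 2 * cUp * (r * x) + r ^ 2) := by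
  set q := lam - r with hq
  have hq0 : 0 ≤ q := by linarith
  have hqx : q / κ ≤ x := by rw [div_le_iff₀ hκ]; linarith
  have hq0' : 0 ≤ q / κ := by positivity
  have hcL : 0 < cLow := hκ.trans hκc
  have hcU : 0 < cUp := hcL.trans_le hc
  set s := 2 - α + w with hs
  have hs0 : 0 < s := by linarith
  have h1 : w * (cUp * cLow * (q / κ) ^ 2) = s * q ^ 2 := by
    have : w * (cLow * cUp / κ ^ 2) = s := by linarith
    rw [← this]; field_simp
  have h2 : s ≤ (1 + w) * (cUp / κ) := by
    refine (sq_le_sq₀ hs0.le (by positivity)).1 ?_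
    have h3 : s / w ≤ (cUp / κ) ^ 2 := by
      have : s / w = cLow * cUp / κ ^ 2 := by
        field_simp at hweq ⊢
        linarith
      rw [this, div_pow]
      gcongr
      nlinarith
    calc s ^ 2 = (w * s) * (s / w) := by field_simp
      _ ≤ (1 + w) ^ 2 * (cUp / κ) ^ 2 := by
        gcongr
        nlinarith
      _ = _ := by ring
  have h3 : (cUp * cLow * (q / κ) ^ 2) ≤ cUp * cLow * x ^ 2 := by gcongr
  have h4 : r * (q / κ) ≤ r * x := by gcongr
  have h5 : s * (r * q) ≤ (1 + w) * cUp * (r * (q / κ)) := by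
    calc s * (r * q) ≤ (1 + w) * (cUp / κ) * (r * q) := by gcongr
      _ = _ := by ring
  have h6 : (1 + w) * cUp * (r * (q / κ)) ≤ (1 + w) * cUp * (r * x) := by gcongr
  have h7 := mul_le_mul_of_nonneg_left h3 hw.le
  have : lam = r + q := by simp [hq]
  rw [this]
  nlinarith

/-- Two energy inequalities at a critical point `lam ⊕ b` with gradient `g` and `b` supported in
`A ⊇ B`. With `H = P_A y - X b`, `E = P_A y - P_B y`, `β = X b - P_B X b` and `G` the vector in the
span of the columns in `A` whose inner products with them are `n g` on `A \ B` and `0` on `B`, the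
first compares `‖H - G‖²` with the Riesz bounds, and the second does so for
`β + G = E - (H - P_B H - G)`. -/
lemma energy_inequalities {A B : Finset (Fin p)} (hBA : B ⊆ A) {cLow cUp α τ e : ℝ}
    (hn : 0 < n) (hR : RieszOn X A cLow cUp) (hcL : 0 < cLow) (hc : cLow ≤ cUp)
    (hα0 : 0 < α) (hα1 : α < 1) (hτ0 : 0 < τ)
    {y : EuclideanSpace ℝ (Fin n)} {b : EuclideanSpace ℝ (Fin p)} (hb : b ∈ supportedIn A)
    {g : Fin p → ℝ} (hg : ∀ j ∈ A, inner ℝ (col X j) (y - applyX X b) = n * g j)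
    (hQ : cUp * ‖(colSpan X A).starProjection y - (colSpan X B).starProjection y‖ ^ 2 ≤
      n * α ^ 2 * e) :
    (2 - α) * ∑ j ∈ A \ B, g j ^ 2 + 2 * cUp * ∑ j ∈ A \ B, g j * b j - α * e ≤
        (cUp / cLow - 1) * ∑ j ∈ B, g j ^ 2 ∧
      cUp * cLow * ∑ j ∈ A \ B, b j ^ 2 + 2 * cUp * ∑ j ∈ A \ B, g j * b j
          + ∑ j ∈ A \ B, g j ^ 2 ≤
        (1 + τ) * (α ^ 2 * e) + (1 + τ⁻¹) * ((cUp / cLow - 1) * ∑ j ∈ B, g j ^ 2) := by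
  classical
  have hcU : 0 < cUp := hcL.trans_le hc
  have hn' : (0 : ℝ) < n := by exact_mod_cast hn
  have hα1' : 0 < 1 - α := by linarith
  have hRB := hR.mono hBA
  set VA := colSpan X A
  set VB := colSpan X B
  set C := A \ B
  set H := VA.starProjection y - applyX X b with hH
  set E := VA.starProjection y - VB.starProjection y with hE
  set β := applyX X b - VB.starProjection (applyX X b) with hβ
  obtain ⟨G, hGA, hG⟩ := hR.exists_mem_colSpan_inner_eq hn hcL
    (fun j => if j ∈ B then 0 else n * g j)
  have hGB : ∀ j ∈ B, inner ℝ (col X j) G = 0 := fun j hj => by simp [hG j (hBA hj), hj]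
  have hGC : ∀ j ∈ C, inner ℝ (col X j) G = n * g j := fun j hj => by
    rw [Finset.mem_sdiff] at hj; simp [hG j hj.1, hj.2]
  have hXbA : applyX X b ∈ VA := applyX_mem_colSpan hb
  have hHA : H ∈ VA := VA.sub_mem (VA.starProjection_apply_mem y) hXbA
  have hHg : ∀ j ∈ A, inner ℝ (col X j) H = n * g j := fun j hj => by
    rw [hH, inner_sub_right, inner_col_starProjection hj, ← inner_sub_right, hg j hj]
  -- The decomposition of `H` along the span of the columns in `B`.
  have hcomp : VB.starProjection (VA.starProjection y) = VB.starProjection y := by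
    have := Submodule.starProjection_comp_starProjection_of_le (colSpan_mono (X := X) hBA)
    exact congrArg (fun f => f y) this
  have hQH : H - VB.starProjection H = E - β := by
    rw [hH, map_sub, hcomp, hE, hβ]; abel
  set gB := ∑ j ∈ B, g j ^ 2
  set gC := ∑ j ∈ C, g j ^ 2
  have hGperp : ∀ v ∈ VB, inner ℝ G v = 0 := fun v hv => by
    rw [real_inner_comm]; exact inner_eq_zero_of_mem_colSpan hv hGB
  have hGH : inner ℝ G H = inner ℝ G E - inner ℝ G β := by
    have h := inner_sub_right (𝕜 := ℝ) G H (VB.starProjection H)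
    rw [hQH, inner_sub_right, hGperp _ (VB.starProjection_apply_mem H), sub_zero] at h
    exact h.symm
  have hsplit (f : Fin p → ℝ) : ∑ j ∈ A, f j = ∑ j ∈ C, f j + ∑ j ∈ B, f j :=
    (Finset.sum_sdiff hBA).symm
  have hnn : ∀ s : Finset (Fin p), ∑ j ∈ s, ((n : ℝ) * g j) ^ 2 = n * (n * ∑ j ∈ s, g j ^ 2) := by
    intro s
    rw [Finset.mul_sum, Finset.mul_sum]
    exact Finset.sum_congr rfl fun j _ => by ring
  have f1 : cLow * ‖H - G‖ ^ 2 ≤ n * gB := by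
    have h := hR.le_sum_sq_inner hcL.le (VA.sub_mem hHA hGA)
    have h2 : ∑ j ∈ A, inner ℝ (col X j) (H - G) ^ 2 = n * (n * gB) := by
      rw [hsplit, Finset.sum_eq_zero, zero_add, ← hnn]
      · exact Finset.sum_congr rfl fun j hj => by
          rw [inner_sub_right, hHg j (hBA hj), hGB j hj, sub_zero]
      · intro j hj
        rw [inner_sub_right, hHg j (Finset.sdiff_subset hj), hGC j hj, sub_self]; norm_num
    rw [h2, mul_assoc] at h
    exact le_of_mul_le_mul_left h hn'
  have f1' : ‖H - G‖ ^ 2 = ‖H‖ ^ 2 - 2 * inner ℝ G E + 2 * inner ℝ G β + ‖G‖ ^ 2 := by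
    rw [norm_sub_sq_real, real_inner_comm, hGH]; ring
  have f2 : n * (gC + gB) ≤ cUp * ‖H‖ ^ 2 := by
    have h := hR.sum_sq_inner_le hcU.le H
    rw [Finset.sum_congr rfl fun j hj => by rw [hHg j hj], hnn, hsplit, mul_assoc] at h
    exact le_of_mul_le_mul_left h hn'
  have f3 : n * gC ≤ cUp * ‖G‖ ^ 2 := by
    have h := hR.sum_sq_inner_le hcU.le G
    rw [hsplit, Finset.sum_congr rfl fun j hj => by rw [hGC j hj], hnn,
      Finset.sum_eq_zero (s := B) fun j hj => by rw [hGB j hj]; norm_num, add_zero, mul_assoc] at h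
    exact le_of_mul_le_mul_left h hn'
  set R := H - VB.starProjection H - G with hRdef
  have f4 : cLow * cUp * ‖R‖ ^ 2 ≤ n * gB * (cUp - cLow) := by
    have h1 : n * gB ≤ cUp * ‖VB.starProjection H‖ ^ 2 := by
      have h := hRB.sum_sq_inner_le hcU.le (VB.starProjection H)
      rw [Finset.sum_congr rfl fun j hj => by
        rw [inner_col_starProjection hj, hHg j (hBA hj)], hnn, mul_assoc] at h
      exact le_of_mul_le_mul_left h hn'
    have h2 : ‖H - G‖ ^ 2 = ‖R‖ ^ 2 + ‖VB.starProjection H‖ ^ 2 := by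
      have : H - G = R + VB.starProjection H := by rw [hRdef]; abel
      have h0 : inner ℝ R (VB.starProjection H) = 0 := by
        rw [hRdef, inner_sub_left, hGperp _ (VB.starProjection_apply_mem H),
          Submodule.starProjection_inner_eq_zero H _ (VB.starProjection_apply_mem H), sub_zero]
      rw [this, norm_add_sq_real, h0]; ring
    have h3 := mul_le_mul_of_nonneg_left f1 hcU.le
    have h4 := mul_le_mul_of_nonneg_left h1 hcL.le
    rw [h2] at h3
    nlinarith
  have f5 : n * cLow * ∑ j ∈ C, b j ^ 2 ≤ ‖β‖ ^ 2 := by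
    obtain ⟨b0, hb0, hb0'⟩ := mem_colSpan.1 (VB.starProjection_apply_mem (applyX X b))
    have hmem : b - b0 ∈ supportedIn A :=
      (supportedIn A).sub_mem hb fun j hj => hb0 j fun hjB => hj (hBA hjB)
    have h := (hR _ hmem).1
    rw [applyX_sub, hb0', ← hβ] at h
    refine le_trans ?_ h
    gcongr
    rw [norm_sq_of_mem_supportedIn hmem, hsplit]
    have : ∑ j ∈ C, b j ^ 2 = ∑ j ∈ C, (b - b0) j ^ 2 :=
      Finset.sum_congr rfl fun j hj => by
        rw [PiLp.sub_apply, hb0 j (Finset.mem_sdiff.1 hj).2, sub_zero]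
    rw [this]
    exact le_add_of_nonneg_right (Finset.sum_nonneg fun _ _ => sq_nonneg _)
  have f6 : inner ℝ G β = n * ∑ j ∈ C, g j * b j := by
    rw [hβ, inner_sub_right, hGperp _ (VB.starProjection_apply_mem _), sub_zero, real_inner_comm,
      inner_applyX, sum_mul_of_mem_supportedIn hb, hsplit, Finset.sum_eq_zero (s := B) fun j hj => by
        rw [hGB j hj, mul_zero], add_zero, Finset.mul_sum]
    exact Finset.sum_congr rfl fun j hj => by rw [hGC j hj]; ring
  have f7 : 2 * inner ℝ G E ≤ α * ‖G‖ ^ 2 + α⁻¹ * ‖E‖ ^ 2 := by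
    have h1 := real_inner_le_norm G E
    have h2 : α * ‖G‖ ^ 2 + α⁻¹ * ‖E‖ ^ 2 - 2 * (‖G‖ * ‖E‖) =
        α⁻¹ * (α * ‖G‖ - ‖E‖) ^ 2 := by field_simp; ring
    have h3 : 0 ≤ α⁻¹ * (α * ‖G‖ - ‖E‖) ^ 2 := by positivity
    linarith
  have f8 : ‖β + G‖ ^ 2 ≤ (1 + τ) * ‖E‖ ^ 2 + (1 + τ⁻¹) * ‖R‖ ^ 2 := by
    have h0 : β + G = E - R := by rw [hRdef, hQH]; abel
    have h1 : ‖β + G‖ ≤ ‖E‖ + ‖R‖ := by rw [h0]; exact norm_sub_le _ _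
    have h2 : (1 + τ) * ‖E‖ ^ 2 + (1 + τ⁻¹) * ‖R‖ ^ 2 - (‖E‖ + ‖R‖) ^ 2 =
        τ⁻¹ * (τ * ‖E‖ - ‖R‖) ^ 2 := by field_simp; ring
    have h3 : 0 ≤ τ⁻¹ * (τ * ‖E‖ - ‖R‖) ^ 2 := by positivity
    have h4 : ‖β + G‖ ^ 2 ≤ (‖E‖ + ‖R‖) ^ 2 := by gcongr
    linarith
  have f8' : ‖β + G‖ ^ 2 = ‖β‖ ^ 2 + 2 * inner ℝ G β + ‖G‖ ^ 2 := by
    rw [norm_add_sq_real, real_inner_comm]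
  set S := ∑ j ∈ C, g j * b j
  set T := ∑ j ∈ C, b j ^ 2
  constructor
  · have h1 : cUp * ‖H - G‖ ^ 2 ≤ cUp / cLow * (n * gB) := by
      calc cUp * ‖H - G‖ ^ 2 = cUp / cLow * (cLow * ‖H - G‖ ^ 2) := by field_simp
        _ ≤ _ := by gcongr
    have h2 := mul_le_mul_of_nonneg_left f7 hcU.le
    have h3 : cUp * (α⁻¹ * ‖E‖ ^ 2) ≤ n * α * e := by
      calc cUp * (α⁻¹ * ‖E‖ ^ 2) = α⁻¹ * (cUp * ‖E‖ ^ 2) := by ring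
        _ ≤ α⁻¹ * (n * α ^ 2 * e) := by gcongr
        _ = _ := by field_simp
    have h4 := mul_le_mul_of_nonneg_left f3 hα1'.le
    rw [f1', f6] at h1
    refine le_of_mul_le_mul_left ?_ hn'
    linarith
  · have h1 := mul_le_mul_of_nonneg_left f8 hcU.le
    have h2 : cUp * ((1 + τ) * ‖E‖ ^ 2) ≤ (1 + τ) * (n * α ^ 2 * e) := by
      calc cUp * ((1 + τ) * ‖E‖ ^ 2) = (1 + τ) * (cUp * ‖E‖ ^ 2) := by ring
        _ ≤ _ := by gcongr
    have h3 : cUp * ((1 + τ⁻¹) * ‖R‖ ^ 2) ≤ (1 + τ⁻¹) * (n * ((cUp / cLow - 1) * gB)) := by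
      calc cUp * ((1 + τ⁻¹) * ‖R‖ ^ 2) = (1 + τ⁻¹) * (cLow⁻¹ * (cLow * cUp * ‖R‖ ^ 2)) := by
            field_simp
        _ ≤ (1 + τ⁻¹) * (cLow⁻¹ * (n * gB * (cUp - cLow))) := by gcongr
        _ = _ := by field_simp
    have h4 := mul_le_mul_of_nonneg_left f5 hcU.le
    rw [f8', f6] at h1
    refine le_of_mul_le_mul_left ?_ hn'
    linarith

/-- The basic inequality: at a critical point `lam ⊕ b` with `b` supported in `A`, the number
`|A \ B|` of coordinates on which the gradient is nearly extremal is controlled by `|B|`, as long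
as the response has little energy in the orthogonal complement of the columns in `B` inside the
span of those in `A`. -/
theorem sparsity_inequality {A B : Finset (Fin p)} (hBA : B ⊆ A) {cLow cUp κ α w t lam : ℝ}
    (hn : 0 < n) (hR : RieszOn X A cLow cUp)
    (hκ : 0 < κ) (hκc : κ < cLow) (hc : cLow ≤ cUp) (hα0 : 0 < α) (hα1 : α < 1) (hw : 0 < w)
    (hweq : w * (cLow * cUp / κ ^ 2 - 1) = 2 - α) (ht : 0 < t) (hlam : 0 < lam)
    {y : EuclideanSpace ℝ (Fin n)} {b : EuclideanSpace ℝ (Fin p)} (hb : b ∈ supportedIn A)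
    {g : Fin p → ℝ} (hg : ∀ j ∈ A, inner ℝ (col X j) (y - applyX X b) = n * g j)
    (hgl : ∀ j ∈ A, |g j| ≤ lam)
    (hgC : ∀ j ∈ A \ B, lam - κ * |b j| ≤ |g j| ∧ 0 ≤ g j * b j)
    (hQ : cUp * ‖(colSpan X A).starProjection y - (colSpan X B).starProjection y‖ ^ 2 ≤
      (A \ B).card * n * α ^ 2 * lam ^ 2) :
    (2 + w * (1 + α - t * α)) * (1 - α) * (A \ B).card ≤
      ((1 + w * (1 + (α / t) / (1 - α))) * cUp / cLow - 1 - w) * B.card := by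
  have hcL : 0 < cLow := hκ.trans hκc
  have hcU : 0 < cUp := hcL.trans_le hc
  have hα1' : 0 < 1 - α := by linarith
  set τ := t * (1 - α) / α with hτ
  have hτ0 : 0 < τ := by positivity
  set C := A \ B
  set M : ℝ := (C.card : ℝ)
  set D : ℝ := (B.card : ℝ)
  obtain ⟨I1, I2⟩ := energy_inequalities (e := M * lam ^ 2) hBA hn hR hcL hc hα0 hα1 hτ0 hb hg
    (by linarith)
  set gB := ∑ j ∈ B, g j ^ 2
  set gC := ∑ j ∈ C, g j ^ 2
  set S := ∑ j ∈ C, g j * b j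
  set T := ∑ j ∈ C, b j ^ 2
  have hgB : gB ≤ D * lam ^ 2 := by
    calc gB ≤ ∑ j ∈ B, lam ^ 2 :=
          Finset.sum_le_sum fun j hj => sq_le_sq' (abs_le.1 (hgl j (hBA hj))).1
            (abs_le.1 (hgl j (hBA hj))).2
      _ = D * lam ^ 2 := by rw [Finset.sum_const, nsmul_eq_mul]
  have hratio : 0 ≤ cUp / cLow - 1 := by
    rw [sub_nonneg, one_le_div hcL]; exact hc
  have I3 : M * ((2 - α + w) * lam ^ 2) ≤
      (2 - α) * gC + 2 * cUp * S + w * (cUp * cLow * T + 2 * cUp * S + gC) := by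
    have : ∑ j ∈ C, ((2 - α) * |g j| ^ 2 + 2 * cUp * (|g j| * |b j|)
        + w * (cUp * cLow * |b j| ^ 2 + 2 * cUp * (|g j| * |b j|) + |g j| ^ 2)) =
        (2 - α) * gC + 2 * cUp * S + w * (cUp * cLow * T + 2 * cUp * S + gC) := by
      simp only [gC, S, T, Finset.mul_sum, ← Finset.sum_add_distrib]
      refine Finset.sum_congr rfl fun j hj => ?_
      rw [sq_abs, sq_abs, ← abs_mul, abs_of_nonneg (hgC j hj).2]
    rw [← this, ← nsmul_eq_mul]
    exact Finset.card_nsmul_le_sum _ _ _ fun j hj =>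
      coordinate_bound hκ hκc hc hα0 hα1 hw hweq (abs_nonneg _)
        (hgl j (Finset.sdiff_subset hj)) (hgC j hj).1
  have hτα : (1 + τ) * (α ^ 2 * (M * lam ^ 2)) = (α ^ 2 + t * α * (1 - α)) * (M * lam ^ 2) := by
    rw [hτ]; field_simp
  have hτi : τ⁻¹ = (α / t) / (1 - α) := by rw [hτ]; field_simp
  set θ := (α / t) / (1 - α)
  have hθ : 0 ≤ θ := by positivity
  rw [hτα, hτi] at I2
  have I2' := mul_le_mul_of_nonneg_left I2 hw.le
  have J : (cUp / cLow - 1) * gB + w * ((1 + θ) * ((cUp / cLow - 1) * gB)) ≤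
      ((1 + w * (1 + θ)) * cUp / cLow - 1 - w) * (D * lam ^ 2) := by
    calc (cUp / cLow - 1) * gB + w * ((1 + θ) * ((cUp / cLow - 1) * gB))
        = ((1 + w * (1 + θ)) * (cUp / cLow - 1)) * gB := by ring
      _ ≤ ((1 + w * (1 + θ)) * (cUp / cLow - 1)) * (D * lam ^ 2) := by gcongr
      _ ≤ ((1 + w * (1 + θ)) * cUp / cLow - 1 - w) * (D * lam ^ 2) := by
        refine mul_le_mul_of_nonneg_right ?_ (by positivity)
        rw [mul_sub, mul_one, ← mul_div_assoc]
        nlinarith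
  have hl2 : 0 < lam ^ 2 := by positivity
  refine le_of_mul_le_mul_right ?_ hl2
  linarith

end Sparsity

/-! ### The constant `K_*` -/

section Kstar

variable {cLow cUp κ α : ℝ}

lemma wConst_spec (hκ : 0 < κ) (hκc : κ < cLow) (hc : cLow ≤ cUp) (hα1 : α < 1) :
    0 < wConst cLow cUp κ α ∧
      wConst cLow cUp κ α * (cLow * cUp / κ ^ 2 - 1) = 2 - α := by
  have h1 : 0 < cLow * cUp / κ ^ 2 - 1 := by
    rw [sub_pos, one_lt_div (by positivity)]
    nlinarith
  rw [wConst, if_neg hκ.ne']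
  exact ⟨div_pos (by linarith) h1, div_mul_cancel₀ _ h1.ne'⟩

/-- A lower bound for `K_*` from a lower bound, uniform in `t`, of the quotients that define it. -/
lemma le_Kstar (hκ : 0 < κ) (hκc : κ < cLow) (hc : cLow ≤ cUp) (hα0 : 0 < α) (hα1 : α < 1)
    {w x : ℝ} (hwdef : w = wConst cLow cUp κ α)
    (h : ∀ t, 0 < t → 0 < (2 + w * (1 + α - t * α)) * (1 - α) →
      x * ((2 + w * (1 + α - t * α)) * (1 - α)) ≤
        (1 + w * (1 + (α / t) / (1 - α))) * cUp / cLow - 1) :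
    x ≤ Kstar cLow cUp κ α := by
  have hw : 0 < w := hwdef ▸ (wConst_spec hκ hκc hc hα1).1
  rw [Kstar, ← hwdef]
  refine le_csInf ?_ ?_
  · refine Set.Nonempty.image _ ⟨(2 / w + 1 + α) / α / 2, by positivity, Or.inr ?_⟩
    exact half_lt_self (by positivity)
  · rintro _ ⟨t, ⟨ht, ht'⟩, rfl⟩
    have ht2 : t * α < 2 / w + 1 + α := by
      rw [← lt_div_iff₀ hα0]; exact ht'.resolve_left hw.ne'
    have hden : 0 < (2 + w * (1 + α - t * α)) * (1 - α) := by
      refine mul_pos ?_ (by linarith)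
      have := mul_lt_mul_of_pos_left ht2 hw
      have h2 : w * (2 / w + 1 + α) = 2 + w * (1 + α) := by field_simp; ring
      nlinarith
    rw [le_div_iff₀ hden]
    exact h t ht hden

lemma Kstar_pos (hκ : 0 < κ) (hκc : κ < cLow) (hc : cLow ≤ cUp) (hα0 : 0 < α) (hα1 : α < 1) :
    0 < Kstar cLow cUp κ α := by
  obtain ⟨hw, -⟩ := wConst_spec hκ hκc hc hα1
  set w := wConst cLow cUp κ α with hwdef
  have hcL : 0 < cLow := hκ.trans hκc
  have hα1' : 0 < 1 - α := by linarith
  set D0 := (2 + w * (1 + α)) * (1 - α)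
  have hD0 : 0 < D0 := by positivity
  refine lt_of_lt_of_le (div_pos hw hD0) (le_Kstar hκ hκc hc hα0 hα1 hwdef fun t ht hden => ?_)
  have h1 : (2 + w * (1 + α - t * α)) * (1 - α) ≤ D0 := by
    refine mul_le_mul_of_nonneg_right ?_ hα1'.le
    nlinarith [mul_pos hw (mul_pos ht hα0)]
  have h2 : w / D0 * ((2 + w * (1 + α - t * α)) * (1 - α)) ≤ w := by
    calc _ ≤ w / D0 * D0 := by gcongr
      _ = w := by field_simp
  have hθ : 0 ≤ (α / t) / (1 - α) := by positivity
  have h3 : 1 + w ≤ (1 + w * (1 + (α / t) / (1 - α))) * cUp / cLow := by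
    rw [le_div_iff₀ hcL]
    have : 1 + w ≤ 1 + w * (1 + (α / t) / (1 - α)) := by nlinarith
    gcongr
  linarith

end Kstar

/-- Under the sparsity assumption `d° (1 + K_*) ≤ d^*`, the gradient cannot be nearly extremal on
`d^* - d°` coordinates outside `B` when the response has little energy there. The strict gap `w`
in `sparsity_inequality` makes it unnecessary to know that the infimum `K_*` is attained. -/
theorem no_large_model {n p : ℕ} {X : Matrix (Fin n) (Fin p) ℝ} {A B : Finset (Fin p)}
    (hBA : B ⊆ A) {cLow cUp κ α lam : ℝ}
    (hn : 0 < n) (hR : RieszOn X A cLow cUp)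
    (hκ : 0 < κ) (hκc : κ < cLow) (hc : cLow ≤ cUp) (hα0 : 0 < α) (hα1 : α < 1) (hlam : 0 < lam)
    (hK : (B.card : ℝ) ≤ A.card / (1 + Kstar cLow cUp κ α)) (hAB : 0 < (A \ B).card)
    {y : EuclideanSpace ℝ (Fin n)} {b : EuclideanSpace ℝ (Fin p)} (hb : b ∈ supportedIn A)
    {g : Fin p → ℝ} (hg : ∀ j ∈ A, inner ℝ (col X j) (y - applyX X b) = n * g j)
    (hgl : ∀ j ∈ A, |g j| ≤ lam)
    (hgC : ∀ j ∈ A \ B, lam - κ * |b j| ≤ |g j| ∧ 0 ≤ g j * b j)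
    (hQ : cUp * ‖(colSpan X A).starProjection y - (colSpan X B).starProjection y‖ ^ 2 ≤
      (A \ B).card * n * α ^ 2 * lam ^ 2) : False := by
  obtain ⟨hw, hweq⟩ := wConst_spec hκ hκc hc hα1
  have hKpos := Kstar_pos hκ hκc hc hα0 hα1
  set w := wConst cLow cUp κ α with hwdef
  have key := fun t (ht : 0 < t) => sparsity_inequality hBA hn hR hκ hκc hc hα0 hα1 hw hweq ht
    hlam hb hg hgl hgC hQ
  have hα1' : 0 < 1 - α := by linarith
  have hM : (0 : ℝ) < (A \ B).card := by exact_mod_cast hAB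
  have hcard : (A.card : ℝ) = B.card + (A \ B).card := by
    rw [← Finset.card_sdiff_add_card_eq_card hBA]; push_cast; ring
  set M : ℝ := ((A \ B).card : ℝ)
  rcases Nat.eq_zero_or_pos B.card with h0 | h0
  · have := key 1 one_pos
    rw [h0, Nat.cast_zero, mul_zero, one_mul] at this
    have : 0 < (2 + w * (1 + α - α)) * (1 - α) * M := by
      have : 0 < 2 + w * (1 + α - α) := by nlinarith
      positivity
    linarith
  · have hD : (0 : ℝ) < B.card := by exact_mod_cast h0
    set D : ℝ := (B.card : ℝ)
    set D0 := (2 + w * (1 + α)) * (1 - α)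
    have hD0 : 0 < D0 := by positivity
    have hle : M / D + w / D0 ≤ Kstar cLow cUp κ α := by
      refine le_Kstar hκ hκc hc hα0 hα1 hwdef fun t ht hden => ?_
      have h1 : (2 + w * (1 + α - t * α)) * (1 - α) ≤ D0 := by
        refine mul_le_mul_of_nonneg_right ?_ hα1'.le
        nlinarith [mul_pos hw (mul_pos ht hα0)]
      have h2 : w / D0 * ((2 + w * (1 + α - t * α)) * (1 - α)) ≤ w := by
        calc _ ≤ w / D0 * D0 := by gcongr
          _ = w := by field_simp
      have h3 : M / D * ((2 + w * (1 + α - t * α)) * (1 - α)) ≤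
          (1 + w * (1 + (α / t) / (1 - α))) * cUp / cLow - 1 - w := by
        rw [div_mul_eq_mul_div, div_le_iff₀ hD, mul_comm M]
        exact key t ht
      linarith
    rw [hcard, le_div_iff₀ (by linarith)] at hK
    have h4 : D * Kstar cLow cUp κ α ≤ M := by linarith
    have h5 : M < D * Kstar cLow cUp κ α := by
      calc M = D * (M / D) := by field_simp
        _ < D * Kstar cLow cUp κ α := by
          gcongr
          have : 0 < w / D0 := by positivity
          linarith
    linarith

/-! ### Penalties and critical points -/

section Penalty

variable {ρ : ℝ → ℝ → ℝ} {lam1 γ κ lam : ℝ}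

lemma IsPenalty.rhoDot_nonneg (h : IsPenalty ρ lam1 γ κ) (h1 : lam1 ≤ lam) (h0 : 0 < lam)
    {t : ℝ} (ht : 0 < t) : 0 ≤ rhoDot ρ t lam := by
  rw [rhoDot, ← derivWithin_of_mem_nhds (Ici_mem_nhds ht)]
  exact (h.mono lam h1 h0).derivWithin_nonneg

lemma IsPenalty.rhoDot_le (h : IsPenalty ρ lam1 γ κ) (h1 : lam1 ≤ lam) (h0 : 0 < lam)
    {t : ℝ} (ht : 0 < t) : rhoDot ρ t lam ≤ lam := by
  refine (h.deriv_le lam h1 h0 t ht).trans ?_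
  split_ifs
  exacts [le_rfl, h0.le]

lemma IsPenalty.rhoDot_eq_zero (h : IsPenalty ρ lam1 γ κ) (h1 : lam1 ≤ lam) (h0 : 0 < lam)
    {t : ℝ} (ht : 0 < t) (hγ : γ * lam < t) : rhoDot ρ t lam = 0 := by
  have := h.deriv_le lam h1 h0 t ht
  rw [if_neg hγ.not_ge] at this
  exact this.antisymm (h.rhoDot_nonneg h1 h0 ht)

/-- Bounded concavity, read from `0`: `ρ̇(t) ≥ lam - κ t`. -/
lemma IsPenalty.sub_le_rhoDot (h : IsPenalty ρ lam1 γ κ) (h1 : lam1 ≤ lam) (h0 : 0 < lam)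
    {t : ℝ} (ht : 0 < t) : lam - κ * t ≤ rhoDot ρ t lam := by
  have hlim : Tendsto (fun s => rhoDot ρ s lam - κ * (t - s)) (𝓝[>] 0) (𝓝 (lam - κ * (t - 0))) :=
    (h.deriv_zero lam h1 h0).sub
      (((tendsto_const_nhds.sub tendsto_id).const_mul κ).mono_left nhdsWithin_le_nhds)
  rw [sub_zero] at hlim
  refine le_of_tendsto hlim ?_
  filter_upwards [Ioo_mem_nhdsGT ht] with s hs
  linarith [h.concavity lam h1 h0 s t hs.1 hs.2]

/-- A penalty with `ρ̇(t; lam) = 0` for large `t` and `ρ̇(0+; lam) = lam > 0` is strictly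
concave somewhere. -/
lemma IsPenalty.kappa_pos (h : IsPenalty ρ lam1 γ κ) (hκ : 0 ≤ κ) : 0 < κ := by
  refine hκ.lt_of_ne fun hκ0 => ?_
  set l := max lam1 1
  have h1 : lam1 ≤ l := le_max_left _ _
  have h0 : 0 < l := one_pos.trans_le (le_max_right _ _)
  set t := max (γ * l) 0 + 1
  have ht : 0 < t := by positivity
  have hγ : γ * l < t := lt_add_of_le_of_pos (le_max_left _ _) one_pos
  have h2 := h.sub_le_rhoDot h1 h0 ht
  rw [h.rhoDot_eq_zero h1 h0 ht hγ, ← hκ0] at h2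
  linarith

lemma IsPenalty.gamma_pos (h : IsPenalty ρ lam1 γ κ) : 0 < γ := by
  by_contra! hγ
  set l := max lam1 1
  have h1 : lam1 ≤ l := le_max_left _ _
  have h0 : 0 < l := one_pos.trans_le (le_max_right _ _)
  have : l ≤ 0 := by
    refine le_of_tendsto (h.deriv_zero l h1 h0) ?_
    filter_upwards [self_mem_nhdsWithin] with t ht
    rw [h.rhoDot_eq_zero h1 h0 ht ((mul_nonpos_of_nonpos_of_nonneg hγ h0.le).trans_lt ht)]
  linarith

lemma abs_sign_of_ne_zero {z : ℝ} (hz : z ≠ 0) : |Real.sign z| = 1 := by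
  rcases Real.sign_apply_eq_of_ne_zero z hz with h | h <;> rw [h] <;> norm_num

/-- The critical equations of one coordinate with value `b` and gradient `g`. -/
def IsCriticalCoord (ρ : ℝ → ℝ → ℝ) (lam b g : ℝ) : Prop :=
  (b ≠ 0 → g = Real.sign b * rhoDot ρ |b| lam) ∧ (b = 0 → |g| ≤ lam)

lemma IsCriticalCoord.abs_le (hρ : IsPenalty ρ lam1 γ κ) (h1 : lam1 ≤ lam) (h0 : 0 < lam)
    {b g : ℝ} (h : IsCriticalCoord ρ lam b g) : |g| ≤ lam := by
  by_cases hb : b = 0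
  · exact h.2 hb
  · rw [h.1 hb, abs_mul, abs_of_nonneg (hρ.rhoDot_nonneg h1 h0 (abs_pos.2 hb))]
    rw [abs_sign_of_ne_zero hb, one_mul]
    exact hρ.rhoDot_le h1 h0 (abs_pos.2 hb)

lemma IsCriticalCoord.mul_nonneg (hρ : IsPenalty ρ lam1 γ κ) (h1 : lam1 ≤ lam) (h0 : 0 < lam)
    {b g : ℝ} (h : IsCriticalCoord ρ lam b g) : 0 ≤ g * b := by
  by_cases hb : b = 0
  · simp [hb]
  · have h2 := hρ.rhoDot_nonneg h1 h0 (abs_pos.2 hb)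
    rw [h.1 hb, mul_right_comm]
    refine _root_.mul_nonneg ?_ h2
    rcases lt_or_gt_of_ne hb with hb | hb
    · rw [Real.sign_of_neg hb]; linarith
    · rw [Real.sign_of_pos hb]; linarith

lemma IsCriticalCoord.sub_le_abs (hρ : IsPenalty ρ lam1 γ κ) (h1 : lam1 ≤ lam) (h0 : 0 < lam)
    {b g : ℝ} (h : IsCriticalCoord ρ lam b g) (hb : b ≠ 0) : lam - κ * |b| ≤ |g| := by
  rw [h.1 hb, abs_mul]
  rw [abs_sign_of_ne_zero hb, one_mul]
  exact (hρ.sub_le_rhoDot h1 h0 (abs_pos.2 hb)).trans (le_abs_self _)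

/-- The gradient of a penalty with concavity at most `κ`, with the interval `[-lam, lam]` at `0`,
decreases by at most `κ (b - b')` between `b' < b`. -/
lemma IsCriticalCoord.sub_le_of_lt (hρ : IsPenalty ρ lam1 γ κ) (hκ : 0 ≤ κ) (h1 : lam1 ≤ lam)
    (h0 : 0 < lam) {b g b' g' : ℝ} (h : IsCriticalCoord ρ lam b g)
    (h' : IsCriticalCoord ρ lam b' g') (hlt : b' < b) : g' - g ≤ κ * (b - b') := by
  have hpos {b g : ℝ} (h : IsCriticalCoord ρ lam b g) (hb : 0 < b) : g = rhoDot ρ b lam := by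
    rw [h.1 hb.ne', Real.sign_of_pos hb, abs_of_pos hb, one_mul]
  have hneg {b g : ℝ} (h : IsCriticalCoord ρ lam b g) (hb : b < 0) : g = -rhoDot ρ (-b) lam := by
    rw [h.1 hb.ne, Real.sign_of_neg hb, abs_of_neg hb, neg_one_mul]
  rcases lt_trichotomy b' 0 with hb' | rfl | hb'
  · have hn' := neg_pos.2 hb'
    rw [hneg h' hb']
    rcases lt_trichotomy b 0 with hb | rfl | hb
    · rw [hneg h hb]
      have := hρ.concavity lam h1 h0 (-b) (-b') (neg_pos.2 hb) (neg_lt_neg hlt)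
      linarith
    · have := hρ.sub_le_rhoDot h1 h0 hn'
      have := (_root_.abs_le.1 (h.2 rfl)).1
      linarith
    · rw [hpos h hb]
      have := hρ.rhoDot_nonneg h1 h0 hb
      have := hρ.rhoDot_nonneg h1 h0 hn'
      have : 0 ≤ κ * (b - b') := _root_.mul_nonneg hκ (by linarith)
      linarith
  · rw [hpos h hlt]
    have := hρ.sub_le_rhoDot h1 h0 hlt
    have := (_root_.abs_le.1 (h'.2 rfl)).2
    linarith
  · rw [hpos h' hb', hpos h (hb'.trans hlt)]
    exact hρ.concavity lam h1 h0 b' b hb' hlt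

lemma IsCriticalCoord.sub_mul_sub_le (hρ : IsPenalty ρ lam1 γ κ) (hκ : 0 ≤ κ) (h1 : lam1 ≤ lam)
    (h0 : 0 < lam) {b g b' g' : ℝ} (h : IsCriticalCoord ρ lam b g)
    (h' : IsCriticalCoord ρ lam b' g') : (b - b') * (g' - g) ≤ κ * (b - b') ^ 2 := by
  rcases lt_trichotomy b' b with hlt | rfl | hlt
  · have := mul_le_mul_of_nonneg_left (h.sub_le_of_lt hρ hκ h1 h0 h' hlt) (sub_pos.2 hlt).le
    nlinarith
  · simp
  · have := mul_le_mul_of_nonneg_left (h'.sub_le_of_lt hρ hκ h1 h0 h hlt) (sub_pos.2 hlt).le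
    nlinarith

end Penalty

section Critical

variable {n p : ℕ} {X : Matrix (Fin n) (Fin p) ℝ} {y : EuclideanSpace ℝ (Fin n)}
  {ρ : ℝ → ℝ → ℝ} {lam1 γ κ lam : ℝ}

lemma IsCritical.coord {b : EuclideanSpace ℝ (Fin p)} (h : IsCritical X y ρ lam b) (j : Fin p) :
    IsCriticalCoord ρ lam (b j) (inner ℝ (col X j) (y - applyX X b) / n) := h j

/-- The penalized loss is strictly convex on models of size at most the Riesz rank, so two critical
points whose difference is that sparse coincide. -/
lemma IsCritical.eq_of_sub_mem (hρ : IsPenalty ρ lam1 γ κ) (hκ : 0 ≤ κ) (h1 : lam1 ≤ lam)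
    (h0 : 0 < lam) (hn : 0 < n) {A : Finset (Fin p)} {cLow cUp : ℝ} (hR : RieszOn X A cLow cUp)
    (hκc : κ < cLow) {b b' : EuclideanSpace ℝ (Fin p)} (h : IsCritical X y ρ lam b)
    (h' : IsCritical X y ρ lam b') (hA : b - b' ∈ supportedIn A) : b = b' := by
  have hn' : (0 : ℝ) < n := by exact_mod_cast hn
  have h2 : ‖applyX X (b - b')‖ ^ 2 ≤ n * κ * ‖b - b'‖ ^ 2 := by
    rw [← real_inner_self_eq_norm_sq, inner_applyX, EuclideanSpace.real_norm_sq_eq, Finset.mul_sum]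
    refine Finset.sum_le_sum fun j _ => ?_
    have h3 := (h.coord j).sub_mul_sub_le hρ hκ h1 h0 (h'.coord j)
    have h4 : inner ℝ (col X j) (applyX X (b - b')) =
        n * (inner ℝ (col X j) (y - applyX X b') / n
          - inner ℝ (col X j) (y - applyX X b) / n) := by
      rw [mul_sub, mul_div_cancel₀ _ hn'.ne', mul_div_cancel₀ _ hn'.ne', ← inner_sub_right,
        applyX_sub]
      congr 1; abel
    rw [h4, PiLp.sub_apply]
    nlinarith
  have h3 := (hR _ hA).1
  have h4 : ‖b - b'‖ ^ 2 ≤ 0 := by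
    by_contra! hpos
    have : n * κ * ‖b - b'‖ ^ 2 < n * cLow * ‖b - b'‖ ^ 2 := by gcongr
    linarith
  rw [← sub_eq_zero, ← norm_eq_zero]
  exact pow_eq_zero_iff two_ne_zero |>.1 (h4.antisymm (sq_nonneg _))

/-- The zero vector stays critical when the penalty level increases. -/
lemma IsCritical.zero_mono {lam' : ℝ} (h : IsCritical X y ρ lam 0) (hle : lam ≤ lam') :
    IsCritical X y ρ lam' 0 := fun j =>
  ⟨fun hj => absurd rfl hj, fun _ => ((h j).2 rfl).trans hle⟩

/-- A least squares fit on `B` is critical at level `lam` when its coefficients exceed `γ lam` and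
the correlations of its residual with the other columns are at most `lam`. -/
lemma isCritical_of_large (hρ : IsPenalty ρ lam1 γ κ) (h1 : lam1 ≤ lam) (h0 : 0 < lam)
    {B : Finset (Fin p)} {b : EuclideanSpace ℝ (Fin p)} (hb : b ∈ supportedIn B)
    (hlarge : ∀ j ∈ B, γ * lam < |b j|)
    (hin : ∀ j ∈ B, inner ℝ (col X j) (y - applyX X b) = 0)
    (hout : ∀ j ∉ B, |inner ℝ (col X j) (y - applyX X b) / n| ≤ lam) :
    IsCritical X y ρ lam b := by
  intro j
  by_cases hj : j ∈ B
  · have hpos : 0 < |b j| := (mul_pos hρ.gamma_pos h0).trans (hlarge j hj)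
    refine ⟨fun _ => ?_, fun h => absurd h (abs_pos.1 hpos)⟩
    rw [hin j hj, hρ.rhoDot_eq_zero h1 h0 hpos (hlarge j hj)]
    simp
  · exact ⟨fun h => absurd (hb j hj) h, fun _ => hout j hj⟩

end Critical

/-! ### The oracle least squares estimator -/

section Oracle

variable {n p : ℕ} {X : Matrix (Fin n) (Fin p) ℝ} {y : EuclideanSpace ℝ (Fin n)}
  {B : Finset (Fin p)}

lemma norm_sub_sq_of_mem_colSpan {v : EuclideanSpace ℝ (Fin n)} (hv : v ∈ colSpan X B) :
    ‖y - v‖ ^ 2 = ‖y - (colSpan X B).starProjection y‖ ^ 2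
      + ‖(colSpan X B).starProjection y - v‖ ^ 2 := by
  have h : y - v = (y - (colSpan X B).starProjection y) + ((colSpan X B).starProjection y - v) := by
    abel
  rw [h, norm_add_sq_real, Submodule.starProjection_inner_eq_zero y _
    ((colSpan X B).sub_mem ((colSpan X B).starProjection_apply_mem y) hv)]
  ring

lemma oracleLSE_spec (X : Matrix (Fin n) (Fin p) ℝ) (y : EuclideanSpace ℝ (Fin n))
    (B : Finset (Fin p)) :
    oracleLSE X y B ∈ supportedIn B ∧
      applyX X (oracleLSE X y B) = (colSpan X B).starProjection y := by
  obtain ⟨b0, hb0, hb0'⟩ := mem_colSpan.1 ((colSpan X B).starProjection_apply_mem y)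
  have hex : ∃ b, IsOracleLSE X y B b := by
    refine ⟨b0, hb0, fun b' hb' => ?_⟩
    rw [hb0', norm_sub_sq_of_mem_colSpan (y := y) (applyX_mem_colSpan (X := X) hb')]
    exact le_add_of_nonneg_right (sq_nonneg _)
  have h := Classical.epsilon_spec hex
  change IsOracleLSE X y B (oracleLSE X y B) at h
  refine ⟨h.1, ?_⟩
  have h2 := h.2 b0 hb0
  rw [hb0', norm_sub_sq_of_mem_colSpan (y := y) (applyX_mem_colSpan (X := X) h.1)] at h2
  have h3 : ‖(colSpan X B).starProjection y - applyX X (oracleLSE X y B)‖ ^ 2 ≤ 0 := by linarith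
  have h4 := pow_eq_zero_iff two_ne_zero |>.1 (h3.antisymm (sq_nonneg _))
  exact (sub_eq_zero.1 (norm_eq_zero.1 h4)).symm

/-- The dual basis of the columns in `B`: the coefficients of the oracle estimator are inner
products with vectors of squared length `w_j / n`, where `w_j` is the `j`-th diagonal element of
`Σ_B⁻¹`. -/
lemma exists_dual_vector (hn : 0 < n) {cLow cUp : ℝ} (hR : RieszOn X B cLow cUp) (hc : 0 < cLow)
    (j : B) : ∃ a ∈ colSpan X B, (∀ i ∈ B, inner ℝ (col X i) a = if i = j then 1 else 0) ∧
      ‖a‖ ^ 2 = (subGram X B)⁻¹ j j / n := by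
  classical
  have hn' : (n : ℝ) ≠ 0 := by positivity
  choose a haB ha using fun j : B =>
    hR.exists_mem_colSpan_inner_eq hn hc (fun i => if i = j then 1 else 0)
  choose c hc hca using fun j => mem_colSpan.1 (haB j)
  refine ⟨a j, haB j, ha j, ?_⟩
  have hinv : (subGram X B)⁻¹ = Matrix.of fun k j : B => n * c j k := by
    refine Matrix.inv_eq_right_inv ?_
    ext i j
    have h := ha j i i.2
    rw [← hca, real_inner_comm, inner_applyX, sum_mul_of_mem_supportedIn (hc j),
      ← Finset.sum_coe_sort B] at h
    rw [Matrix.mul_apply, Matrix.one_apply]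
    simp only [Subtype.ext_iff]
    rw [← h]
    refine Finset.sum_congr rfl fun k _ => ?_
    rw [subGram, Matrix.submatrix_apply, gram_apply, Matrix.of_apply,
      real_inner_comm (col X i.1)]
    field_simp
  rw [hinv, Matrix.of_apply, mul_div_cancel_left₀ _ hn', ← real_inner_self_eq_norm_sq]
  conv_lhs => rw [← hca j]
  rw [inner_applyX, hca, sum_mul_of_mem_supportedIn (hc j), Finset.sum_eq_single j.1]
  · rw [ha j j j.2, if_pos rfl, mul_one]
  · intro i hi hij
    rw [ha j i hi, if_neg hij, mul_zero]
  · exact fun h => absurd j.2 h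

end Oracle

/-! ### The solution path -/

section Path

variable {n p : ℕ} {X : Matrix (Fin n) (Fin p) ℝ} {y : EuclideanSpace ℝ (Fin n)}
  {ρ : ℝ → ℝ → ℝ} {lamP : ℝ → ℝ} {bP : ℝ → EuclideanSpace ℝ (Fin p)}

lemma mem_supp {b : EuclideanSpace ℝ (Fin p)} {j : Fin p} : j ∈ supp b ↔ b j ≠ 0 := by
  simp [supp]

lemma mem_supportedIn_of_supp_subset {b : EuclideanSpace ℝ (Fin p)} {A : Finset (Fin p)}
    (h : supp b ⊆ A) : b ∈ supportedIn A := fun j hj => by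
  by_contra h0; exact hj (h (mem_supp.2 h0))

lemma supp_subset_of_mem_supportedIn {b : EuclideanSpace ℝ (Fin p)} {A : Finset (Fin p)}
    (h : b ∈ supportedIn A) : supp b ⊆ A := fun j hj => by
  by_contra h0; exact mem_supp.1 hj (h j h0)

/-- Along a convergent family of vectors the support can only shrink in the limit. -/
lemma eventually_supp_subset {l : Filter ℝ} {b : EuclideanSpace ℝ (Fin p)}
    (h : Tendsto bP l (𝓝 b)) : ∀ᶠ x in l, supp b ⊆ supp (bP x) := by
  have h1 : ∀ᶠ x in l, ∀ j, b j ≠ 0 → bP x j ≠ 0 := by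
    refine eventually_all.2 fun j => ?_
    by_cases hj : b j = 0
    · exact Eventually.of_forall fun x h => absurd hj h
    · have h2 : Tendsto (fun x => bP x j) l (𝓝 (b j)) :=
        ((EuclideanSpace.proj (𝕜 := ℝ) j).continuous.tendsto b).comp h
      exact (h2.eventually_ne hj).mono fun x hx _ => hx
  filter_upwards [h1] with x hx j hj
  exact mem_supp.2 (hx j (mem_supp.1 hj))

/-- The normalized gradient `x_j'(y - X b)/n`. -/
noncomputable def grad (X : Matrix (Fin n) (Fin p) ℝ) (y : EuclideanSpace ℝ (Fin n))
    (b : EuclideanSpace ℝ (Fin p)) (j : Fin p) : ℝ :=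
  inner ℝ (col X j) (y - applyX X b) / n

lemma continuous_grad (j : Fin p) : Continuous fun b => grad X y b j :=
  (continuous_const.inner (continuous_const.sub continuous_applyX)).div_const _

lemma inner_eq_mul_grad (hn : 0 < n) (b : EuclideanSpace ℝ (Fin p)) (j : Fin p) :
    inner ℝ (col X j) (y - applyX X b) = n * grad X y b j := by
  rw [grad, mul_div_cancel₀]
  exact_mod_cast hn.ne'

/-- If the support of the path jumps to `s` at `x₀`, the gradient at `x₀` is already nearly
extremal on all of `s`: on new coordinates it has reached the boundary of `[-lam, lam]`. -/
lemma IsSolutionPath.grad_of_frequently (hpath : IsSolutionPath X y ρ lamP bP)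
    {lam1 γ κ : ℝ} (hρ : IsPenalty ρ lam1 γ κ) {x₀ : ℝ} (hx₀ : 0 ≤ x₀) {s : Finset (Fin p)}
    (hlam : ∀ᶠ x in 𝓝[>] x₀, lam1 ≤ lamP x ∧ 0 < lamP x)
    (hs : ∃ᶠ x in 𝓝[>] x₀, supp (bP x) = s) {j : Fin p} (hj : j ∈ s) :
    lamP x₀ - κ * |bP x₀ j| ≤ |grad X y (bP x₀) j| ∧ 0 ≤ grad X y (bP x₀) j * bP x₀ j := by
  have hle : 𝓝[>] x₀ ≤ 𝓝[Set.Ici 0] x₀ :=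
    nhdsWithin_mono _ fun x hx => hx₀.trans (le_of_lt hx)
  have hb : Tendsto bP (𝓝[>] x₀) (𝓝 (bP x₀)) := (hpath.cont_b x₀ hx₀).mono_left hle
  have hl : Tendsto lamP (𝓝[>] x₀) (𝓝 (lamP x₀)) := (hpath.cont_lam x₀ hx₀).mono_left hle
  have hbj : Tendsto (fun x => bP x j) (𝓝[>] x₀) (𝓝 (bP x₀ j)) :=
    ((EuclideanSpace.proj (𝕜 := ℝ) j).continuous.tendsto _).comp hb
  have hg : Tendsto (fun x => grad X y (bP x) j) (𝓝[>] x₀) (𝓝 (grad X y (bP x₀) j)) :=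
    ((continuous_grad j).tendsto _).comp hb
  have hfreq : ∃ᶠ x in 𝓝[>] x₀, lamP x - κ * |bP x j| - |grad X y (bP x) j| ≤ 0 ∧
      0 ≤ grad X y (bP x) j * bP x j := by
    refine (hs.and_eventually (hlam.and self_mem_nhdsWithin)).mono ?_
    rintro x ⟨hxs, ⟨h1, h0⟩, hx⟩
    have hc := (hpath.critical x (hx₀.trans (le_of_lt hx))).coord j
    have hjs : bP x j ≠ 0 := mem_supp.1 (hxs ▸ hj)
    exact ⟨by have := hc.sub_le_abs hρ h1 h0 hjs; rw [grad]; linarith, hc.mul_nonneg hρ h1 h0⟩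
  constructor
  · have := isClosed_Iic.mem_of_frequently_of_tendsto (hfreq.mono fun x hx => hx.1)
      ((hl.sub (hbj.abs.const_mul κ)).sub hg.abs)
    linarith [Set.mem_Iic.1 this]
  · exact isClosed_Ici.mem_of_frequently_of_tendsto (hfreq.mono fun x hx => hx.2) (hg.mul hbj)

variable {lam1 lam2 lamHat γ κ cLow cUp α : ℝ} {d : ℕ} {B : Finset (Fin p)}
  {bo : EuclideanSpace ℝ (Fin p)}

/-- On the event that the least squares fit `bo` on `B` has large coefficients, small residual
correlations with the other columns, and that the response has little energy in every model of size
`d` containing `B`, the path solution equals `bo` at every level between `lam1` and `lam2`.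

The path never selects more than `d - |B|` variables outside `B` before reaching the level
`lamHat`. Such a bound is a closed condition on the path parameter. It is also open to the right:
at levels above `lam2` by `no_large_model`, and at levels below `lam2` because the path then sits
at `bo`, where the gradient is not extremal outside `B`. -/
theorem IsSolutionPath.pathSolution_eq (hpath : IsSolutionPath X y ρ lamP bP)
    (hρ : IsPenalty ρ lam1 γ κ) (hn : 0 < n) (hS : SparseRiesz X d cLow cUp)
    (hκ : 0 < κ) (hκc : κ < cLow) (hc : cLow ≤ cUp) (hα0 : 0 < α) (hα1 : α < 1)
    (hK : (B.card : ℝ) ≤ d / (1 + Kstar cLow cUp κ α)) (hBd : B.card < d)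
    (h0 : 0 < lam1) (hl1 : lam1 ≤ lamHat) (hl2 : lamHat ≤ lam2)
    (hbo : bo ∈ supportedIn B) (hlarge : ∀ j ∈ B, γ * lam2 < |bo j|)
    (hin : ∀ j ∈ B, inner ℝ (col X j) (y - applyX X bo) = 0)
    (hout : ∀ j ∉ B, |inner ℝ (col X j) (y - applyX X bo) / n| < lam1)
    (hQ : ∀ A, B ⊆ A → A.card = d →
      cUp * ‖(colSpan X A).starProjection y - (colSpan X B).starProjection y‖ ^ 2 ≤
        (A \ B).card * n * α ^ 2 * lam2 ^ 2) :
    pathSolution lamP bP lamHat = bo := by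
  have hlam2 : 0 < lam2 := h0.trans_le (hl1.trans hl2)
  have hcritO : ∀ lam, lam1 ≤ lam → lam ≤ lam2 → IsCritical X y ρ lam bo := fun lam h1 h2 =>
    isCritical_of_large hρ h1 (h0.trans_le h1) hbo
      (fun j hj => (mul_le_mul_of_nonneg_left h2 hρ.gamma_pos.le).trans_lt (hlarge j hj)) hin
      (fun j hj => (hout j hj).le.trans h1)
  set good : Set ℝ := {x | (supp (bP x) \ B).card ≤ d - B.card} with hgood
  -- Sparse critical points at levels in `[lam1, lam2]` coincide with `bo`.
  have huniq : ∀ lam b, lam1 ≤ lam → lam ≤ lam2 → IsCritical X y ρ lam b →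
      (supp b \ B).card ≤ d - B.card → b = bo := by
    intro lam b h1 h2 hb hcard
    have hA : (B ∪ supp b).card ≤ d := by
      rw [← Finset.union_sdiff_self_eq_union]
      exact (Finset.card_union_le _ _).trans (by omega)
    refine hb.eq_of_sub_mem hρ hκ.le h1 (h0.trans_le h1) hn (hS.rieszOn hA) hκc (hcritO lam h1 h2)
      ((supportedIn _).sub_mem ?_ ?_)
    · exact mem_supportedIn_of_supp_subset Finset.subset_union_right
    · exact mem_supportedIn_of_supp_subset
        ((supp_subset_of_mem_supportedIn hbo).trans Finset.subset_union_left)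
  set Z : Set ℝ := {x | 0 ≤ x ∧ lamP x ≤ lamHat} with hZ
  have hZne : Z.Nonempty := by
    have h := hpath.lim.eventually (gt_mem_nhds (h0.trans_le hl1))
    obtain ⟨x, hx, hx0⟩ := (h.and (eventually_ge_atTop 0)).exists
    exact ⟨x, hx0, le_of_lt hx⟩
  have hZbdd : BddBelow Z := ⟨0, fun x hx => hx.1⟩
  have hZclosed : IsClosed Z :=
    hpath.cont_lam.preimage_isClosed_of_isClosed isClosed_Ici isClosed_Iic
  set T := sInf Z with hT
  have hTZ : T ∈ Z := hZclosed.csInf_mem hZne hZbdd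
  have hlt : ∀ x, 0 ≤ x → x < T → lamHat < lamP x := fun x hx hxT => by
    by_contra! h
    exact notMem_of_lt_csInf hxT hZbdd ⟨hx, h⟩
  have hTgood : Set.Icc 0 T ⊆ good := by
    refine IsClosed.Icc_subset_of_forall_mem_nhdsWithin ?_ ?_ ?_
    · -- The support can only shrink in the limit, so the bound is a closed condition.
      refine isClosed_of_closure_subset fun x hx => ?_
      have hxI : x ∈ Set.Icc 0 T :=
        isClosed_Icc.closure_subset (closure_mono Set.inter_subset_right hx)
      refine ⟨?_, hxI⟩
      have h1 := eventually_supp_subset (hpath.cont_b x hxI.1)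
      rw [eventually_nhdsWithin_iff] at h1
      obtain ⟨x', hx', hx'2⟩ := ((mem_closure_iff_frequently.1 hx).and_eventually h1).exists
      exact (Finset.card_le_card (Finset.sdiff_subset_sdiff (hx'2 hx'.2.1) le_rfl)).trans hx'.1
    · simp [hgood, hpath.start, supp]
    · rintro x₀ ⟨hx₀g, hx₀, hx₀T⟩
      by_contra hnot
      have hfreq : ∃ᶠ x in 𝓝[>] x₀, x ∉ good := fun h =>
        hnot (h.mono fun x hx => not_not.1 hx)
      -- There are finitely many supports, so one of those that are too large recurs.
      obtain ⟨s, hs⟩ : ∃ s : Finset (Fin p),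
          ∃ᶠ x in 𝓝[>] x₀, supp (bP x) = s ∧ x ∉ good := by
        by_contra! hall
        refine hfreq ?_
        filter_upwards [eventually_all.2 hall] with x hx
        exact not_not.2 (hx _ rfl)
      have hIoo : ∀ᶠ x in 𝓝[>] x₀, x ∈ Set.Ioo x₀ T := Ioo_mem_nhdsGT hx₀T
      have hlam : ∀ᶠ x in 𝓝[>] x₀, lam1 ≤ lamP x ∧ 0 < lamP x := by
        filter_upwards [hIoo] with x hx
        have := hlt x (hx₀.trans hx.1.le) hx.2
        exact ⟨by linarith, by linarith⟩
      have hext := fun j (hj : j ∈ s) =>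
        hpath.grad_of_frequently hρ hx₀ hlam (hs.mono fun x hx => hx.1) hj
      have hsub : ∀ᶠ x in 𝓝[>] x₀, supp (bP x₀) ⊆ supp (bP x) :=
        eventually_supp_subset ((hpath.cont_b x₀ hx₀).mono_left
          (nhdsWithin_mono _ fun x hx => hx₀.trans (le_of_lt hx)))
      obtain ⟨x, ⟨rfl, hxg⟩, hx₀s⟩ := (hs.and_eventually hsub).exists
      set s := supp (bP x)
      have hscard : d - B.card < (s \ B).card := not_le.1 hxg
      have hlamx := hlt x₀ hx₀ hx₀T
      have hcrit := hpath.critical x₀ hx₀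
      have hlam1x : lam1 ≤ lamP x₀ := hl1.trans hlamx.le
      rcases le_total lam2 (lamP x₀) with hcase | hcase
      · -- Thin `s` out to `C ∪ B` with `|C| = d - |B|`, still containing the support at `x₀`.
        obtain ⟨C, hC1, hC2, hC3⟩ := Finset.exists_subsuperset_card_eq
          (Finset.sdiff_subset_sdiff hx₀s (le_refl B)) hx₀g hscard.le
        have hCB : Disjoint B C :=
          Finset.disjoint_left.2 fun j hjB hjC => (Finset.mem_sdiff.1 (hC2 hjC)).2 hjB
        have hAB : (B ∪ C) \ B = C := by
          rw [Finset.union_sdiff_left, Finset.sdiff_eq_self_of_disjoint hCB.symm]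
        have hAcard : (B ∪ C).card = d := by
          rw [Finset.card_union_of_disjoint hCB, hC3]; omega
        have hpos : 0 < lamP x₀ := h0.trans_le hlam1x
        refine no_large_model (A := B ∪ C) (B := B) Finset.subset_union_left hn
          (hS.rieszOn hAcard.le) hκ hκc hc hα0 hα1 hpos ?_ ?_ (b := bP x₀) ?_
          (fun j _ => inner_eq_mul_grad hn _ j)
          (fun j _ => (hcrit.coord j).abs_le hρ hlam1x hpos) ?_ ?_
        · rw [hAcard]; exact hK
        · rw [hAB, hC3]; omega
        · refine mem_supportedIn_of_supp_subset fun j hj => ?_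
          by_cases hjB : j ∈ B
          · exact Finset.mem_union_left _ hjB
          · exact Finset.mem_union_right _ (hC1 (Finset.mem_sdiff.2 ⟨hj, hjB⟩))
        · intro j hj
          rw [hAB] at hj
          exact hext j (Finset.mem_sdiff.1 (hC2 hj)).1
        · refine (hQ _ Finset.subset_union_left hAcard).trans ?_
          gcongr
      · -- Here the gradient on `s \ B` would be at the boundary of `[-lamP x₀, lamP x₀]`.
        have hb : bP x₀ = bo := huniq _ _ hlam1x hcase hcrit hx₀g
        obtain ⟨j, hj⟩ : (s \ B).Nonempty := Finset.card_pos.1 (by omega)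
        rw [Finset.mem_sdiff] at hj
        have h1 := (hext j hj.1).1
        rw [hb, hbo j hj.2, abs_zero, mul_zero, sub_zero] at h1
        have h2 := hout j hj.2
        rw [grad] at h1
        linarith
  have hgoodT : T ∈ good := hTgood ⟨hTZ.1, le_rfl⟩
  refine huniq lamHat (bP T) hl1 hl2 ?_ hgoodT
  rcases hTZ.1.eq_or_lt with hT0 | hT0
  · -- The path starts below the level `lamHat`, with `0` as its path solution.
    have := hpath.critical 0 le_rfl
    rw [hpath.start] at this
    rw [← hT0, hpath.start]
    exact this.zero_mono (hT0 ▸ hTZ.2)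
  · have hge : lamHat ≤ lamP T := by
      have hcont : ContinuousAt lamP T := (hpath.cont_lam T hTZ.1).continuousAt (Ici_mem_nhds hT0)
      refine ge_of_tendsto (hcont.tendsto.mono_left (nhdsWithin_le_nhds (s := Set.Iio T))) ?_
      filter_upwards [Ioo_mem_nhdsLT hT0] with x hx
      exact (hlt x hx.1.le hx.2).le
    have := hpath.critical T hTZ.1
    rwa [hTZ.2.antisymm hge] at this

end Path

/-! ### Laws of projections of the noise -/

section Noise

variable {n p : ℕ} {σ : ℝ}

/-- The law `N(0, σ² I)` of the noise. -/
noncomputable abbrev noiseLaw (n : ℕ) (σ : ℝ) : Measure (EuclideanSpace ℝ (Fin n)) :=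
  multivariateGaussian 0 (σ ^ 2 • (1 : Matrix (Fin n) (Fin n) ℝ))

lemma charFun_noiseLaw (t : EuclideanSpace ℝ (Fin n)) :
    charFun (noiseLaw n σ) t = Complex.exp (-(σ ^ 2 * ‖t‖ ^ 2 / 2 : ℝ)) := by
  have hS : (σ ^ 2 • (1 : Matrix (Fin n) (Fin n) ℝ)).PosSemidef :=
    Matrix.PosSemidef.one.smul (sq_nonneg σ)
  rw [charFun_multivariateGaussian hS]
  have : t.ofLp ⬝ᵥ (σ ^ 2 • (1 : Matrix (Fin n) (Fin n) ℝ)).mulVec t.ofLp = σ ^ 2 * ‖t‖ ^ 2 := by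
    rw [Matrix.smul_mulVec, Matrix.one_mulVec, dotProduct_smul, EuclideanSpace.real_norm_sq_eq]
    simp [dotProduct, sq]
  rw [this]
  congr 1
  simp

lemma map_inner_noiseLaw (hσ : 0 < σ) {a : EuclideanSpace ℝ (Fin n)} (ha : a ≠ 0) :
    (noiseLaw n σ).map (fun v => (σ * ‖a‖)⁻¹ * inner ℝ a v) = gaussianReal 0 1 := by
  have hmeas : Measurable fun v : EuclideanSpace ℝ (Fin n) => (σ * ‖a‖)⁻¹ * inner ℝ a v :=
    (continuous_const.mul (continuous_const.inner continuous_id)).measurable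
  have : IsProbabilityMeasure ((noiseLaw n σ).map (fun v => (σ * ‖a‖)⁻¹ * inner ℝ a v)) :=
    Measure.isProbabilityMeasure_map hmeas.aemeasurable
  have ha' : ‖a‖ ≠ 0 := norm_ne_zero_iff.2 ha
  refine Measure.ext_of_charFun (funext fun t => ?_)
  have h1 : charFun ((noiseLaw n σ).map (fun v => (σ * ‖a‖)⁻¹ * inner ℝ a v)) t =
      charFun (noiseLaw n σ) ((t * (σ * ‖a‖)⁻¹) • a) := by
    rw [charFun_apply, charFun_apply, integral_map hmeas.aemeasurable (by fun_prop)]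
    congr 1; ext v
    rw [real_inner_smul_right, real_inner_comm v a]
    simp; ring_nf
  rw [h1, charFun_noiseLaw, charFun_gaussianReal, norm_smul, mul_pow, Real.norm_eq_abs, sq_abs]
  congr 1
  have : σ ^ 2 * ((t * (σ * ‖a‖)⁻¹) ^ 2 * ‖a‖ ^ 2) / 2 = t ^ 2 / 2 := by field_simp
  rw [this]
  simp

lemma noiseLaw_real_inner_le (hσ : 0 < σ) {a : EuclideanSpace ℝ (Fin n)} (ha : a ≠ 0) (c : ℝ) :
    (noiseLaw n σ).real {v | inner ℝ a v ≤ c} = Phi (c / (σ * ‖a‖)) := by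
  have hmeas : Measurable fun v : EuclideanSpace ℝ (Fin n) => (σ * ‖a‖)⁻¹ * inner ℝ a v :=
    (continuous_const.mul (continuous_const.inner continuous_id)).measurable
  rw [Phi, cdf_eq_real, ← map_inner_noiseLaw hσ ha, map_measureReal_apply hmeas measurableSet_Iic]
  congr 1; ext v
  have hpos : 0 < σ * ‖a‖ := mul_pos hσ (norm_pos_iff.2 ha)
  simp only [Set.mem_ofPred_eq, Set.mem_preimage, Set.mem_Iic]
  rw [inv_mul_eq_div, div_le_div_iff_of_pos_right hpos]

lemma Phi_nonneg (x : ℝ) : 0 ≤ Phi x := cdf_nonneg _ _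

lemma Phi_mono : Monotone Phi := monotone_cdf _

/-- Two-sided tail of a linear functional of the noise. -/
lemma noiseLaw_real_le_abs_inner (hσ : 0 < σ) {a : EuclideanSpace ℝ (Fin n)} {c r : ℝ}
    (hc : 0 < c) (har : ‖a‖ ≤ r) :
    (noiseLaw n σ).real {v | c ≤ |inner ℝ a v|} ≤ 2 * Phi (-(c / (σ * r))) := by
  by_cases ha : a = 0
  · have : {v : EuclideanSpace ℝ (Fin n) | c ≤ |inner ℝ a v|} = ∅ := by
      ext v; simp [ha, hc]
    rw [this, measureReal_empty]
    have := Phi_nonneg (-(c / (σ * r)))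
    linarith
  have hsub : {v : EuclideanSpace ℝ (Fin n) | c ≤ |inner ℝ a v|} ⊆
      {v | inner ℝ a v ≤ -c} ∪ {v | inner ℝ (-a) v ≤ -c} := by
    intro v hv
    rw [Set.mem_ofPred_eq] at hv
    rcases le_abs.1 hv with h | h
    · right; simp only [Set.mem_ofPred_eq, inner_neg_left]; linarith
    · left; simp only [Set.mem_ofPred_eq]; linarith
  have hpos : 0 < ‖a‖ := norm_pos_iff.2 ha
  calc (noiseLaw n σ).real {v | c ≤ |inner ℝ a v|}
      ≤ (noiseLaw n σ).real {v | inner ℝ a v ≤ -c}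
        + (noiseLaw n σ).real {v | inner ℝ (-a) v ≤ -c} :=
        (measureReal_mono hsub).trans (measureReal_union_le _ _)
    _ = 2 * Phi (-(c / (σ * ‖a‖))) := by
        rw [noiseLaw_real_inner_le hσ ha, noiseLaw_real_inner_le hσ (neg_ne_zero.2 ha), norm_neg,
          neg_div]
        ring
    _ ≤ 2 * Phi (-(c / (σ * r))) := by
        gcongr
        refine Phi_mono (neg_le_neg ?_)
        gcongr

/-- The squared norm of the projection of the noise onto a subspace of dimension `k` is `σ²` times
a chi-square variable with `k` degrees of freedom. -/
lemma noiseLaw_real_lt_norm_starProjection_sq {k : ℕ}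
    (W : Submodule ℝ (EuclideanSpace ℝ (Fin n))) (hW : Module.finrank ℝ W = k) (c : ℝ) :
    (noiseLaw n σ).real {v | c < ‖W.starProjection v‖ ^ 2} =
      (chiSq k).real {x | c < σ ^ 2 * x} := by
  let e : OrthonormalBasis (Fin k) ℝ W := (stdOrthonormalBasis ℝ W).reindex (finCongr hW)
  let L : EuclideanSpace ℝ (Fin n) → EuclideanSpace ℝ (Fin k) :=
    fun v => WithLp.toLp 2 fun i => inner ℝ (e i : EuclideanSpace ℝ (Fin n)) v
  have hLm : Measurable L := by
    refine Continuous.measurable ?_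
    refine (PiLp.continuous_toLp 2 _).comp (continuous_pi fun i => ?_)
    exact continuous_const.inner continuous_id
  have hLnorm (v : EuclideanSpace ℝ (Fin n)) : ‖L v‖ ^ 2 = ‖W.starProjection v‖ ^ 2 := by
    rw [Submodule.starProjection_apply, Submodule.norm_coe, EuclideanSpace.real_norm_sq_eq,
      ← e.sum_sq_norm_inner_right]
    refine Finset.sum_congr rfl fun i _ => ?_
    rw [Real.norm_eq_abs, sq_abs, Submodule.inner_orthogonalProjectionOnto_eq_of_mem_left]
  have hlaw : (noiseLaw n σ).map L =
      (stdGaussian (EuclideanSpace ℝ (Fin k))).map (fun z => σ • z) := by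
    have h1 : IsProbabilityMeasure ((noiseLaw n σ).map L) :=
      Measure.isProbabilityMeasure_map hLm.aemeasurable
    have hsm : Measurable fun z : EuclideanSpace ℝ (Fin k) => σ • z := by fun_prop
    have h2 : IsProbabilityMeasure ((stdGaussian (EuclideanSpace ℝ (Fin k))).map (fun z => σ • z)) :=
      Measure.isProbabilityMeasure_map hsm.aemeasurable
    refine Measure.ext_of_charFun (funext fun t => ?_)
    have h3 : charFun ((noiseLaw n σ).map L) t =
        charFun (noiseLaw n σ) (∑ i, t i • (e i : EuclideanSpace ℝ (Fin n))) := by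
      rw [charFun_apply, charFun_apply, integral_map hLm.aemeasurable (by fun_prop)]
      congr 1; ext v
      rw [inner_sum, PiLp.inner_apply]
      congr 3
      refine Finset.sum_congr rfl fun i _ => ?_
      rw [real_inner_smul_right, real_inner_comm]
      simp [L, real_inner_comm, mul_comm]
    have h4 : ‖∑ i, t i • (e i : EuclideanSpace ℝ (Fin n))‖ ^ 2 = ‖t‖ ^ 2 := by
      have h5 : ∑ i, t i • (e i : EuclideanSpace ℝ (Fin n)) = ((e.repr.symm t : W) : _) := by
        rw [← e.sum_repr_symm]; simp
      rw [h5, Submodule.norm_coe, LinearIsometryEquiv.norm_map]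
    rw [h3, charFun_noiseLaw, h4, charFun_map_smul, charFun_stdGaussian, norm_smul,
      ← Complex.ofReal_pow, mul_pow, Real.norm_eq_abs, sq_abs]
    congr 1
    push_cast; ring
  have hset : {v | c < ‖W.starProjection v‖ ^ 2} = L ⁻¹' {z | c < ‖z‖ ^ 2} := by
    ext v; simp [hLnorm]
  have hm1 : MeasurableSet {z : EuclideanSpace ℝ (Fin k) | c < ‖z‖ ^ 2} :=
    measurableSet_lt measurable_const (by fun_prop)
  have hm2 : MeasurableSet {x : ℝ | c < σ ^ 2 * x} :=
    measurableSet_lt measurable_const (by fun_prop)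
  rw [hset, ← map_measureReal_apply hLm hm1, hlaw, map_measureReal_apply (by fun_prop) hm1, chiSq,
    map_measureReal_apply (by fun_prop) hm2]
  congr 1; ext z
  simp [norm_smul, mul_pow]

end Noise

section Projections

variable {n p : ℕ} {X : Matrix (Fin n) (Fin p) ℝ} {A B : Finset (Fin p)} {cLow cUp : ℝ}

lemma finrank_colSpan (hR : RieszOn X A cLow cUp) (hn : 0 < n) (hc : 0 < cLow) :
    Module.finrank ℝ (colSpan X A) = A.card := by
  classical
  let F : (A → ℝ) →ₗ[ℝ] EuclideanSpace ℝ (Fin p) :=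
    { toFun := fun u => WithLp.toLp 2 fun j => if hj : j ∈ A then u ⟨j, hj⟩ else 0
      map_add' := fun u u' => by
        ext j; by_cases hj : j ∈ A <;> simp [hj]
      map_smul' := fun c u => by
        ext j; by_cases hj : j ∈ A <;> simp [hj] }
  have hF (u : A → ℝ) : F u ∈ supportedIn A := fun j hj => by simp [F, hj]
  have hrange : LinearMap.range ((Matrix.toEuclideanLin X) ∘ₗ F) = colSpan X A := by
    ext v
    constructor
    · rintro ⟨u, rfl⟩
      exact applyX_mem_colSpan (hF u)
    · rintro ⟨b, hb, rfl⟩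
      refine ⟨fun j => b j, ?_⟩
      rw [LinearMap.comp_apply]
      congr 1
      ext j
      by_cases hj : j ∈ A
      · simp [F, hj]
      · simp [F, hj, hb j hj]
  have hinj : Function.Injective ((Matrix.toEuclideanLin X) ∘ₗ F) := by
    refine (injective_iff_map_eq_zero _).2 fun u hu => ?_
    have h0 := hR.eq_zero_of_applyX_eq_zero hn hc (hF u) hu
    ext j
    have := congrArg (fun b : EuclideanSpace ℝ (Fin p) => b j.1) h0
    simpa [F] using this
  rw [← hrange, LinearMap.finrank_range_of_inj hinj, Module.finrank_fintype_fun_eq_card,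
    Fintype.card_coe]

/-- `P_A - P_B` is the orthogonal projection onto the orthogonal complement of the columns in `B`
inside the span of those in `A`. -/
lemma starProjection_sub_eq (hBA : B ⊆ A) (v : EuclideanSpace ℝ (Fin n)) :
    (colSpan X A).starProjection v - (colSpan X B).starProjection v =
      ((colSpan X B)ᗮ ⊓ colSpan X A).starProjection v := by
  refine (Submodule.eq_starProjection_of_mem_orthogonal (Submodule.mem_inf.2 ⟨?_, ?_⟩) ?_).symm
  · refine (Submodule.mem_orthogonal _ _).2 fun u hu => inner_eq_zero_of_mem_colSpan hu fun j hj => ?_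
    rw [inner_sub_right, inner_col_starProjection (hBA hj), inner_col_starProjection hj, sub_self]
  · exact Submodule.sub_mem _ (Submodule.starProjection_apply_mem _ v)
      (colSpan_mono hBA (Submodule.starProjection_apply_mem _ v))
  · refine (Submodule.mem_orthogonal _ _).2 fun u hu => ?_
    obtain ⟨h1, h2⟩ := Submodule.mem_inf.1 hu
    have h3 : v - ((colSpan X A).starProjection v - (colSpan X B).starProjection v) =
        (v - (colSpan X A).starProjection v) + (colSpan X B).starProjection v := by abel
    rw [h3, inner_add_right, real_inner_comm, Submodule.starProjection_inner_eq_zero v u h2,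
      zero_add]
    rw [real_inner_comm]
    exact (Submodule.mem_orthogonal _ _).1 h1 _ (Submodule.starProjection_apply_mem _ v)

lemma finrank_orthogonal_inf_colSpan (hBA : B ⊆ A) (hR : RieszOn X A cLow cUp) (hn : 0 < n)
    (hc : 0 < cLow) :
    Module.finrank ℝ ((colSpan X B)ᗮ ⊓ colSpan X A : Submodule ℝ (EuclideanSpace ℝ (Fin n))) =
      (A \ B).card := by
  have h := Submodule.finrank_add_inf_finrank_orthogonal (colSpan_mono (X := X) hBA)
  rw [finrank_colSpan hR hn hc, finrank_colSpan (hR.mono hBA) hn hc] at h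
  have h2 := Finset.card_sdiff_add_card_eq_card hBA
  omega

end Projections

/-! ### The general probability bound -/

lemma SparseRiesz.n_pos {n p d : ℕ} {X : Matrix (Fin n) (Fin p) ℝ} {cLow cUp : ℝ}
    (h : SparseRiesz X d cLow cUp) (hd : 0 < d) (hc : 0 < cLow) (hp : 0 < p) : 0 < n := by
  refine Nat.pos_of_ne_zero fun hn => ?_
  subst hn
  have hX : subGram X {(⟨0, hp⟩ : Fin p)} = 0 := by ext i j; simp [subGram, gram]
  have h1 := (h {⟨0, hp⟩} (by rw [Finset.card_singleton]; exact hd)).1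
    (EuclideanSpace.single ⟨⟨0, hp⟩, Finset.mem_singleton_self _⟩ 1) (by simp)
  rw [hX, Matrix.zero_mulVec] at h1
  have : ‖(WithLp.toLp 2 0 : EuclideanSpace ℝ ({(⟨0, hp⟩ : Fin p)} : Finset (Fin p)))‖ = 0 := by simp
  linarith

lemma sign_eq_of_mul_pos {x z : ℝ} (hz : z ≠ 0) (h : 0 < Real.sign z * x) :
    Real.sign x = Real.sign z := by
  rcases lt_or_gt_of_ne hz with hz | hz
  · rw [Real.sign_of_neg hz] at h ⊢
    exact Real.sign_of_neg (by linarith)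
  · rw [Real.sign_of_pos hz] at h ⊢
    exact Real.sign_of_pos (by linarith)

lemma sign_mul_self_eq_abs (z : ℝ) : Real.sign z * z = |z| := by
  rcases lt_trichotomy z 0 with hz | rfl | hz
  · rw [Real.sign_of_neg hz, abs_of_neg hz]; ring
  · simp
  · rw [Real.sign_of_pos hz, abs_of_pos hz]; ring

namespace Problem

variable {P : Problem.{u}} {lam1 lam2 lam3 : ℝ}

lemma Assumptions.kappa_pos (h : P.Assumptions lam1) : 0 < P.κ :=
  h.penalty.kappa_pos h.kappa_nonneg

lemma Assumptions.cLow_pos (h : P.Assumptions lam1) : 0 < P.cLow :=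
  h.kappa_pos.trans h.kappa_lt

/-- As `K_* > 0`, the sparsity assumption leaves room for at least one false selection. -/
lemma Assumptions.d0_lt (h : P.Assumptions lam1) : P.d0 < P.dStar := by
  have hK := Kstar_pos h.kappa_pos h.kappa_lt h.cLow_le_cUp h.alpha_pos h.alpha_lt_one
  have hd : (0 : ℝ) < P.dStar := by exact_mod_cast h.dStar_pos
  have : (P.d0 : ℝ) < P.dStar :=
    h.sparsity.trans_lt (div_lt_self hd (by linarith))
  exact_mod_cast this

lemma beta_mem : P.β ∈ supportedIn P.A0 := mem_supportedIn_of_supp_subset le_rfl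

/-- The noise event on which the residual of the oracle fit correlates too much with `x_j`. -/
def badCorrelation (P : Problem.{u}) (lam : ℝ) (j : Fin P.p) : Set (EuclideanSpace ℝ (Fin P.n)) :=
  {v | P.n * lam ≤ |inner ℝ (col P.X j - (colSpan P.X P.A0).starProjection (col P.X j)) v|}

/-- The noise event on which the model `A° ∪ C` captures too much energy. -/
def badEnergy (P : Problem.{u}) (lam : ℝ) (C : Finset (Fin P.p)) :
    Set (EuclideanSpace ℝ (Fin P.n)) :=
  {v | P.m * P.n * lam ^ 2 < ‖(colSpan P.X (P.A0 ∪ C)).starProjection v -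
    (colSpan P.X P.A0).starProjection v‖ ^ 2}

lemma noiseLaw_badCorrelation_le (hσ : 0 < P.σ) (hn : 0 < P.n) (h0 : 0 < lam1) (j : Fin P.p) :
    (noiseLaw P.n P.σ).real (P.badCorrelation lam1 j) ≤
      2 * Phi (-(P.n * lam1 / (P.σ * ‖col P.X j‖))) := by
  have hn' : (0 : ℝ) < P.n := by exact_mod_cast hn
  refine noiseLaw_real_le_abs_inner hσ (by positivity) ?_
  rw [← sq_le_sq₀ (norm_nonneg _) (norm_nonneg _)]
  have h := norm_sub_sq_of_mem_colSpan (y := col P.X j) (Submodule.zero_mem (colSpan P.X P.A0))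
  rw [sub_zero] at h
  rw [h]
  exact le_add_of_nonneg_right (sq_nonneg _)

lemma noiseLaw_badEnergy_eq (hA : P.Assumptions lam1) (hn : 0 < P.n) {C : Finset (Fin P.p)}
    (hC : C ⊆ P.A0ᶜ) (hCm : C.card = P.m) :
    (noiseLaw P.n P.σ).real (P.badEnergy lam3 C) =
      (chiSq P.m).real {x | (P.m : ℝ) * P.n * lam3 ^ 2 < P.σ ^ 2 * x} := by
  have hdisj : Disjoint P.A0 C :=
    Finset.disjoint_left.2 fun j hj hjC => Finset.mem_compl.1 (hC hjC) hj
  have hcard : (P.A0 ∪ C).card ≤ P.dStar := by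
    rw [Finset.card_union_of_disjoint hdisj, hCm, Problem.m]
    have := hA.d0_lt
    rw [Problem.d0] at *
    omega
  rw [← noiseLaw_real_lt_norm_starProjection_sq
    ((colSpan P.X P.A0)ᗮ ⊓ colSpan P.X (P.A0 ∪ C)) (k := P.m)]
  · simp only [badEnergy, starProjection_sub_eq (Finset.subset_union_left (s₁ := P.A0))]
  · rw [finrank_orthogonal_inf_colSpan Finset.subset_union_left (hA.src.rieszOn hcard) hn
      hA.cLow_pos, Finset.union_sdiff_left, Finset.sdiff_eq_self_of_disjoint hdisj.symm, hCm]

/-- Off the bad noise events the path solution is the oracle estimator and has the right signs. -/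
lemma eq_oracle_of_good (hA : P.Assumptions lam1) (hn : 0 < P.n) (h0 : 0 < lam1)
    (hlam3 : 0 ≤ lam3) (hmax : max lam1 (√P.cUp / P.α * lam3) ≤ lam2) {ω : P.Ω}
    (hpath : IsSolutionPath P.X (P.y ω) P.ρ (P.lamP ω) (P.bP ω))
    (hl : lam1 ≤ P.lamHat ω ∧ P.lamHat ω ≤ lam2)
    (h1 : ∀ j ∈ P.A0ᶜ, P.noise ω ∉ P.badCorrelation lam1 j)
    (h2 : ∀ j : P.A0, P.γ * lam2 < Real.sign (P.β j) * P.betaOracle ω j)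
    (h3 : ∀ C ∈ P.A0ᶜ.powersetCard P.m, P.noise ω ∉ P.badEnergy lam3 C) :
    P.betaHat ω = P.betaOracle ω ∧
      ∀ j, Real.sign (P.betaHat ω j) = Real.sign (P.β j) := by
  have hn' : (0 : ℝ) < P.n := by exact_mod_cast hn
  have hlam2 : 0 < lam2 := h0.trans_le ((le_max_left _ _).trans hmax)
  have hcU : 0 < P.cUp := hA.cLow_pos.trans_le hA.cLow_le_cUp
  obtain ⟨hbo, hXbo⟩ := oracleLSE_spec P.X (P.y ω) P.A0
  change P.betaOracle ω ∈ _ at hbo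
  change applyX P.X (P.betaOracle ω) = _ at hXbo
  have hβne : ∀ j ∈ P.A0, P.β j ≠ 0 := fun j hj => mem_supp.1 hj
  have hpos : 0 < P.γ * lam2 := mul_pos hA.penalty.gamma_pos hlam2
  have hproj (A : Finset (Fin P.p)) (hA0 : P.A0 ⊆ A) :
      (colSpan P.X A).starProjection (P.y ω) =
        applyX P.X P.β + (colSpan P.X A).starProjection (P.noise ω) := by
    rw [Problem.y, map_add, Submodule.starProjection_eq_self_iff.2
      (colSpan_mono hA0 (applyX_mem_colSpan P.beta_mem))]
  have heq : P.betaHat ω = P.betaOracle ω := by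
    refine hpath.pathSolution_eq hA.penalty hn hA.src hA.kappa_pos hA.kappa_lt hA.cLow_le_cUp
      hA.alpha_pos hA.alpha_lt_one hA.sparsity hA.d0_lt h0 hl.1 hl.2 hbo ?_ ?_ ?_ ?_
    · intro j hj
      refine (h2 ⟨j, hj⟩).trans_le ((le_abs_self _).trans_eq ?_)
      rw [abs_mul, abs_sign_of_ne_zero (hβne j hj), one_mul]
    · intro j hj
      rw [hXbo]
      exact inner_col_sub_starProjection hj _
    · intro j hj
      have h := h1 j (Finset.mem_compl.2 hj)
      rw [badCorrelation, Set.mem_ofPred_eq, not_le] at h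
      rw [hXbo, hproj _ le_rfl, abs_div, Nat.abs_cast, div_lt_iff₀ hn', mul_comm lam1]
      refine lt_of_eq_of_lt ?_ h
      congr 1
      rw [Problem.y, add_sub_add_left_eq_sub, inner_sub_right, inner_sub_left,
        Submodule.inner_starProjection_left_eq_right]
    · intro A hA0 hAd
      have hC : A \ P.A0 ∈ P.A0ᶜ.powersetCard P.m := by
        refine Finset.mem_powersetCard.2 ⟨fun j hj => ?_, ?_⟩
        · exact Finset.mem_compl.2 (Finset.mem_sdiff.1 hj).2
        · rw [Finset.card_sdiff_of_subset hA0, hAd]; rfl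
      have h := h3 _ hC
      simp only [badEnergy, Finset.union_sdiff_of_subset hA0, Set.mem_ofPred_eq, not_lt] at h
      rw [hproj A hA0, hproj _ le_rfl, add_sub_add_left_eq_sub, (Finset.mem_powersetCard.1 hC).2]
      have h4 : √P.cUp * lam3 ≤ P.α * lam2 := by
        have := (le_max_right _ _).trans hmax
        rw [div_mul_eq_mul_div, div_le_iff₀ hA.alpha_pos] at this
        linarith
      have h5 : P.cUp * lam3 ^ 2 ≤ P.α ^ 2 * lam2 ^ 2 := by
        calc P.cUp * lam3 ^ 2 = (√P.cUp * lam3) ^ 2 := by rw [mul_pow, Real.sq_sqrt hcU.le]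
          _ ≤ (P.α * lam2) ^ 2 := by gcongr
          _ = _ := by ring
      calc _ ≤ P.cUp * (P.m * P.n * lam3 ^ 2) := by gcongr
        _ = P.m * P.n * (P.cUp * lam3 ^ 2) := by ring
        _ ≤ P.m * P.n * (P.α ^ 2 * lam2 ^ 2) := by gcongr
        _ = _ := by ring
  refine ⟨heq, fun j => ?_⟩
  rw [heq]
  by_cases hj : j ∈ P.A0
  · exact sign_eq_of_mul_pos (hβne j hj) (hpos.trans (h2 ⟨j, hj⟩))
  · rw [hbo j hj, P.beta_mem j hj]

/-- The general bound, on the event that the penalty level lies between `lam1` and `lam2`. -/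
theorem real_not_oracle_inter_le (hA : P.Assumptions lam1) (h0 : 0 < lam1)
    (hlam3 : 0 ≤ lam3) (hmax : max lam1 (√P.cUp / P.α * lam3) ≤ lam2) :
    P.μ.real {ω | (P.betaHat ω ≠ P.betaOracle ω ∨
        ∃ j, Real.sign (P.betaHat ω j) ≠ Real.sign (P.β j)) ∧
        (lam1 ≤ P.lamHat ω ∧ P.lamHat ω ≤ lam2)} ≤
      P.pi1 lam1 + P.pi2 lam2 + P.pi3 lam3 := by
  classical
  have hpi1 : 0 ≤ P.pi1 lam1 :=
    mul_nonneg two_pos.le (Finset.sum_nonneg fun _ _ => Phi_nonneg _)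
  have hpi2 : 0 ≤ P.pi2 lam2 := Finset.sum_nonneg fun _ _ => Phi_nonneg _
  have hpi3 : 0 ≤ P.pi3 lam3 := mul_nonneg (Nat.cast_nonneg _) measureReal_nonneg
  rcases Nat.eq_zero_or_pos P.p with hp | hp
  · have hE : IsEmpty (Fin P.p) := by rw [hp]; infer_instance
    have : {ω | (P.betaHat ω ≠ P.betaOracle ω ∨
        ∃ j, Real.sign (P.betaHat ω j) ≠ Real.sign (P.β j)) ∧
        (lam1 ≤ P.lamHat ω ∧ P.lamHat ω ≤ lam2)} = ∅ := by
      refine Set.eq_empty_of_forall_notMem ?_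
      rintro ω ⟨h | ⟨j, -⟩, -⟩
      · exact h (Subsingleton.elim _ _)
      · exact hE.elim j
    rw [this, measureReal_empty]
    positivity
  have hn := hA.src.n_pos hA.dStar_pos hA.cLow_pos hp
  have hσ := hA.sigma_pos
  have hRB : RieszOn P.X P.A0 P.cLow P.cUp := hA.src.rieszOn (le_of_lt hA.d0_lt)
  choose a haB haδ hanorm using fun j : P.A0 => exists_dual_vector hn hRB hA.cLow_pos j
  set ν := noiseLaw P.n P.σ
  -- On `S2 j` the oracle estimate of `β_j` is not beyond `γ lam2` on the side of `β_j`.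
  set S2 : P.A0 → Set (EuclideanSpace ℝ (Fin P.n)) := fun j =>
    {v | inner ℝ (Real.sign (P.β j) • a j) v ≤ P.γ * lam2 - |P.β j|} with hS2
  -- The error of the oracle estimator is a linear functional of the noise.
  have horacle (ω : P.Ω) (j : P.A0) : P.betaOracle ω j = P.β j + inner ℝ (a j) (P.noise ω) := by
    have hcoef (b : EuclideanSpace ℝ (Fin P.p)) (hb : b ∈ supportedIn P.A0) :
        inner ℝ (applyX P.X b) (a j) = b j := by
      rw [inner_applyX, sum_mul_of_mem_supportedIn hb, Finset.sum_eq_single j.1]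
      · rw [haδ j j j.2, if_pos rfl, mul_one]
      · intro i hi hij
        rw [haδ j i hi, if_neg hij, mul_zero]
      · exact fun h => absurd j.2 h
    obtain ⟨hbo, hXbo⟩ := oracleLSE_spec P.X (P.y ω) P.A0
    rw [← hcoef _ P.beta_mem]
    refine (hcoef _ hbo).symm.trans ?_
    rw [hXbo, Submodule.inner_starProjection_left_eq_right,
      Submodule.starProjection_eq_self_iff.2 (haB j), Problem.y, inner_add_left,
      real_inner_comm (P.noise ω)]
  set S : Set (EuclideanSpace ℝ (Fin P.n)) :=
    (⋃ j ∈ P.A0ᶜ, P.badCorrelation lam1 j) ∪ (⋃ j ∈ (Finset.univ : Finset P.A0), S2 j) ∪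
      ⋃ C ∈ P.A0ᶜ.powersetCard P.m, P.badEnergy lam3 C with hS
  have hνS : ν.real S ≤ P.pi1 lam1 + P.pi2 lam2 + P.pi3 lam3 := by
    refine (measureReal_union_le _ _).trans
      (add_le_add ((measureReal_union_le _ _).trans (add_le_add ?_ ?_)) ?_)
    · refine (measureReal_biUnion_finset_le _ _).trans ?_
      rw [pi1, Finset.mul_sum]
      exact Finset.sum_le_sum fun j _ => noiseLaw_badCorrelation_le hσ hn h0 j
    · refine (measureReal_biUnion_finset_le _ _).trans ?_
      rw [pi2]
      refine Finset.sum_le_sum fun j _ => le_of_eq ?_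
      have hj : P.β j ≠ 0 := mem_supp.1 j.2
      have ha0 : a j ≠ 0 := fun h => by
        have := haδ j j j.2
        rw [h, inner_zero_right, if_pos rfl] at this
        exact zero_ne_one this
      have hs0 : Real.sign (P.β j) ≠ 0 := fun h => by
        have := abs_sign_of_ne_zero hj
        rw [h, abs_zero] at this
        exact zero_ne_one this
      rw [hS2, noiseLaw_real_inner_le hσ (smul_ne_zero hs0 ha0), norm_smul, Real.norm_eq_abs,
        abs_sign_of_ne_zero hj, one_mul, w0, ← hanorm j, Real.sqrt_sq (norm_nonneg _)]
    · refine (measureReal_biUnion_finset_le _ _).trans ?_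
      rw [Finset.sum_congr rfl fun C hC => noiseLaw_badEnergy_eq hA hn
        (Finset.mem_powersetCard.1 hC).1 (Finset.mem_powersetCard.1 hC).2, Finset.sum_const,
        Finset.card_powersetCard, Finset.card_compl, Fintype.card_fin, nsmul_eq_mul]
      rfl
  set N : Set P.Ω := {ω | ¬ IsSolutionPath P.X (P.y ω) P.ρ (P.lamP ω) (P.bP ω)}
  have hN : P.μ.real N = 0 := by
    rw [measureReal_def, ae_iff.1 hA.path, ENNReal.toReal_zero]
  have hsub : {ω | (P.betaHat ω ≠ P.betaOracle ω ∨
        ∃ j, Real.sign (P.betaHat ω j) ≠ Real.sign (P.β j)) ∧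
        (lam1 ≤ P.lamHat ω ∧ P.lamHat ω ≤ lam2)} ⊆ N ∪ P.noise ⁻¹' S := by
    rintro ω ⟨hbad, hl⟩
    by_contra hnot
    rw [Set.mem_union, not_or] at hnot
    obtain ⟨hNω, hSω⟩ := hnot
    have hpath : IsSolutionPath P.X (P.y ω) P.ρ (P.lamP ω) (P.bP ω) := not_not.1 hNω
    rw [Set.mem_preimage, hS, Set.mem_union, Set.mem_union, not_or, not_or] at hSω
    simp only [Set.mem_iUnion, not_exists] at hSω
    obtain ⟨⟨h1, h2⟩, h3⟩ := hSω
    have hgood := eq_oracle_of_good hA hn h0 hlam3 hmax hpath hl h1 (fun j => ?_) h3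
    · rcases hbad with h | ⟨j, hj⟩
      · exact h hgood.1
      · exact hj (hgood.2 j)
    · have h := h2 j (Finset.mem_univ j)
      rw [hS2, Set.mem_ofPred_eq, not_le, real_inner_smul_left] at h
      rw [horacle, mul_add, sign_mul_self_eq_abs]
      linarith
  -- `S` need not be shown measurable: the law of the noise dominates on preimages of any set.
  have hpre : P.μ.real (P.noise ⁻¹' S) ≤ ν.real S := by
    have h := Measure.le_map_apply hA.noise_law.aemeasurable S
    rw [hA.noise_law.map_eq] at h
    exact ENNReal.toReal_mono (measure_ne_top _ _) h
  calc _ ≤ P.μ.real N + P.μ.real (P.noise ⁻¹' S) :=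
        (measureReal_mono hsub).trans (measureReal_union_le _ _)
    _ ≤ ν.real S := by rw [hN, zero_add]; exact hpre
    _ ≤ _ := hνS

lemma probWrongSelection_le (P : Problem.{u}) : P.probWrongSelection ≤ P.probNotOracle := by
  refine measureReal_mono fun ω hω => Or.inr ?_
  by_contra! h
  refine hω ?_
  ext j
  rw [mem_supp, A0, mem_supp, Ne, Ne, ← Real.sign_eq_zero_iff, h j, Real.sign_eq_zero_iff]

end Problem

/-! ### The chi-square distribution in polar coordinates -/

section Polar

/-- The standard Gaussian measure has density `(2π)^(-k/2) exp (-‖x‖²/2)`. -/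
lemma stdGaussian_eq_withDensity (k : ℕ) :
    stdGaussian (EuclideanSpace ℝ (Fin k)) = (volume : Measure (EuclideanSpace ℝ (Fin k))).withDensity
      (fun x => ENNReal.ofReal (((2 * Real.pi) ^ ((k : ℝ) / 2))⁻¹ * Real.exp (-(1 / 2) * ‖x‖ ^ 2))) := by
  set c : ℝ := ((2 * Real.pi) ^ ((k : ℝ) / 2))⁻¹ with hc
  have hc0 : 0 < c := by positivity
  have hint : Integrable (fun x : EuclideanSpace ℝ (Fin k) => Real.exp (-(1 / 2) * ‖x‖ ^ 2)) := by
    have h := GaussianFourier.integral_rexp_neg_mul_sq_norm (V := EuclideanSpace ℝ (Fin k))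
      (by norm_num : (0 : ℝ) < 1 / 2)
    refine (integrable_of_integral_eq_one ?_ : Integrable (fun x : EuclideanSpace ℝ (Fin k) =>
      c * Real.exp (-(1 / 2) * ‖x‖ ^ 2))).const_mul c⁻¹ |>.congr ?_
    · rw [integral_const_mul, h, hc, finrank_euclideanSpace_fin,
        show Real.pi / (1 / 2) = 2 * Real.pi by ring]
      exact inv_mul_cancel₀ (by positivity)
    · exact Eventually.of_forall fun x => by field_simp
  have hfin : IsFiniteMeasure ((volume : Measure (EuclideanSpace ℝ (Fin k))).withDensity
      (fun x => ENNReal.ofReal (c * Real.exp (-(1 / 2) * ‖x‖ ^ 2)))) :=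
    isFiniteMeasure_withDensity_ofReal (hint.const_mul c).2
  refine Measure.ext_of_charFun (funext fun t => ?_)
  rw [charFun_stdGaussian, charFun_apply,
    integral_withDensity_eq_integral_toReal_smul (by fun_prop) (by simp)]
  have h1 (x : EuclideanSpace ℝ (Fin k)) :
      (ENNReal.ofReal (c * Real.exp (-(1 / 2) * ‖x‖ ^ 2))).toReal •
        Complex.exp ((inner ℝ x t : ℝ) * Complex.I) =
      c * Complex.exp (-(1 / 2 : ℂ) * ‖x‖ ^ 2 + Complex.I * (inner ℝ t x : ℝ)) := by
    rw [ENNReal.toReal_ofReal (by positivity), Complex.exp_add, Complex.real_smul,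
      real_inner_comm t x]
    push_cast
    ring_nf
  simp_rw [h1]
  rw [integral_const_mul, GaussianFourier.integral_cexp_neg_mul_sq_norm_add (by norm_num),
    finrank_euclideanSpace_fin]
  have h2 : (Real.pi / (1 / 2 : ℂ)) ^ ((k : ℂ) / 2) = (((2 * Real.pi) ^ ((k : ℝ) / 2) : ℝ) : ℂ) := by
    rw [Complex.ofReal_cpow (by positivity)]
    push_cast
    congr 1
    ring
  rw [h2, hc, ← mul_assoc, ← Complex.ofReal_mul, inv_mul_cancel₀ (by positivity),
    Complex.ofReal_one, one_mul]
  congr 1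
  rw [Complex.I_sq]
  ring

/-- The unnormalized density of `‖Z‖ / √(k + 1)` on the positive half line, where `Z` is standard
Gaussian in dimension `k + 1`. -/
noncomputable def radial (k : ℕ) (v : ℝ) : ℝ := v ^ k * Real.exp (-((k + 1) / 2) * v ^ 2)

variable {k : ℕ}

lemma radial_nonneg {v : ℝ} (hv : 0 ≤ v) : 0 ≤ radial k v :=
  mul_nonneg (pow_nonneg hv k) (Real.exp_pos _).le

lemma radial_pos {v : ℝ} (hv : 0 < v) : 0 < radial k v :=
  mul_pos (pow_pos hv k) (Real.exp_pos _)

lemma continuous_radial : Continuous (radial k) := by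
  unfold radial; fun_prop

lemma integrable_radial : Integrable (radial k) := by
  have h := integrable_rpow_mul_exp_neg_mul_sq (b := ((k : ℝ) + 1) / 2) (s := k) (by positivity)
    (by have := k.cast_nonneg (α := ℝ); linarith)
  simp only [Real.rpow_natCast] at h
  exact h

lemma integral_radial_pos : 0 < ∫ v in Set.Ioi 0, radial k v := by
  rw [setIntegral_pos_iff_support_of_nonneg_ae]
  · refine lt_of_lt_of_le (?_ : 0 < volume (Set.Ioi (0 : ℝ))) (measure_mono fun v hv => ⟨?_, hv⟩)
    · simp
    · exact (radial_pos hv).ne'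
  · filter_upwards [ae_restrict_mem measurableSet_Ioi] with v hv
    exact radial_nonneg (le_of_lt hv)
  · exact integrable_radial.integrableOn

/-- The chi-square tail, as a quotient of radial integrals. -/
lemma chiSq_real_eq (k : ℕ) {a : ℝ} (ha : 0 ≤ a) :
    (chiSq (k + 1)).real {x | ((k + 1 : ℕ) : ℝ) * a ^ 2 < x} =
      (∫ v in Set.Ioi a, radial k v) / ∫ v in Set.Ioi 0, radial k v := by
  set m : ℝ := ((k + 1 : ℕ) : ℝ) with hm
  have hm0 : 0 < m := by positivity
  set E := EuclideanSpace ℝ (Fin (k + 1))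
  set c : ℝ := ((2 * Real.pi) ^ (m / 2))⁻¹ with hc
  have hc0 : 0 < c := by positivity
  set h : ℝ → ℝ := fun y => c * Real.exp (-(1 / 2) * y ^ 2) with hh
  set D : ℝ := Module.finrank ℝ E * (volume : Measure E).real (Metric.ball 0 1) with hD
  have htail (r : ℝ) (hr : 0 ≤ r) : (stdGaussian E).real {z | √m * r < ‖z‖} =
      (D * c * √m ^ (k + 1)) * ∫ v in Set.Ioi r, radial k v := by
    have hms : MeasurableSet {z : E | √m * r < ‖z‖} :=
      measurableSet_lt measurable_const measurable_norm
    have h1 : (stdGaussian E).real {z | √m * r < ‖z‖} =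
        ∫ z : E, (Set.Ioi (√m * r)).indicator h ‖z‖ := by
      rw [measureReal_def, stdGaussian_eq_withDensity, withDensity_apply _ hms,
        ← integral_eq_lintegral_of_nonneg_ae (Eventually.of_forall fun x => by positivity)
          (by fun_prop), ← integral_indicator hms]
      rfl
    have h2 : ∀ y ∈ Set.Ioi (0 : ℝ), y ^ (Module.finrank ℝ E - 1) •
        (Set.Ioi (√m * r)).indicator h y = (Set.Ioi (√m * r)).indicator
          (fun y => y ^ k * h y) y := by
      intro y _
      rw [finrank_euclideanSpace_fin, Nat.add_sub_cancel]
      by_cases hy : y ∈ Set.Ioi (√m * r) <;> simp [hy]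
    have hsm : 0 < √m := Real.sqrt_pos.2 hm0
    have h3 : ∫ y in Set.Ioi (√m * r), y ^ k * h y =
        √m * ∫ v in Set.Ioi r, (√m * v) ^ k * h (√m * v) := by
      rw [integral_comp_mul_left_Ioi (fun y => y ^ k * h y) r hsm, smul_eq_mul,
        mul_inv_cancel_left₀ hsm.ne']
    have h4 : ∀ v, (√m * v) ^ k * h (√m * v) = (c * √m ^ k) * radial k v := by
      intro v
      simp only [hh, radial, mul_pow, Real.sq_sqrt hm0.le]
      simp only [hm]
      push_cast
      ring_nf
    rw [h1, integral_fun_norm_addHaar, setIntegral_congr_fun measurableSet_Ioi h2,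
      setIntegral_indicator measurableSet_Ioi, Set.Ioi_inter_Ioi,
      max_eq_right (by positivity), h3]
    simp_rw [h4]
    rw [integral_const_mul, nsmul_eq_mul, smul_eq_mul, hD]
    ring
  have hset : (chiSq (k + 1)).real {x | m * a ^ 2 < x} =
      (stdGaussian E).real {z | √m * a < ‖z‖} := by
    have hms : MeasurableSet {x : ℝ | m * a ^ 2 < x} := measurableSet_Ioi
    rw [chiSq, map_measureReal_apply (by fun_prop) hms]
    congr 1; ext z
    change m * a ^ 2 < ‖z‖ ^ 2 ↔ √m * a < ‖z‖
    rw [← sq_lt_sq₀ (by positivity) (norm_nonneg z), mul_pow, Real.sq_sqrt hm0.le]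
  have htotal : (D * c * √m ^ (k + 1)) * ∫ v in Set.Ioi 0, radial k v = 1 := by
    rw [← htail 0 le_rfl, mul_zero]
    have hcompl : {z : E | 0 < ‖z‖} = {0}ᶜ := by
      ext z; exact norm_pos_iff
    have h0 : stdGaussian E {0} = 0 := by
      rw [stdGaussian_eq_withDensity]
      exact withDensity_absolutelyContinuous _ _ (measure_singleton _)
    rw [hcompl, probReal_compl_eq_one_sub (measurableSet_singleton _), measureReal_def, h0]
    simp
  rw [hset, htail a ha, eq_div_iff integral_radial_pos.ne', mul_right_comm, htotal, one_mul]

end Polar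

/-! ### Stirling's lower bound at half integers -/

section Stirling

/-- `log Γ(x)` minus the main part of Stirling's formula, up to the constant `log (2π) / 2`. -/
noncomputable def stirlingDefect (x : ℝ) : ℝ :=
  Real.log (Real.Gamma x) - (x - 1 / 2) * Real.log x + x

lemma stirlingDefect_add_one_le {x : ℝ} (hx : 0 < x) :
    stirlingDefect (x + 1) ≤ stirlingDefect x := by
  have h1 : Real.log (Real.Gamma (x + 1)) = Real.log x + Real.log (Real.Gamma x) := by
    rw [Real.Gamma_add_one hx.ne', Real.log_mul hx.ne' (Real.Gamma_pos_of_pos hx).ne']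
  have h2 := Real.le_log_one_add_of_nonneg (x := x⁻¹) (by positivity)
  have h3 : Real.log (1 + x⁻¹) = Real.log (x + 1) - Real.log x := by
    rw [← Real.log_div (by positivity) hx.ne']
    congr 1; field_simp
  have h4 : 2 * x⁻¹ / (x⁻¹ + 2) = 1 / (x + 1 / 2) := by field_simp; ring
  rw [h3, h4, div_le_iff₀ (by positivity)] at h2
  rw [stirlingDefect, stirlingDefect, h1]
  linarith

lemma stirlingDefect_add_nat_le {x : ℝ} (hx : 0 < x) (i : ℕ) :
    stirlingDefect (x + i) ≤ stirlingDefect x := by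
  induction i with
  | zero => simp
  | succ i ih =>
    push_cast
    rw [← add_assoc]
    exact (stirlingDefect_add_one_le (by positivity)).trans ih

lemma log_factorial_eq {n : ℕ} : Real.log n.factorial = Real.log (Real.Gamma (n + 1)) := by
  rw [Real.Gamma_nat_eq_factorial]

lemma le_stirlingDefect_nat {n : ℕ} (hn : n ≠ 0) :
    Real.log (2 * Real.pi) / 2 ≤ stirlingDefect n := by
  have hn' : (0 : ℝ) < n := by positivity
  have h1 := Stirling.le_log_factorial_stirling hn
  have h2 : Real.log n.factorial = Real.log n + Real.log (Real.Gamma n) := by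
    rw [log_factorial_eq, Real.Gamma_add_one hn'.ne',
      Real.log_mul hn'.ne' (Real.Gamma_pos_of_pos hn').ne']
  rw [stirlingDefect]
  linarith

/-- Log-convexity of `Γ` transfers the bound at the integers to the half integers, with an error
that vanishes at infinity. -/
lemma le_stirlingDefect_nat_add_half {n : ℕ} (hn : n ≠ 0) :
    Real.log (2 * Real.pi) / 2 - 1 / (4 * n) ≤ stirlingDefect (n + 1 / 2) := by
  have hn' : (0 : ℝ) < n := by positivity
  set x : ℝ := n + 1 / 2 with hx
  have hx0 : 0 < x := by positivity
  have h1 := Stirling.le_log_factorial_stirling hn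
  have h2 := Real.convexOn_log_Gamma.2 (show x ∈ Set.Ioi (0 : ℝ) from hx0)
    (show x + 1 ∈ Set.Ioi (0 : ℝ) by simp only [Set.mem_Ioi]; linarith)
    (show (0 : ℝ) ≤ 1 / 2 by norm_num) (show (0 : ℝ) ≤ 1 / 2 by norm_num) (by norm_num)
  simp only [Function.comp_apply, smul_eq_mul] at h2
  rw [Real.Gamma_add_one hx0.ne', Real.log_mul hx0.ne' (Real.Gamma_pos_of_pos hx0).ne',
    show 1 / 2 * x + 1 / 2 * (x + 1) = (n : ℝ) + 1 by rw [hx]; ring, ← log_factorial_eq] at h2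
  have h3 : Real.log x - Real.log n ≤ 1 / (2 * n) := by
    rw [← Real.log_div hx0.ne' hn'.ne']
    refine (Real.log_le_sub_one_of_pos (by positivity)).trans_eq ?_
    rw [hx]; field_simp; ring
  have h4 := mul_le_mul_of_nonneg_left h3 hx0.le
  have h5 : x * (1 / (2 * n)) = 1 / 2 + 1 / (4 * n) := by rw [hx]; field_simp; ring
  rw [stirlingDefect]
  have h6 : (x - 1 / 2) = n := by rw [hx]; ring
  rw [h5] at h4
  have h7 : x * (Real.log x - Real.log n) = n * Real.log x + Real.log x / 2
      - (n * Real.log n + Real.log n / 2) := by rw [hx]; ring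
  rw [h6]
  linarith

/-- Stirling's lower bound `√(2π) x^(x - 1/2) e^(-x) ≤ Γ(x)` for `2x` a positive integer. -/
lemma le_stirlingDefect_half_nat (k : ℕ) :
    Real.log (2 * Real.pi) / 2 ≤ stirlingDefect (((k : ℝ) + 1) / 2) := by
  rcases Nat.even_or_odd' k with ⟨i, rfl | rfl⟩
  · have hx : (((2 * i : ℕ) : ℝ) + 1) / 2 = i + 1 / 2 := by push_cast; ring
    rw [hx]
    have hlim : Tendsto (fun n : ℕ => Real.log (2 * Real.pi) / 2 - 1 / (4 * ((i + (n + 1) : ℕ) : ℝ)))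
        atTop (𝓝 (Real.log (2 * Real.pi) / 2 - 0)) := by
      refine tendsto_const_nhds.sub ?_
      refine tendsto_const_nhds.div_atTop (Tendsto.const_mul_atTop (by norm_num) ?_)
      refine tendsto_natCast_atTop_atTop.comp ?_
      exact tendsto_atTop_mono (fun n => by simp only [id]; omega) tendsto_id
    rw [sub_zero] at hlim
    refine le_of_tendsto' hlim fun n => ?_
    refine (le_stirlingDefect_nat_add_half (by omega)).trans ?_
    have h := stirlingDefect_add_nat_le (x := (i : ℝ) + 1 / 2) (by positivity) (n + 1)
    refine le_of_eq_of_le ?_ h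
    congr 1; push_cast; ring
  · have hx : (((2 * i + 1 : ℕ) : ℝ) + 1) / 2 = ((i + 1 : ℕ) : ℝ) := by push_cast; ring
    rw [hx]
    exact le_stirlingDefect_nat (by omega)

end Stirling

/-! ### Tail bounds -/

section Tails

variable {k : ℕ}

/-- `∫₀^∞ v^k exp (-(k+1)v²/2) dv ≥ √(π/(k+1)) e^{-(k+1)/2}`. -/
lemma le_integral_radial (k : ℕ) :
    √(Real.pi / (k + 1)) * Real.exp (-((k + 1) / 2)) ≤ ∫ v in Set.Ioi 0, radial k v := by
  set x : ℝ := ((k : ℝ) + 1) / 2 with hx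
  have hx0 : 0 < x := by positivity
  have hN : ∫ v in Set.Ioi 0, radial k v = x ^ (-x) * (1 / 2) * Real.Gamma x := by
    have h := integral_rpow_mul_exp_neg_mul_rpow (p := 2) (q := k) (b := x) two_pos
      (by have := k.cast_nonneg (α := ℝ); linarith) hx0
    rw [neg_div, ← hx] at h
    rw [← h]
    refine setIntegral_congr_fun measurableSet_Ioi fun v _ => ?_
    simp only [radial, Real.rpow_natCast, ← hx]
    norm_cast
  have hG := Real.Gamma_pos_of_pos hx0
  have hpos : 0 < x ^ (-x) * (1 / 2) * Real.Gamma x := by positivity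
  rw [hN, ← Real.log_le_log_iff (by positivity) hpos,
    Real.log_mul (by positivity) (Real.exp_pos _).ne', Real.log_exp,
    Real.log_mul (by positivity) hG.ne', Real.log_mul (by positivity) (by norm_num),
    Real.log_rpow hx0, Real.log_sqrt (by positivity)]
  have h1 := le_stirlingDefect_half_nat k
  rw [← hx, stirlingDefect] at h1
  have h2 : Real.pi / ((k : ℝ) + 1) = 2 * Real.pi / (2 * 2 * x) := by rw [hx]; field_simp
  have h3 : Real.log (1 / 2) = - Real.log 2 := by rw [one_div, Real.log_inv]
  rw [h2, Real.log_div (by positivity) (by positivity), Real.log_mul (by norm_num) hx0.ne',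
    Real.log_mul two_ne_zero two_ne_zero, h3]
  linarith

lemma hasDerivAt_radial {v : ℝ} (hv : 0 < v) :
    HasDerivAt (radial k) (-(radial k v * ((k + 1) * v - k / v))) v := by
  have h1 : HasDerivAt (fun v : ℝ => -(((k : ℝ) + 1) / 2) * v ^ 2)
      (-(((k : ℝ) + 1) / 2) * (2 * v)) v := by
    simpa using (hasDerivAt_pow 2 v).const_mul (-(((k : ℝ) + 1) / 2))
  have h2 := (hasDerivAt_pow k v).mul h1.exp
  refine h2.congr_deriv ?_
  rw [radial]
  have h3 : (k : ℝ) * v ^ (k - 1) = v ^ k * (k / v) := by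
    cases k with
    | zero => simp
    | succ k => rw [Nat.add_sub_cancel, pow_succ]; field_simp
  rw [h3]
  ring

lemma intervalIntegral_radial_mul {a b : ℝ} (ha : 0 < a) (hab : a ≤ b) :
    IntervalIntegrable (fun v => radial k v * ((k + 1) * v - k / v)) volume a b ∧
      ∫ v in a..b, radial k v * ((k + 1) * v - k / v) = radial k a - radial k b := by
  have hpos : ∀ v ∈ Set.uIcc a b, 0 < v := fun v hv => by
    rw [Set.uIcc_of_le hab] at hv; exact ha.trans_le hv.1
  have hint : IntervalIntegrable (fun v => radial k v * ((k + 1) * v - k / v)) volume a b := by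
    refine ContinuousOn.intervalIntegrable ?_
    refine continuous_radial.continuousOn.mul (ContinuousOn.sub (by fun_prop) ?_)
    exact continuousOn_const.div continuousOn_id fun v hv => (hpos v hv).ne'
  refine ⟨hint, ?_⟩
  have h := intervalIntegral.integral_eq_sub_of_hasDerivAt
    (fun v hv => hasDerivAt_radial (k := k) (hpos v hv)) hint.neg
  rw [intervalIntegral.integral_neg] at h
  linarith

lemma slope_mono {a b : ℝ} (ha : 0 < a) (hab : a ≤ b) :
    ((k : ℝ) + 1) * a - k / a ≤ (k + 1) * b - k / b := by
  gcongr

/-- A tail integral of `radial k` is at most `c` times its value, when `c` times the negative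
logarithmic derivative is at least `1`. -/
lemma integral_Ioi_radial_le {a c : ℝ} (ha : 0 < a) (hc0 : 0 ≤ c)
    (hc : 1 ≤ c * ((k + 1) * a - k / a)) :
    ∫ v in Set.Ioi a, radial k v ≤ c * radial k a := by
  refine le_of_tendsto (intervalIntegral_tendsto_integral_Ioi a integrable_radial.integrableOn
    tendsto_id) ?_
  filter_upwards [eventually_ge_atTop a] with b hb
  obtain ⟨hint, heq⟩ := intervalIntegral_radial_mul (k := k) ha hb
  calc ∫ v in a..id b, radial k v ≤ ∫ v in a..b, c * (radial k v * ((k + 1) * v - k / v)) := by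
        refine intervalIntegral.integral_mono_on hb (continuous_radial.intervalIntegrable _ _)
          (hint.const_mul c) fun v hv => ?_
        have h1 : 1 ≤ c * ((k + 1) * v - k / v) :=
          hc.trans (mul_le_mul_of_nonneg_left (slope_mono ha hv.1) hc0)
        have h2 := mul_le_mul_of_nonneg_left h1 (radial_nonneg (k := k) (ha.trans_le hv.1).le)
        linarith
    _ = c * (radial k a - radial k b) := by rw [intervalIntegral.integral_const_mul, heq]
    _ ≤ c * radial k a := by
        gcongr
        exact sub_le_self _ (radial_nonneg (ha.trans_le hb).le)

/-- The mass of `radial k` beyond `1` is at most one half: the inversion `v ↦ 1/v` maps `(1, ∞)`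
into `(0, 1)` and increases the density, because `2 log z ≤ z - 1/z` for `z ≥ 1`. -/
lemma integral_Ioi_one_radial_le (k : ℕ) :
    ∫ v in Set.Ioi 1, radial k v ≤ (∫ v in Set.Ioi 0, radial k v) / 2 := by
  have hkey : ∀ x : ℝ, 0 < x → x < 1 → (x ^ 2)⁻¹ * radial k x⁻¹ ≤ radial k x := by
    intro x hx hx1
    set z := (x ^ 2)⁻¹ with hz
    have hz0 : 0 < z := by positivity
    have hz1 : 1 ≤ z := (one_le_inv₀ (by positivity)).2 (pow_le_one₀ hx.le hx1.le)
    have hlog : Real.log z ≤ (z - z⁻¹) / 2 := by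
      rw [← Real.sinh_log hz0]
      exact Real.self_le_sinh_iff.2 (Real.log_nonneg hz1)
    have h1 : z ≤ Real.exp ((z - z⁻¹) / 2) := by
      rwa [← Real.log_le_iff_le_exp hz0]
    have h2 : z ^ (k + 1) ≤ Real.exp (((k : ℝ) + 1) * ((z - z⁻¹) / 2)) := by
      calc z ^ (k + 1) ≤ Real.exp ((z - z⁻¹) / 2) ^ (k + 1) := by gcongr
        _ = _ := by rw [← Real.exp_nat_mul]; push_cast; rfl
    have h3 : (x ^ 2)⁻¹ * radial k x⁻¹ =
        x ^ k * (z ^ (k + 1) * Real.exp (-(((k : ℝ) + 1) / 2) * z)) := by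
      rw [radial, inv_pow x 2, ← hz, pow_succ z k]
      have : x⁻¹ ^ k = x ^ k * z ^ k := by
        rw [← mul_pow, hz]; congr 1; field_simp
      rw [this]; ring
    rw [h3, radial]
    have h4 : x ^ 2 = z⁻¹ := by rw [hz, inv_inv]
    rw [h4]
    gcongr
    calc z ^ (k + 1) * Real.exp (-(((k : ℝ) + 1) / 2) * z)
        ≤ Real.exp (((k : ℝ) + 1) * ((z - z⁻¹) / 2)) * Real.exp (-(((k : ℝ) + 1) / 2) * z) := by
          gcongr
      _ = _ := by rw [← Real.exp_add]; congr 1; ring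
  have hmain : ∫ v in Set.Ioi 1, radial k v ≤ ∫ v in Set.Ioo 0 1, radial k v := by
    have h1 : ∫ v in Set.Ioi 1, radial k v =
        ∫ v in Set.Ioi 0, (Set.Ioi 1).indicator (radial k) v := by
      rw [setIntegral_indicator measurableSet_Ioi, Set.Ioi_inter_Ioi]
      norm_num
    have h2 : ∫ v in Set.Ioo 0 1, radial k v =
        ∫ v in Set.Ioi 0, (Set.Iio 1).indicator (radial k) v := by
      rw [setIntegral_indicator measurableSet_Iio, Set.Ioi_inter_Iio]
    rw [h1, h2, ← integral_comp_rpow_Ioi _ (by norm_num : (-1 : ℝ) ≠ 0)]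
    refine integral_mono_of_nonneg ?_
      (integrable_radial.indicator measurableSet_Iio).integrableOn ?_
    · filter_upwards [ae_restrict_mem measurableSet_Ioi] with x hx
      refine mul_nonneg (mul_nonneg (abs_nonneg _) (Real.rpow_nonneg (le_of_lt hx) _))
        (Set.indicator_nonneg (fun y hy => radial_nonneg ?_) _)
      exact zero_le_one.trans (le_of_lt hy)
    · filter_upwards [ae_restrict_mem measurableSet_Ioi] with x hx
      have hx0 : 0 < x := hx
      have h3 : |(-1 : ℝ)| * x ^ ((-1 : ℝ) - 1) = (x ^ 2)⁻¹ := by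
        rw [abs_neg, abs_one, one_mul, show (-1 : ℝ) - 1 = -((2 : ℕ) : ℝ) by norm_num,
          Real.rpow_neg hx0.le, Real.rpow_natCast]
      simp only [h3, Real.rpow_neg_one, smul_eq_mul]
      by_cases hx1 : x < 1
      · have h4 : x⁻¹ ∈ Set.Ioi (1 : ℝ) := (one_lt_inv₀ hx0).2 hx1
        rw [Set.indicator_of_mem h4, Set.indicator_of_mem (show x ∈ Set.Iio (1 : ℝ) from hx1)]
        exact hkey x hx0 hx1
      · have h4 : x⁻¹ ∉ Set.Ioi (1 : ℝ) := fun h => hx1 ((one_lt_inv₀ hx0).1 h)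
        rw [Set.indicator_of_notMem h4, Set.indicator_of_notMem (show x ∉ Set.Iio (1 : ℝ) from hx1),
          mul_zero]
  have hsplit : ∫ v in Set.Ioi 0, radial k v =
      (∫ v in Set.Ioc 0 1, radial k v) + ∫ v in Set.Ioi 1, radial k v := by
    rw [← setIntegral_union (Set.Ioc_disjoint_Ioi le_rfl) measurableSet_Ioi
      integrable_radial.integrableOn integrable_radial.integrableOn,
      Set.Ioc_union_Ioi_eq_Ioi zero_le_one]
  rw [hsplit, integral_Ioc_eq_integral_Ioo]
  linarith

/-- The chi-square tail without the factor `J₃`. If the logarithmic derivative of `radial k` is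
already large enough at `a`, it dominates on `(a, ∞)`; otherwise it is dominated on `[1, a]`, and
the bound at `a` follows from the one at `1`. -/
lemma integral_Ioi_radial_le_of_one_le {a : ℝ} (ha : 1 ≤ a) :
    ∫ v in Set.Ioi a, radial k v ≤
      (∫ v in Set.Ioi 0, radial k v) * Real.exp ((k + 1) / 2) / √2 * radial k a := by
  have hN := integral_radial_pos (k := k)
  set N := ∫ v in Set.Ioi 0, radial k v
  set c := N * Real.exp ((k + 1) / 2) / √2 with hc
  have hc0 : 0 < c := by positivity
  have ha0 : 0 < a := one_pos.trans_le ha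
  rcases le_total 1 (c * ((k + 1) * a - k / a)) with h | h
  · exact integral_Ioi_radial_le ha0 hc0.le h
  · obtain ⟨hint, heq⟩ := intervalIntegral_radial_mul (k := k) one_pos ha
    have h1 : c * (radial k 1 - radial k a) ≤ ∫ v in (1 : ℝ)..a, radial k v := by
      rw [← heq, ← intervalIntegral.integral_const_mul]
      refine intervalIntegral.integral_mono_on ha (hint.const_mul c)
        (continuous_radial.intervalIntegrable _ _) fun v hv => ?_
      have hv0 : 0 < v := one_pos.trans_le hv.1
      have h2 : c * ((k + 1) * v - k / v) ≤ 1 :=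
        (mul_le_mul_of_nonneg_left (slope_mono hv0 hv.2) hc0.le).trans h
      have h3 := mul_le_mul_of_nonneg_left h2 (radial_nonneg (k := k) hv0.le)
      linarith
    have h2 : (∫ v in (1 : ℝ)..a, radial k v) + ∫ v in Set.Ioi a, radial k v =
        ∫ v in Set.Ioi 1, radial k v := by
      rw [intervalIntegral.integral_of_le ha,
        ← setIntegral_union (Set.Ioc_disjoint_Ioi le_rfl) measurableSet_Ioi
          integrable_radial.integrableOn integrable_radial.integrableOn,
        Set.Ioc_union_Ioi_eq_Ioi ha]
    have h3 := integral_Ioi_one_radial_le k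
    have h4 : c * radial k 1 = N / √2 := by
      rw [hc, radial, one_pow, one_pow, mul_one, one_mul, div_mul_eq_mul_div, mul_assoc,
        ← Real.exp_add]
      have : ((k : ℝ) + 1) / 2 + -(((k : ℝ) + 1) / 2) = 0 := by ring
      rw [this, Real.exp_zero, mul_one]
    have h5 : N / 2 ≤ N / √2 := by
      gcongr
      rw [Real.sqrt_le_left (by norm_num)]
      norm_num
    linarith

/-- The chi-square tail at `(k+1) a²`, `a ≥ 1`. -/
lemma chiSq_tail_le {a : ℝ} (ha : 1 ≤ a) :
    (chiSq (k + 1)).real {x | ((k + 1 : ℕ) : ℝ) * a ^ 2 < x} ≤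
      Real.exp ((k + 1) / 2) * radial k a / √2 /
        max 1 ((a ^ 2 - 1 + 1 / (k + 1)) * √((k + 1) * Real.pi) / (√2 * a)) := by
  have hN := integral_radial_pos (k := k)
  have ha0 : 0 < a := one_pos.trans_le ha
  rw [chiSq_real_eq k ha0.le]
  have hA := integral_Ioi_radial_le_of_one_le (k := k) ha
  have hNlow := le_integral_radial k
  set N := ∫ v in Set.Ioi 0, radial k v
  set J := (a ^ 2 - 1 + 1 / ((k : ℝ) + 1)) * √((k + 1) * Real.pi) / (√2 * a) with hJ
  have ha2 : 1 ≤ a ^ 2 := one_le_pow₀ ha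
  have hs0 : 0 < ((k : ℝ) + 1) * a ^ 2 - k := by
    have := k.cast_nonneg (α := ℝ)
    nlinarith
  have hr := radial_pos (k := k) ha0
  rcases le_total J 1 with hJ1 | hJ1
  · rw [max_eq_left hJ1, div_one, div_le_iff₀ hN]
    refine hA.trans_eq ?_
    ring
  · rw [max_eq_right hJ1, div_le_div_iff₀ hN (one_pos.trans_le hJ1)]
    have hc : 1 ≤ a / (((k : ℝ) + 1) * a ^ 2 - k) * ((k + 1) * a - k / a) := by
      have h1 : a * (((k : ℝ) + 1) * a - k / a) = (k + 1) * a ^ 2 - k := by field_simp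
      rw [div_mul_eq_mul_div, h1, div_self hs0.ne']
    have hB := integral_Ioi_radial_le ha0 (by positivity) hc
    have hJeq : J = (((k : ℝ) + 1) * a ^ 2 - k) / (√2 * a) * √(Real.pi / (k + 1)) := by
      have h1 : √(((k : ℝ) + 1) * Real.pi) = (k + 1) * √(Real.pi / (k + 1)) := by
        have h2 : ((k : ℝ) + 1) * Real.pi = (k + 1) ^ 2 * (Real.pi / (k + 1)) := by field_simp
        rw [h2, Real.sqrt_mul (by positivity), Real.sqrt_sq (by positivity)]
      rw [hJ, h1]
      field_simp
      ring
    have hexp : Real.exp (((k : ℝ) + 1) / 2) * Real.exp (-(((k : ℝ) + 1) / 2)) = 1 := by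
      rw [← Real.exp_add, add_neg_cancel, Real.exp_zero]
    calc (∫ v in Set.Ioi a, radial k v) * J
        ≤ a / (((k : ℝ) + 1) * a ^ 2 - k) * radial k a * J := by gcongr
      _ = radial k a / √2 * √(Real.pi / (k + 1)) := by
          have hs1 := hs0.ne'
          rw [hJeq]
          generalize ((k : ℝ) + 1) * a ^ 2 - k = D at hs1
          field_simp
      _ = radial k a / √2 * Real.exp ((k + 1) / 2) *
            (√(Real.pi / (k + 1)) * Real.exp (-((k + 1) / 2))) := by
          linear_combination (-(radial k a / √2 * √(Real.pi / (k + 1)))) * hexp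
      _ ≤ radial k a / √2 * Real.exp ((k + 1) / 2) * N := by gcongr
      _ = _ := by ring

/-- The normal tail: `Φ(-√(2L)) ≤ e^{-L} / (2 max(1, √(πL)))`. -/
lemma Phi_neg_sqrt_le {L : ℝ} (hL : 0 ≤ L) :
    Phi (-√(2 * L)) ≤ Real.exp (-L) / 2 / max 1 √(Real.pi * L) := by
  set t := √(2 * L) with ht
  have ht0 : 0 ≤ t := Real.sqrt_nonneg _
  have ht2 : t ^ 2 = 2 * L := Real.sq_sqrt (by positivity)
  set c : ℝ := (√(2 * Real.pi))⁻¹ with hc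
  have hc0 : 0 < c := by positivity
  have hphi (x : ℝ) : gaussianPDFReal 0 1 x = c * radial 0 x := by
    rw [gaussianPDFReal_def, radial, hc]
    norm_num
    left
    ring_nf
  have hPhi : Phi (-t) = c * ∫ x in Set.Ioi t, radial 0 x := by
    rw [Phi, cdf_eq_real, measureReal_def, gaussianReal_apply_eq_integral 0 one_ne_zero,
      ENNReal.toReal_ofReal (setIntegral_nonneg measurableSet_Iic fun x _ =>
        gaussianPDFReal_nonneg _ _ _)]
    have h1 : ∀ x, gaussianPDFReal 0 1 x = (fun y => c * radial 0 y) (-x) := by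
      intro x; simp only [hphi, radial]; norm_num
    simp_rw [h1]
    rw [integral_comp_neg_Iic (-t) (fun y => c * radial 0 y), neg_neg, integral_const_mul]
  have hval : radial 0 t = Real.exp (-L) := by
    rw [radial, ht2]; norm_num; ring_nf
  have h1 : Phi (-t) ≤ Real.exp (-L) / 2 := by
    have h2 : ∫ x in Set.Ioi t, radial 0 x = ∫ x in Set.Ioi 0, radial 0 (x + t) := by
      have := (integral_add_right_eq_self (μ := volume) ((Set.Ioi t).indicator (radial 0)) t)
      rw [← integral_indicator measurableSet_Ioi, ← this, ← integral_indicator measurableSet_Ioi]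
      congr 1; ext x
      by_cases hx : 0 < x
      · rw [Set.indicator_of_mem (show x + t ∈ Set.Ioi t by simpa using hx),
          Set.indicator_of_mem (show x ∈ Set.Ioi (0 : ℝ) from hx)]
      · rw [Set.indicator_of_notMem (show x + t ∉ Set.Ioi t by simpa using hx),
          Set.indicator_of_notMem (show x ∉ Set.Ioi (0 : ℝ) from hx)]
    have h3 : ∫ x in Set.Ioi 0, radial 0 (x + t) ≤
        ∫ x in Set.Ioi 0, Real.exp (-L) * radial 0 x := by
      refine setIntegral_mono_on (integrable_radial.comp_add_right t).integrableOn
        (integrable_radial.const_mul _).integrableOn measurableSet_Ioi fun x hx => ?_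
      rw [← hval]
      simp only [radial, pow_zero, one_mul]
      rw [← Real.exp_add, Real.exp_le_exp]
      have := mul_nonneg (le_of_lt hx : (0 : ℝ) ≤ x) ht0
      push_cast
      nlinarith
    have h4 : ∫ x in Set.Ioi 0, radial 0 x = √(2 * Real.pi) / 2 := by
      have h := integral_gaussian_Ioi (1 / 2)
      rw [show Real.pi / (1 / 2) = 2 * Real.pi by ring] at h
      rw [← h]
      refine setIntegral_congr_fun measurableSet_Ioi fun x _ => ?_
      simp [radial]
    rw [integral_const_mul, h4] at h3
    rw [hPhi, h2]
    calc c * ∫ x in Set.Ioi 0, radial 0 (x + t) ≤ c * (Real.exp (-L) * (√(2 * Real.pi) / 2)) := by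
          gcongr
      _ = _ := by rw [hc]; field_simp
  rcases le_total √(Real.pi * L) 1 with hJ | hJ
  · rw [max_eq_left hJ, div_one]; exact h1
  · rw [max_eq_right hJ]
    have hL0 : 0 < L := by
      rcases hL.eq_or_lt with h | h
      · rw [← h, mul_zero, Real.sqrt_zero] at hJ; linarith
      · exact h
    have htpos : 0 < t := Real.sqrt_pos.2 (by positivity)
    have h2 := integral_Ioi_radial_le (k := 0) (c := t⁻¹) htpos (by positivity)
      (by rw [Nat.cast_zero, zero_div, sub_zero, zero_add, one_mul, inv_mul_cancel₀ htpos.ne'])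
    rw [hPhi]
    calc c * ∫ x in Set.Ioi t, radial 0 x ≤ c * (t⁻¹ * radial 0 t) := by gcongr
      _ = Real.exp (-L) / 2 / √(Real.pi * L) := by
        have h3 : √(2 * Real.pi) * t = 2 * √(Real.pi * L) := by
          rw [ht, ← Real.sqrt_mul (by positivity),
            show 2 * Real.pi * (2 * L) = 2 ^ 2 * (Real.pi * L) by ring,
            Real.sqrt_mul (by positivity), Real.sqrt_sq (by norm_num)]
        rw [hval, hc, ← mul_assoc, ← mul_inv, h3]
        field_simp

end Tails

/-! ### The explicit bound and selection consistency -/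

lemma measureReal_le_inter_add_compl {Ω : Type*} [MeasurableSpace Ω] (μ : Measure Ω)
    [IsProbabilityMeasure μ] (B R : Set Ω) : μ.real B ≤ μ.real (B ∩ R) + μ.real Rᶜ := by
  refine (measureReal_mono fun ω hω => ?_).trans (measureReal_union_le _ _)
  by_cases h : ω ∈ R
  · exact Or.inl ⟨hω, h⟩
  · exact Or.inr h

/-- One term of the explicit bound, when the minimum of `J₁, J₂, J₃` is at least `K`. -/
lemma mul_div_max_le {ε J K x : ℝ} (h0 : 0 < ε) (h1 : ε ≤ 1) (hx : 0 ≤ x) (hK : K ≤ J) :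
    ε * (x / max 1 J) ≤ x * (max ε⁻¹ K)⁻¹ := by
  have hε : 1 ≤ ε⁻¹ := (one_le_inv₀ h0).2 h1
  have hM : 1 ≤ max 1 J := le_max_left _ _
  have hpos : 0 < max ε⁻¹ K := (inv_pos.2 h0).trans_le (le_max_left _ _)
  have hle : max ε⁻¹ K ≤ max 1 J * ε⁻¹ := by
    refine max_le (le_mul_of_one_le_left (by positivity) hM) ?_
    exact (hK.trans (le_max_right _ _)).trans (le_mul_of_one_le_right (by positivity) hε)
  calc ε * (x / max 1 J) = x * (max 1 J * ε⁻¹)⁻¹ := by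
        have : max 1 J ≠ 0 := by positivity
        field_simp
    _ ≤ _ := mul_le_mul_of_nonneg_left (inv_anti₀ hpos hle) hx

namespace Problem

/-- `ε {1/(1 ∨ J₁) + (d°/(2a))/(1 ∨ J₂) + (4 log q)^{-1/2}/(1 ∨ J₃)}`. -/
noncomputable def explicitBound (P : Problem.{u}) (ε q a : ℝ) : ℝ :=
  ε * (1 / max 1 (P.J1 ε) + ((P.d0 : ℝ) / (2 * a)) / max 1 (P.J2 ε a) +
    (√(4 * Real.log q))⁻¹ / max 1 (P.J3 q))

variable {P : Problem.{u}} {ε q lam2 a : ℝ}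

/-- The event that the estimator is not the oracle estimator, or has a wrong sign. -/
def notOracle (P : Problem.{u}) : Set P.Ω :=
  {ω | P.betaHat ω ≠ P.betaOracle ω ∨ ∃ j, Real.sign (P.betaHat ω j) ≠ Real.sign (P.β j)}

namespace ExplicitAssumptions

lemma one_le_sub (h : P.ExplicitAssumptions ε q lam2 a) : (1 : ℝ) ≤ (P.p : ℝ) - P.d0 := by
  have h1 : P.d0 + 1 ≤ P.p := h.base.d0_lt.trans_le h.dStar_le
  have h2 : ((P.d0 + 1 : ℕ) : ℝ) ≤ P.p := by exact_mod_cast h1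
  push_cast at h2
  linarith

lemma n_pos (h : P.ExplicitAssumptions ε q lam2 a) : 0 < P.n :=
  h.base.src.n_pos h.base.dStar_pos h.base.cLow_pos (h.base.dStar_pos.trans_le h.dStar_le)

lemma log_sub_div_nonneg (h : P.ExplicitAssumptions ε q lam2 a) :
    0 ≤ Real.log (((P.p : ℝ) - P.d0) / ε) :=
  Real.log_nonneg ((one_le_div h.eps_pos).2 (h.eps_le_one.trans h.one_le_sub))

lemma d0_div_nonneg (h : P.ExplicitAssumptions ε q lam2 a) : 0 ≤ (P.d0 : ℝ) / (2 * a) := by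
  have := (Nat.cast_nonneg P.d0 : (0 : ℝ) ≤ _).trans h.a_ge
  positivity

lemma d0_div_le (h : P.ExplicitAssumptions ε q lam2 a) : (P.d0 : ℝ) / (2 * a) ≤ 1 / 2 := by
  have ha := (Nat.cast_nonneg P.d0 : (0 : ℝ) ≤ _).trans h.a_ge
  rcases ha.eq_or_lt with h0 | h0
  · rw [← h0]; norm_num
  · rw [div_le_div_iff₀ (by positivity) two_pos]
    linarith [h.a_ge]

lemma inv_sqrt_le (h : P.ExplicitAssumptions ε q lam2 a) : (√(4 * Real.log q))⁻¹ ≤ 1 / √2 := by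
  rw [one_div]
  have := h.pTilde.2.1
  exact inv_anti₀ (by positivity) (Real.sqrt_le_sqrt (by linarith))

/-- A bound that is small when `ε` is, or when all of `J₁, J₂, J₃` are large. -/
lemma explicitBound_le (h : P.ExplicitAssumptions ε q lam2 a) {K : ℝ} (h1 : K ≤ P.J1 ε)
    (h2 : K ≤ P.J2 ε a) (h3 : K ≤ P.J3 q) :
    P.explicitBound ε q a ≤ (3 / 2 + 1 / √2) * (max ε⁻¹ K)⁻¹ := by
  have hT : 0 ≤ (max ε⁻¹ K)⁻¹ :=
    inv_nonneg.2 ((inv_nonneg.2 h.eps_pos.le).trans (le_max_left _ _))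
  have e1 := mul_div_max_le h.eps_pos h.eps_le_one zero_le_one h1
  have e2 := mul_div_max_le h.eps_pos h.eps_le_one h.d0_div_nonneg h2
  have e3 := mul_div_max_le h.eps_pos h.eps_le_one
    (inv_nonneg.2 (Real.sqrt_nonneg (4 * Real.log q))) h3
  have e4 := mul_le_mul_of_nonneg_right h.d0_div_le hT
  have e5 := mul_le_mul_of_nonneg_right h.inv_sqrt_le hT
  rw [explicitBound]
  linarith

lemma pi1_le (h : P.ExplicitAssumptions ε q lam2 a) :
    P.pi1 (P.lam1 ε) ≤ ε * (1 / max 1 (P.J1 ε)) := by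
  have hn : (0 : ℝ) < P.n := by exact_mod_cast h.n_pos
  have hσ := h.base.sigma_pos
  have hN := h.one_le_sub
  set N : ℝ := (P.p : ℝ) - P.d0 with hNdef
  have hL := h.log_sub_div_nonneg
  rw [← hNdef] at hL
  have hterm (j : Fin P.p) : Phi (-(P.n * P.lam1 ε / (P.σ * ‖col P.X j‖))) ≤
      ε / N / 2 / max 1 (P.J1 ε) := by
    have hcol : ‖col P.X j‖ = √P.n := by rw [← h.columns j, Real.sqrt_sq (norm_nonneg _)]
    have harg : P.n * P.lam1 ε / (P.σ * ‖col P.X j‖) = √(2 * Real.log (N / ε)) := by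
      rw [hcol, lam1, ← hNdef, div_eq_iff (by positivity),
        show 2 / (P.n : ℝ) * Real.log (N / ε) = 2 * Real.log (N / ε) / P.n by ring,
        Real.sqrt_div (by positivity)]
      have hs : (P.n : ℝ) = √P.n * √P.n := (Real.mul_self_sqrt hn.le).symm
      have hs0 : √(P.n : ℝ) ≠ 0 := by positivity
      field_simp
      nth_rewrite 1 [hs]
      ring
    rw [harg]
    refine (Phi_neg_sqrt_le hL).trans_eq ?_
    rw [Real.exp_neg, Real.exp_log (div_pos (by linarith) h.eps_pos), inv_div, J1]
  have hcard : ((P.A0ᶜ.card : ℕ) : ℝ) = N := by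
    rw [Finset.card_compl, Fintype.card_fin, Nat.cast_sub]
    · rfl
    · exact (le_of_lt h.base.d0_lt).trans h.dStar_le
  rw [pi1]
  calc 2 * ∑ j ∈ P.A0ᶜ, Phi (-(P.n * P.lam1 ε / (P.σ * ‖col P.X j‖)))
      ≤ 2 * ∑ j ∈ P.A0ᶜ, ε / N / 2 / max 1 (P.J1 ε) := by
        gcongr with j; exact hterm j
    _ = _ := by
        have hM : max 1 (P.J1 ε) ≠ 0 := (one_pos.trans_le (le_max_left _ _)).ne'
        have hN0 : N ≠ 0 := by linarith
        rw [Finset.sum_const, nsmul_eq_mul, hcard]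
        field_simp

lemma pi2_le (h : P.ExplicitAssumptions ε q lam2 a) :
    P.pi2 lam2 ≤ ε * (((P.d0 : ℝ) / (2 * a)) / max 1 (P.J2 ε a)) := by
  have hn : (0 : ℝ) < P.n := by exact_mod_cast h.n_pos
  have hσ := h.base.sigma_pos
  rcases Nat.eq_zero_or_pos P.d0 with hd | hd
  · have hA0 : IsEmpty P.A0 := by
      rw [Finset.isEmpty_coe_sort]; exact Finset.card_eq_zero.1 hd
    rw [pi2, Fintype.sum_empty, hd]
    simp
  · have ha1 : 1 ≤ a := (by exact_mod_cast hd : (1 : ℝ) ≤ P.d0).trans h.a_ge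
    have hL : 0 ≤ Real.log (a / ε) :=
      Real.log_nonneg ((one_le_div h.eps_pos).2 (h.eps_le_one.trans ha1))
    have hterm (j : P.A0) : Phi ((P.γ * lam2 - |P.β j.1|) / (P.σ * √(P.w0 j / P.n))) ≤
        ε / a / 2 / max 1 (P.J2 ε a) := by
      have hRB : RieszOn P.X P.A0 P.cLow P.cUp := h.base.src.rieszOn (le_of_lt h.base.d0_lt)
      obtain ⟨b, -, hb, hbw⟩ := exists_dual_vector h.n_pos hRB h.base.cLow_pos j
      have hb0 : b ≠ 0 := fun h0 => by
        have := hb j j.2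
        rw [h0, inner_zero_right, if_pos rfl] at this
        exact zero_ne_one this
      have hw : 0 < P.w0 j / P.n := by
        rw [w0, ← hbw]; positivity
      have hsig := h.signal j
      rw [show P.w0 j * (2 / (P.n : ℝ)) * Real.log (a / ε) =
        P.w0 j / P.n * (2 * Real.log (a / ε)) by ring, Real.sqrt_mul hw.le] at hsig
      have harg : (P.γ * lam2 - |P.β j.1|) / (P.σ * √(P.w0 j / P.n)) ≤
          -√(2 * Real.log (a / ε)) := by
        rw [div_le_iff₀ (by positivity)]
        linarith
      refine (Phi_mono harg).trans ((Phi_neg_sqrt_le hL).trans_eq ?_)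
      rw [Real.exp_neg, Real.exp_log (div_pos (by linarith) h.eps_pos), inv_div, J2]
    have hM : max 1 (P.J2 ε a) ≠ 0 := (one_pos.trans_le (le_max_left _ _)).ne'
    calc P.pi2 lam2 ≤ ∑ _j : P.A0, ε / a / 2 / max 1 (P.J2 ε a) :=
          Finset.sum_le_sum fun j _ => hterm j
      _ = P.d0 * (ε / a / 2 / max 1 (P.J2 ε a)) := by
          rw [Finset.sum_const, nsmul_eq_mul, Finset.card_univ, Fintype.card_coe, d0]
      _ = _ := by
          have ha0 : a ≠ 0 := by positivity
          field_simp

/-- The equation for `q` is what makes the binomial coefficient times the chi-square tail equal to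
`ε` up to the last factors: with `v = √(2 log q)` it reads
`C(p - d°, m) v^m exp (-m (v² - 1)/2) = ε`. -/
lemma pi3_le (h : P.ExplicitAssumptions ε q lam2 a) :
    P.pi3 (P.lam3 q) ≤ ε * ((√(4 * Real.log q))⁻¹ / max 1 (P.J3 q)) := by
  have hn : (0 : ℝ) < P.n := by exact_mod_cast h.n_pos
  have hσ := h.base.sigma_pos
  have hε := h.eps_pos
  obtain ⟨-, hs1, hq⟩ := h.pTilde
  obtain ⟨k, hk⟩ : ∃ k, P.m = k + 1 :=
    Nat.exists_eq_succ_of_ne_zero (Nat.sub_ne_zero_of_lt h.base.d0_lt)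
  set s := 2 * Real.log q with hs
  set v := √s with hv
  have hv2 : v ^ 2 = s := Real.sq_sqrt (by linarith)
  have hv1 : 1 ≤ v := Real.one_le_sqrt.2 hs1
  have hv0 : 0 < v := by linarith
  have hset : {x : ℝ | (P.m : ℝ) * P.n * P.lam3 q ^ 2 < P.σ ^ 2 * x} =
      {x | ((k + 1 : ℕ) : ℝ) * v ^ 2 < x} := by
    ext x
    have : (P.m : ℝ) * P.n * P.lam3 q ^ 2 = P.σ ^ 2 * (((k + 1 : ℕ) : ℝ) * v ^ 2) := by
      rw [lam3, mul_pow, Real.sq_sqrt (mul_nonneg (by positivity) (by linarith)), hk, hv2, hs]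
      field_simp
    rw [Set.mem_ofPred_eq, Set.mem_ofPred_eq, this]
    exact mul_lt_mul_iff_right₀ (by positivity)
  have hsqrt : √(4 * Real.log q) = √2 * v := by
    rw [hv, ← Real.sqrt_mul (by norm_num)]
    congr 1; rw [hs]; ring
  have hJ : P.J3 q = (v ^ 2 - 1 + 1 / ((k : ℝ) + 1)) * √((k + 1) * Real.pi) / (√2 * v) := by
    rw [J3, hsqrt, ← hs, hk, hv2]
    push_cast
    rfl
  have hC : (0 : ℝ) < ((P.p - P.d0).choose P.m : ℕ) := by
    exact_mod_cast Nat.choose_pos (Nat.sub_le_sub_right h.dStar_le _)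
  set C : ℝ := (((P.p - P.d0).choose P.m : ℕ) : ℝ) with hCdef
  have hval : C * (Real.exp (((k : ℝ) + 1) / 2) * radial k v) = ε / v := by
    have hlogC : Real.log C = ((k : ℝ) + 1) / 2 * (s - 1 - 2 * Real.log v) + Real.log ε := by
      rw [hk, one_div, Real.log_inv] at hq
      have h2 : Real.log s = 2 * Real.log v := by rw [← hv2, Real.log_pow]; norm_num
      rw [← h2, hq]
      push_cast
      field_simp
      ring
    have hpow : v ^ k * v = Real.exp (((k : ℝ) + 1) * Real.log v) := by
      rw [← pow_succ, ← Real.exp_log (pow_pos hv0 (k + 1)), Real.log_pow]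
      push_cast; rfl
    rw [eq_div_iff hv0.ne', radial, hv2]
    calc C * (Real.exp (((k : ℝ) + 1) / 2) * (v ^ k * Real.exp (-((k + 1) / 2) * s))) * v
        = Real.exp (Real.log C) * (Real.exp (((k : ℝ) + 1) / 2) *
            (v ^ k * v * Real.exp (-((k + 1) / 2) * s))) := by
          rw [Real.exp_log hC]; ring
      _ = Real.exp (Real.log ε) := by
          rw [hpow, ← Real.exp_add, ← Real.exp_add, ← Real.exp_add, hlogC]
          congr 1; ring
      _ = ε := Real.exp_log hε
  have htail := chiSq_tail_le (k := k) hv1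
  rw [← hJ] at htail
  rw [pi3, hset, hk]
  rw [hk] at hCdef
  rw [← hCdef]
  refine (mul_le_mul_of_nonneg_left htail hC.le).trans_eq ?_
  calc C * (Real.exp (((k : ℝ) + 1) / 2) * radial k v / √2 / max 1 (P.J3 q))
      = C * (Real.exp (((k : ℝ) + 1) / 2) * radial k v) / √2 / max 1 (P.J3 q) := by ring
    _ = _ := by
      have hM : max 1 (P.J3 q) ≠ 0 := (one_pos.trans_le (le_max_left _ _)).ne'
      rw [hval, hsqrt]
      field_simp

/-- The explicit bound, on the event that the penalty level is in its range. -/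
theorem real_notOracle_inter_le_explicitBound (h : P.ExplicitAssumptions ε q lam2 a) :
    P.μ.real (P.notOracle ∩ {ω | P.lam1 ε ≤ P.lamHat ω ∧ P.lamHat ω ≤ lam2}) ≤
      P.explicitBound ε q a := by
  have hn : (0 : ℝ) < P.n := by exact_mod_cast h.n_pos
  have hσ := h.base.sigma_pos
  rcases h.log_sub_div_nonneg.eq_or_lt with h0 | h0
  · -- Here `λ_{1,ε} = 0`, which forces `p - d° = ε = 1`, and the bound exceeds `1`.
    have hε : 1 ≤ ε := by
      have hpos : 0 < ((P.p : ℝ) - P.d0) / ε := div_pos (by linarith [h.one_le_sub]) h.eps_pos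
      have h1 := Real.eq_one_of_pos_of_log_eq_zero hpos h0.symm
      rw [div_eq_one_iff_eq h.eps_pos.ne'] at h1
      exact h1 ▸ h.one_le_sub
    refine measureReal_le_one.trans ?_
    have e2 : 0 ≤ ((P.d0 : ℝ) / (2 * a)) / max 1 (P.J2 ε a) :=
      div_nonneg h.d0_div_nonneg (zero_le_one.trans (le_max_left _ _))
    have e3 : 0 ≤ (√(4 * Real.log q))⁻¹ / max 1 (P.J3 q) :=
      div_nonneg (by positivity) (zero_le_one.trans (le_max_left _ _))
    have e1 : 1 / max 1 (P.J1 ε) = 1 := by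
      rw [J1, ← h0, mul_zero, Real.sqrt_zero, max_eq_left zero_le_one, div_one]
    rw [explicitBound, e1]
    nlinarith
  · have hlam1 : 0 < P.lam1 ε := by
      rw [lam1]; positivity
    have hlam3 : 0 ≤ P.lam3 q := by
      rw [lam3]; positivity
    refine (real_not_oracle_inter_le h.base hlam1 hlam3 h.lam2_ge).trans ?_
    rw [explicitBound]
    linarith [h.pi1_le, h.pi2_le, h.pi3_le]

end ExplicitAssumptions

end Problem

/-- Selection consistency along a sequence of problems. -/
theorem tendsto_real_supp_eq (P : ℕ → Problem.{u}) (ε q lam2 a : ℕ → ℝ)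
    (h : ∀ k, (P k).ExplicitAssumptions (ε k) (q k) (lam2 k) (a k))
    (hmeas : ∀ k, AEMeasurable (P k).lamHat (P k).μ)
    (hJ : Tendsto (fun k => max (ε k)⁻¹
      (min ((P k).J1 (ε k)) (min ((P k).J2 (ε k) (a k)) ((P k).J3 (q k))))) atTop atTop)
    (hR : Tendsto (fun k => (P k).μ.real
      {ω | (P k).lam1 (ε k) ≤ (P k).lamHat ω ∧ (P k).lamHat ω ≤ lam2 k}) atTop (𝓝 1)) :
    Tendsto (fun k => (P k).μ.real {ω | supp ((P k).betaHat ω) = (P k).A0}) atTop (𝓝 1) := by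
  set T : ℕ → ℝ := fun k => max (ε k)⁻¹
    (min ((P k).J1 (ε k)) (min ((P k).J2 (ε k) (a k)) ((P k).J3 (q k)))) with hT
  set R : ∀ k, Set (P k).Ω := fun k =>
    {ω | (P k).lam1 (ε k) ≤ (P k).lamHat ω ∧ (P k).lamHat ω ≤ lam2 k} with hRdef
  have hcompl (k : ℕ) : (P k).μ.real (R k)ᶜ = 1 - (P k).μ.real (R k) := by
    refine probReal_compl_eq_one_sub₀ ?_
    exact (hmeas k).nullMeasurableSet_preimage measurableSet_Icc
  have hlow (k : ℕ) : 1 - ((3 / 2 + 1 / √2) * (T k)⁻¹ + (1 - (P k).μ.real (R k))) ≤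
      (P k).μ.real {ω | supp ((P k).betaHat ω) = (P k).A0} := by
    have h1 := (P k).probWrongSelection_le
    have h2 := measureReal_le_inter_add_compl (P k).μ (P k).notOracle (R k)
    have h3 := (h k).real_notOracle_inter_le_explicitBound
    have h4 := (h k).explicitBound_le (min_le_left ((P k).J1 (ε k))
        (min ((P k).J2 (ε k) (a k)) ((P k).J3 (q k))))
      ((min_le_right _ _).trans (min_le_left _ _)) ((min_le_right _ _).trans (min_le_right _ _))
    have h5 : 1 ≤ (P k).μ.real {ω | supp ((P k).betaHat ω) = (P k).A0} +
        (P k).probWrongSelection := by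
      rw [← probReal_univ (μ := (P k).μ)]
      refine (measureReal_mono fun ω _ => ?_).trans (measureReal_union_le _ _)
      exact em _
    have h6 : (P k).probNotOracle = (P k).μ.real (P k).notOracle := rfl
    rw [hcompl k] at h2
    linarith
  have hlim : Tendsto (fun k => 1 - ((3 / 2 + 1 / √2) * (T k)⁻¹ + (1 - (P k).μ.real (R k))))
      atTop (𝓝 (1 - ((3 / 2 + 1 / √2) * 0 + (1 - 1)))) :=
    ((hJ.inv_tendsto_atTop.const_mul _).add (hR.const_sub 1)).const_sub 1
  rw [show (1 : ℝ) - ((3 / 2 + 1 / √2) * 0 + (1 - 1)) = 1 by ring] at hlim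
  exact tendsto_of_tendsto_of_tendsto_of_le_of_le hlim tendsto_const_nhds hlow
    fun k => measureReal_le_one

end PLUS

theorem theorem5 :
    -- (i) the general probability bound
    (∀ (P : PLUS.Problem.{u}) (lam1 lam2 lam3 : ℝ),
      0 < lam1 → 0 ≤ lam3 →
      P.Assumptions lam1 →
      max lam1 (√P.cUp / P.α * lam3) ≤ lam2 →
      (∀ j ∈ P.A0, P.γ * lam2 ≤ |P.β j|) →
      (∀ᵐ ω ∂P.μ, lam1 ≤ P.lamHat ω ∧ P.lamHat ω ≤ lam2) →
      P.probWrongSelection ≤ P.probNotOracle ∧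
        P.probNotOracle ≤ P.pi1 lam1 + P.pi2 lam2 + P.pi3 lam3) ∧
    -- (ii) the explicit bound
    (∀ (P : PLUS.Problem.{u}) (ε q lam2 a : ℝ),
      P.ExplicitAssumptions ε q lam2 a →
      (∀ᵐ ω ∂P.μ, P.lam1 ε ≤ P.lamHat ω ∧ P.lamHat ω ≤ lam2) →
      P.probWrongSelection ≤ P.probNotOracle ∧
        P.probNotOracle ≤
          ε * (1 / max 1 (P.J1 ε) + ((P.d0 : ℝ) / (2 * a)) / max 1 (P.J2 ε a) +
            (√(4 * Real.log q))⁻¹ / max 1 (P.J3 q)) ∧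
        ε * (1 / max 1 (P.J1 ε) + ((P.d0 : ℝ) / (2 * a)) / max 1 (P.J2 ε a) +
            (√(4 * Real.log q))⁻¹ / max 1 (P.J3 q)) ≤ (3 / 2 + 1 / √2) * ε) ∧
    -- (ii), consequence: selection consistency along a sequence of problems
    (∀ (P : ℕ → PLUS.Problem.{u}) (ε q lam2 a : ℕ → ℝ),
      (∀ k, (P k).ExplicitAssumptions (ε k) (q k) (lam2 k) (a k)) →
      (∀ k, AEMeasurable (P k).lamHat (P k).μ) →
      Tendsto (fun k => max (ε k)⁻¹
        (min ((P k).J1 (ε k)) (min ((P k).J2 (ε k) (a k)) ((P k).J3 (q k))))) atTop atTop →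
      Tendsto (fun k => (P k).μ.real
        {ω | (P k).lam1 (ε k) ≤ (P k).lamHat ω ∧ (P k).lamHat ω ≤ lam2 k}) atTop (𝓝 1) →
      Tendsto (fun k => (P k).μ.real {ω | PLUS.supp ((P k).betaHat ω) = (P k).A0})
        atTop (𝓝 1)) := by
  have hrange {P : PLUS.Problem.{u}} {l1 l2 : ℝ}
      (hr : ∀ᵐ ω ∂P.μ, l1 ≤ P.lamHat ω ∧ P.lamHat ω ≤ l2) :
      P.probNotOracle ≤ P.μ.real (P.notOracle ∩ {ω | l1 ≤ P.lamHat ω ∧ P.lamHat ω ≤ l2}) := by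
    have h := PLUS.measureReal_le_inter_add_compl P.μ P.notOracle
      {ω | l1 ≤ P.lamHat ω ∧ P.lamHat ω ≤ l2}
    have h0 : P.μ.real {ω | l1 ≤ P.lamHat ω ∧ P.lamHat ω ≤ l2}ᶜ = 0 := by
      rw [measureReal_def, mem_ae_iff.1 hr, ENNReal.toReal_zero]
    rw [h0, add_zero] at h
    exact h
  refine ⟨fun P lam1 lam2 lam3 h0 h3 hA hmax _ hr => ⟨P.probWrongSelection_le, ?_⟩,
    fun P ε q lam2 a h hr => ⟨P.probWrongSelection_le, ?_, ?_⟩,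
    PLUS.tendsto_real_supp_eq⟩
  · exact (hrange hr).trans (PLUS.Problem.real_not_oracle_inter_le hA h0 h3 hmax)
  · exact (hrange hr).trans h.real_notOracle_inter_le_explicitBound
  · have hK := h.explicitBound_le (K := min 0 (min (P.J1 ε) (min (P.J2 ε a) (P.J3 q))))
      ((min_le_right _ _).trans (min_le_left _ _))
      ((min_le_right _ _).trans ((min_le_right _ _).trans (min_le_left _ _)))
      ((min_le_right _ _).trans ((min_le_right _ _).trans (min_le_right _ _)))
    rwa [max_eq_left ((min_le_left _ _).trans (inv_nonneg.2 h.eps_pos.le)), inv_inv] at hK
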